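/- Work over $\mathbb C$. Let $\mathbb P^4=\{z_1+\dots+z_6=0\}\subset\mathbb P^5$ with the action of $\mathfrak S_6$ permuting the coordinates, and let $B=\{b=0\}$, $b=\sum z_i^4-\frac14\left(\sum z_i^2\right)^2$, be the Igusa quartic. For a nonzero quadratic form $a$ on $\mathbb P^4$, the pencil $\{\lambda a^2+\mu b=0\}$ is called an Igusa pencil, and its members are called $E_6$-quartic threefolds. Let $\mathbb V\subset|\mathcal O_{\mathbb P^4}(4)|=\mathbb P^{69}$ be the union of all Igusa pencils, a cone with vertex $B$ over the set $\mathbb V_2=\{2A : A\in|\mathcal O_{\mathbb P^4}(2)|\}$ of double quadrics, which parametrizes the Igusa pencils. Let $\mathcal X=\mathbb V/\!/\mathfrak S_6$ and $\mathcal P^I=\mathbb V_2/\!/\mathfrak S_6$ be the GIT quotients (the moduli spaces of $E_6$-quartic threefolds and of Igusa pencils). Let $\widetilde{\mathbb V}=\{(X,2A)\in\mathbb V\times\mathbb V_2 : X \text{ lies on the line through } B \text{ and } 2A\}$ be the blow-up of $\mathbb V$ at its vertex, with exceptional divisor $\widetilde E=\{(B,2A)\}$, and let $\widetilde{\mathcal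 X}=\widetilde{\mathbb V}/\!/\mathfrak S_6$. Then: 1. $\mathcal P^I$ and $\mathcal X$ are rational. 2. There is a dominant rational map $f:\mathcal X\dashrightarrow\mathcal P^I$ sending $[X]$, for general $X=\{\lambda a^2+\mu b=0\}$, to the class $[2A]$, $A=\{a=0\}$, of its Igusa pencil. It is a fibration in rational curves: for every point $y$ in a dense open subset of $\mathcal P^I$, the fibre over $y$ is an integral curve birational to $\mathbb P^1$ over the residue field of $y$. 3. The blow-down induces a birational map $\sigma:\widetilde{\mathcal X}\dashrightarrow\mathcal X$, $[(X,2A)]\mapsto[X]$, and $f'=f\circ\sigma:\widetilde{\mathcal X}\dashrightarrow\mathcal P^I$ has a rational section $\mathcal P^I\dashrightarrow\widetilde{\mathcal X}$, namely $[2A]\mapsto[(B,2A)]$, given by the exceptional divisor. 4. There is a birational map $\mathcal X\dashrightarrow\mathcal P^I\times\mathbb P^1$ over $\mathbb C$ whose composition with the first projection is $f$. -/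

import Mathlib

open CategoryTheory AlgebraicGeometry
open scoped TensorProduct

noncomputable section

/-! ## Quotients of projective varieties by linear actions of finite groups -/

/-- A cone in the complex vector space `E` that is stable under a linear action of `G`,
i.e. the affine cone over a `G`-stable subset of the projective space `ℙ(E)` of lines in `E`. -/
structure InvariantCone {G E : Type} [Group G] [AddCommGroup E] [Module ℂ E]
    (ρ : Representation ℂ G E) where
  /-- The underlying set of vectors. -/
  carrier : Set E
  smul_mem : ∀ (c : ℂ) {x : E}, x ∈ carrier → c • x ∈ carrier
  act_mem : ∀ (g : G) {x : E}, x ∈ carrier → ρ g x ∈ carrier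

namespace InvariantCone

variable {G E : Type} [Group G] [AddCommGroup E] [Module ℂ E] {ρ : Representation ℂ G E}
  (C : InvariantCone ρ)

/-- Scalar multiplication on the cone. -/
def scale (c : ℂ) (x : C.carrier) : C.carrier := ⟨c • (x : E), C.smul_mem c x.2⟩

/-- The action of the group on the cone. -/
def act (g : G) (x : C.carrier) : C.carrier := ⟨ρ g (x : E), C.act_mem g x.2⟩

/-- The homogeneous coordinate ring of the projective variety with affine cone `C`: the ring of
functions on the cone that are restrictions of polynomial functions on the ambient space. -/
def coordRing : Subalgebra ℂ (C.carrier → ℂ) :=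
  Algebra.adjoin ℂ (Set.range fun (φ : Module.Dual ℂ E) (x : C.carrier) => φ x)

/-- The subring of `G`-invariant elements of the homogeneous coordinate ring. -/
def invariantRing : Subalgebra ℂ (C.carrier → ℂ) where
  carrier := {F | F ∈ C.coordRing ∧ ∀ g x, F (C.act g x) = F x}
  mul_mem' hF hH := ⟨mul_mem hF.1 hH.1, fun g x => by simp [hF.2 g x, hH.2 g x]⟩
  add_mem' hF hH := ⟨add_mem hF.1 hH.1, fun g x => by simp [hF.2 g x, hH.2 g x]⟩
  algebraMap_mem' r := ⟨C.coordRing.algebraMap_mem r, fun _ _ => rfl⟩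

/-- The homogeneous elements of degree `n` of the ring of all functions on the cone. -/
def homogFun (n : ℕ) : Submodule ℂ (C.carrier → ℂ) where
  carrier := {F | ∀ c x, F (C.scale c x) = c ^ n * F x}
  add_mem' hF hH c x := by simp [hF c x, hH c x, mul_add]
  zero_mem' c x := by simp
  smul_mem' r F hF c x := by simp [hF c x]; ring

/-- The invariants of degree `n`. -/
def invariantPart (n : ℕ) : Submodule ℂ C.invariantRing :=
  (C.homogFun n).comap C.invariantRing.val.toLinearMap

lemma mem_invariantPart {n : ℕ} {F : C.invariantRing} :
    F ∈ C.invariantPart n ↔ ∀ c x, F.1 (C.scale c x) = c ^ n * F.1 x := Iff.rfl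

lemma coeff_eq_zero {s : Finset ℕ} {a : ℕ → ℂ} (h : ∀ c : ℂ, ∑ n ∈ s, c ^ n * a n = 0) :
    ∀ n ∈ s, a n = 0 := by
  have hp : (∑ n ∈ s, Polynomial.monomial n (a n)) = 0 := by
    apply Polynomial.funext
    intro c
    simpa [Polynomial.eval_finsetSum, mul_comm] using h c
  intro n hn
  have h1 := congrArg (fun p => Polynomial.coeff p n) hp
  simpa [Polynomial.finsetSum_coeff, Polynomial.coeff_monomial, hn] using h1

lemma coordRing_le_iSup (F : C.carrier → ℂ) (hF : F ∈ C.coordRing) :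
    F ∈ ⨆ n, (C.homogFun n ⊓ Subalgebra.toSubmodule C.coordRing) := by
  unfold coordRing at hF
  induction hF using Algebra.adjoin_induction with
  | mem F hF =>
    refine Submodule.mem_iSup_of_mem 1 ⟨?_, Algebra.subset_adjoin hF⟩
    obtain ⟨φ, rfl⟩ := hF
    intro c x
    simp [scale]
  | algebraMap r =>
    refine Submodule.mem_iSup_of_mem 0 ⟨?_, C.coordRing.algebraMap_mem r⟩
    intro c x
    simp
  | add F H _ _ h1 h2 => exact add_mem h1 h2
  | mul F H m1 m2 h1 h2 =>
    clear m1 m2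
    induction h1 using Submodule.iSup_induction' with
    | zero => simp
    | add F1 F2 _ _ k1 k2 => rw [add_mul]; exact add_mem k1 k2
    | mem i F1 hF1 =>
      induction h2 using Submodule.iSup_induction' with
      | zero => simp
      | add H1 H2 _ _ k1 k2 => rw [mul_add]; exact add_mem k1 k2
      | mem j H1 hH1 =>
        refine Submodule.mem_iSup_of_mem (i + j) ⟨?_, C.coordRing.mul_mem hF1.2 hH1.2⟩
        intro c x
        simp only [Pi.mul_apply, hF1.1 c x, hH1.1 c x]
        ring

instance : CommRing C.invariantRing := Subalgebra.toCommRing _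

instance (n : ℕ) : AddCommGroup (C.invariantPart n) := Submodule.addCommGroup _

lemma isInternal_invariantPart : DirectSum.IsInternal C.invariantPart := by
  classical
  constructor
  · rw [injective_iff_map_eq_zero]
    intro f hf
    rw [DirectSum.coeAddMonoidHom_eq_dfinsuppSum] at hf
    ext n x
    change ((f n).1).1 x = 0
    by_cases hn : n ∈ DFinsupp.support f
    · refine coeff_eq_zero (s := DFinsupp.support f) (a := fun n => (f n).1.1 x) ?_ n hn
      intro c
      have h1 := congrFun (congrArg Subtype.val hf) (C.scale c x)
      rw [DFinsupp.sum] at h1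
      simp only [AddSubmonoidClass.coe_finsetSum, Finset.sum_apply] at h1
      refine Eq.trans (Finset.sum_congr rfl fun m _ => ((f m).2 c x).symm) h1
    · rw [DFinsupp.notMem_support_iff.mp hn]; rfl
  · intro F
    obtain ⟨p, hp, hpF⟩ := (Submodule.mem_iSup_iff_exists_finsupp _ _).mp
      (C.coordRing_le_iSup F.1 F.2.1)
    have hscale : ∀ c x, F.1 (C.scale c x) = ∑ n ∈ p.support, c ^ n * p n x := by
      intro c x
      rw [← hpF, Finsupp.sum, Finset.sum_apply]
      exact Finset.sum_congr rfl fun n _ => (hp n).1 c x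
    have hinv : ∀ n g x, p n (C.act g x) = p n x := by
      intro n g x
      by_cases hn : n ∈ p.support
      · have := coeff_eq_zero (s := p.support) (a := fun n => p n (C.act g x) - p n x) (by
          intro c
          have h1 := F.2.2 g (C.scale c x)
          have h2 : C.act g (C.scale c x) = C.scale c (C.act g x) := by
            simp [act, scale]
          rw [h2, hscale, hscale] at h1
          simp only [mul_sub, Finset.sum_sub_distrib]
          rw [h1, sub_self]) n hn
        exact sub_eq_zero.mp this
      · simp [Finsupp.notMem_support_iff.mp hn]
    let q : ∀ n, C.invariantPart n := fun n => ⟨⟨p n, (hp n).2, hinv n⟩, (hp n).1⟩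
    refine ⟨∑ n ∈ p.support, DirectSum.of (fun n => C.invariantPart n) n (q n), ?_⟩
    rw [map_sum]
    apply Subtype.ext
    simp only [DirectSum.coeAddMonoidHom_of, AddSubmonoidClass.coe_finsetSum]
    exact hpF

instance : SetLike.GradedMonoid C.invariantPart where
  one_mem c x := by simp
  mul_mem i j F H hF hH c x := by
    have h1 := hF c x
    have h2 := hH c x
    simp only [Subalgebra.coe_val, AlgHom.toLinearMap_apply, MulMemClass.coe_mul,
      Pi.mul_apply] at h1 h2 ⊢
    rw [h1, h2]
    ring

/-- The grading of the invariant ring. -/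
instance : GradedAlgebra C.invariantPart where
  toDecomposition := C.isInternal_invariantPart.chooseDecomposition

end InvariantCone

/-- The structure morphism `Proj A ⟶ Spec k` of the projective spectrum of a graded `k`-algebra. -/
def projToSpec {A : Type} (k : CommRingCat.{0}) [CommRing A] [Algebra k A] (𝒜 : ℕ → Submodule k A)
    [GradedAlgebra 𝒜] : Proj 𝒜 ⟶ Spec k :=
  Proj.toSpecZero 𝒜 ≫ Spec.map (CommRingCat.ofHom (algebraMap k (𝒜 0)))

namespace InvariantCone

variable {G E : Type} [Group G] [AddCommGroup E] [Module ℂ E] {ρ : Representation ℂ G E}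
  (C : InvariantCone ρ)

/-- The GIT quotient by the finite group `G` of the projective variety with affine cone `C`,
linearised by `𝒪(1)`: the projective spectrum of the ring of invariants. -/
abbrev quotient : Scheme := Proj C.invariantPart

/-- The structure morphism of the quotient. -/
def quotientToSpec : C.quotient ⟶ Spec (.of ℂ) := projToSpec (.of ℂ) C.invariantPart

lemma exists_polynomial (F : C.carrier → ℂ) (hF : F ∈ C.coordRing) (x : C.carrier) :
    ∃ P : Polynomial ℂ, ∀ c, F (C.scale c x) = P.eval c := by
  unfold coordRing at hF
  induction hF using Algebra.adjoin_induction with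
  | mem F hF =>
    obtain ⟨φ, rfl⟩ := hF
    exact ⟨Polynomial.C (φ x) * Polynomial.X, fun c => by simp [scale]; ring⟩
  | algebraMap r => exact ⟨Polynomial.C r, fun c => by simp⟩
  | add F H _ _ h1 h2 =>
    obtain ⟨P, hP⟩ := h1
    obtain ⟨Q, hQ⟩ := h2
    exact ⟨P + Q, fun c => by simp [hP, hQ]⟩
  | mul F H _ _ h1 h2 =>
    obtain ⟨P, hP⟩ := h1
    obtain ⟨Q, hQ⟩ := h2
    exact ⟨P * Q, fun c => by simp [hP, hQ]⟩

/-- The ideal of all invariants vanishing on the line spanned by `x`. -/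
def lineIdeal (x : C.carrier) : Ideal C.invariantRing where
  carrier := {F | ∀ c, F.1 (C.scale c x) = 0}
  add_mem' hF hH c := by simp [hF c, hH c]
  zero_mem' c := by simp
  smul_mem' r F hF c := by simp [hF c]

lemma lineIdeal_isPrime (x : C.carrier) : (C.lineIdeal x).IsPrime := by
  refine ⟨fun h => ?_, fun {F H} hFH => ?_⟩
  · have h1 := (Ideal.eq_top_iff_one _).mp h 1
    simp at h1
  · obtain ⟨P, hP⟩ := C.exists_polynomial F.1 F.2.1 x
    obtain ⟨Q, hQ⟩ := C.exists_polynomial H.1 H.2.1 x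
    have hPQ : P * Q = 0 := by
      apply Polynomial.funext
      intro c
      have := hFH c
      simpa [hP, hQ] using this
    rcases mul_eq_zero.mp hPQ with h | h
    · exact Or.inl fun c => by simp [hP, h]
    · exact Or.inr fun c => by simp [hQ, h]

lemma lineIdeal_isHomogeneous (x : C.carrier) :
    (C.lineIdeal x).IsHomogeneous C.invariantPart := by
  classical
  intro n F hF c
  by_cases hn : n ∈ (DirectSum.decompose C.invariantPart F).support
  · have h0 : ((DirectSum.decompose C.invariantPart F n).1).1 x = 0 := by
      refine coeff_eq_zero (s := (DirectSum.decompose C.invariantPart F).support)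
        (a := fun n => ((DirectSum.decompose C.invariantPart F n).1).1 x) ?_ n hn
      intro c
      have h1 := hF c
      rw [← DirectSum.sum_support_decompose C.invariantPart F] at h1
      simp only [AddSubmonoidClass.coe_finsetSum, Finset.sum_apply] at h1
      refine Eq.trans (Finset.sum_congr rfl fun m _ => ?_) h1
      exact ((DirectSum.decompose C.invariantPart F m).2 c x).symm
    have h2 := (DirectSum.decompose C.invariantPart F n).2 c x
    exact h2.trans (by rw [AlgHom.toLinearMap_apply, Subalgebra.coe_val, h0, mul_zero])
  · rw [DFinsupp.notMem_support_iff.mp hn]; rfl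

lemma irrelevant_not_le_lineIdeal [Finite G] (x : C.carrier) (hx : (x : E) ≠ 0) :
    ¬ HomogeneousIdeal.irrelevant C.invariantPart ≤
      (⟨C.lineIdeal x, C.lineIdeal_isHomogeneous x⟩ : HomogeneousIdeal C.invariantPart) := by
  classical
  have := Fintype.ofFinite G
  have hne : ∀ g : G, ρ g (x : E) ≠ 0 := by
    intro g h
    apply hx
    have h1 := congrArg (ρ g⁻¹) h
    simpa using h1
  obtain ⟨φ, hφ⟩ := Module.exists_dual_forall_apply_ne_zero (K := ℂ)
    (fun g : G => ρ g (x : E)) hne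
  let F : C.carrier → ℂ := ∏ g : G, fun y : C.carrier => φ (ρ g (y : E))
  have hF : ∀ y, F y = ∏ g : G, φ (ρ g (y : E)) := fun y => by simp [F]
  have hmem : F ∈ C.coordRing :=
    prod_mem fun g _ => Algebra.subset_adjoin ⟨φ.comp (ρ g), rfl⟩
  have hinv : ∀ g y, F (C.act g y) = F y := by
    intro g y
    rw [hF, hF]
    refine Fintype.prod_equiv (Equiv.mulRight g) _ _ fun h => ?_
    simp [act]
  have hdeg : (⟨F, hmem, hinv⟩ : C.invariantRing) ∈ C.invariantPart (Fintype.card G) := by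
    intro c y
    change F (C.scale c y) = c ^ _ * F y
    rw [hF, hF]
    simp [scale, Finset.prod_mul_distrib, Finset.card_univ]
  intro hle
  have h1 := hle (HomogeneousIdeal.mem_irrelevant_of_mem _ Fintype.card_pos hdeg) 1
  change F (C.scale 1 x) = 0 at h1
  rw [hF, Finset.prod_eq_zero_iff] at h1
  obtain ⟨g, -, hg⟩ := h1
  exact hφ g (by simpa [scale] using hg)

/-- The point `[x]` of the quotient that is the image of the point of the projective variety
spanned by the nonzero vector `x` of the cone. -/
def point [Finite G] (x : E) (hx : x ∈ C.carrier) (h0 : x ≠ 0) : C.quotient where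
  asHomogeneousIdeal := ⟨C.lineIdeal ⟨x, hx⟩, C.lineIdeal_isHomogeneous ⟨x, hx⟩⟩
  isPrime := C.lineIdeal_isPrime ⟨x, hx⟩
  not_irrelevant_le := C.irrelevant_not_le_lineIdeal ⟨x, hx⟩ h0

end InvariantCone

/-! ## The projective line, rational varieties, fibrations in rational curves -/

attribute [local instance] MvPolynomial.gradedAlgebra

/-- The projective line over the ring `k`. -/
abbrev projLine (k : CommRingCat.{0}) : Scheme :=
  Proj (MvPolynomial.homogeneousSubmodule (Fin 2) k)

/-- The structure morphism of the projective line. -/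
def projLineToSpec (k : CommRingCat.{0}) : projLine k ⟶ Spec k :=
  projToSpec k (MvPolynomial.homogeneousSubmodule (Fin 2) k)

/-- The scheme `X` over `ℂ` is rational: it is birational over `ℂ` to an affine space of finite
dimension. -/
def IsRationalVariety {X : Scheme.{0}} (sX : X ⟶ Spec (.of ℂ)) : Prop :=
  ∃ n : ℕ, Scheme.BirationalOver sX (𝔸(Fin n; Spec (.of ℂ)) ↘ Spec (.of ℂ))

/-- `g ∘ f = h` as rational maps: on a dense open subset `W`, the map `f` is defined with values in
the domain of `g`, the map `h` is defined, and the composition agrees with `h`. -/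
def IsRationalComp {X Y Z : Scheme.{0}} (f : X.PartialMap Y) (g : Y.PartialMap Z)
    (h : X.PartialMap Z) : Prop :=
  ∃ (W : X.Opens) (_ : Dense (W : Set X)) (h₁ : W ≤ f.domain) (h₂ : W ≤ h.domain)
    (k : W.toScheme ⟶ g.domain.toScheme),
    k ≫ g.domain.ι = X.homOfLE h₁ ≫ f.hom ∧ k ≫ g.hom = X.homOfLE h₂ ≫ h.hom

/-- A partial map is a fibration in rational curves: it is dominant, and the fibre over every
point `y` (generic or closed) of some dense open subset of the target is an integral curve over
the residue field `κ(y)` that is birational to the projective line over `κ(y)`. -/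
def IsRationalCurveFibration {X Y : Scheme.{0}} (f : X.PartialMap Y) : Prop :=
  IsDominant f.hom ∧ ∃ W : Y.Opens, Dense (W : Set Y) ∧ ∀ y ∈ W,
    IsIntegral (f.hom.fiber y) ∧
      Scheme.BirationalOver (f.hom.fiberToSpecResidueField y) (projLineToSpec (Y.residueField y))

/-! ## Igusa pencils and quartic threefolds -/

namespace Igusa

/-- The hyperplane `z₁ + ⋯ + z₆ = 0` in `ℂ⁶`; its projectivisation is `ℙ⁴`. -/
def hyperplane : Submodule ℂ (Fin 6 → ℂ) where
  carrier := {z | ∑ i, z i = 0}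
  add_mem' hz hw := by
    simp only [Set.mem_ofPred_eq, Pi.add_apply, Finset.sum_add_distrib] at *
    rw [hz, hw, add_zero]
  zero_mem' := by simp
  smul_mem' c z hz := by
    simp only [Set.mem_ofPred_eq, Pi.smul_apply, smul_eq_mul, ← Finset.mul_sum] at *
    rw [hz, mul_zero]

/-- Restriction of polynomials in six variables to the hyperplane, as functions. -/
def restrict : MvPolynomial (Fin 6) ℂ →ₗ[ℂ] (hyperplane → ℂ) where
  toFun p z := MvPolynomial.eval (z : Fin 6 → ℂ) p
  map_add' p q := by ext; simp
  map_smul' c p := by ext; simp [MvPolynomial.smul_eval]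

/-- The space `H⁰(ℙ⁴, 𝒪(d))` of forms of degree `d` on the hyperplane. -/
def Forms (d : ℕ) : Submodule ℂ (hyperplane → ℂ) :=
  (MvPolynomial.homogeneousSubmodule (Fin 6) ℂ d).map restrict

/-- Permutation of coordinates, on the hyperplane. -/
def permute (σ : Equiv.Perm (Fin 6)) (z : hyperplane) : hyperplane :=
  ⟨fun i => (z : Fin 6 → ℂ) (σ i), (Equiv.sum_comp σ (z : Fin 6 → ℂ)).trans z.2⟩

/-- The action of the symmetric group `𝔖₆` on forms, by permutation of the coordinates. -/
def permForms (d : ℕ) : Representation ℂ (Equiv.Perm (Fin 6)) (Forms d) where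
  toFun σ :=
    { toFun := fun F => ⟨fun z => F.1 (permute σ z), by
        obtain ⟨p, hp, hpF⟩ := F.2
        refine ⟨MvPolynomial.rename σ p, ?_, ?_⟩
        · exact (MvPolynomial.IsHomogeneous.rename_isHomogeneous hp :)
        · rw [← hpF]
          funext z
          simp only [restrict, LinearMap.coe_mk, AddHom.coe_mk, MvPolynomial.eval_rename]
          rfl⟩
      map_add' := fun _ _ => rfl
      map_smul' := fun _ _ => rfl }
  map_one' := rfl
  map_mul' _ _ := rfl

/-- The square `a²` of a quadratic form. -/
def sq (a : Forms 2) : Forms 4 :=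
  ⟨a.1 * a.1, by
    obtain ⟨p, hp, hpa⟩ := a.2
    refine ⟨p * p, ?_, ?_⟩
    · exact MvPolynomial.IsHomogeneous.mul hp hp
    · rw [← hpa]
      funext z
      simp [restrict]⟩

/-- The equation `b = ∑ zᵢ⁴ - (1/4) (∑ zᵢ²)²` of the Igusa quartic `B`. -/
def b : Forms 4 :=
  ⟨fun z => ∑ i, (z : Fin 6 → ℂ) i ^ 4 - 1 / 4 * (∑ i, (z : Fin 6 → ℂ) i ^ 2) ^ 2, by
    refine ⟨∑ i, MvPolynomial.X i ^ 4
      - MvPolynomial.C (1 / 4) * (∑ i, MvPolynomial.X i ^ 2) ^ 2, ?_, ?_⟩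
    · refine Submodule.sub_mem _ (Submodule.sum_mem _ fun i _ => ?_) ?_
      · exact MvPolynomial.isHomogeneous_X_pow i 4
      · refine (MvPolynomial.mem_homogeneousSubmodule _ _).mpr ?_
        have h : (∑ i : Fin 6, (MvPolynomial.X i : MvPolynomial (Fin 6) ℂ) ^ 2).IsHomogeneous 2 :=
          MvPolynomial.IsHomogeneous.sum _ _ _ fun i _ => MvPolynomial.isHomogeneous_X_pow i 2
        simpa using (MvPolynomial.isHomogeneous_C (Fin 6) (1 / 4 : ℂ)).mul (h.pow 2)
    · funext z
      simp [restrict]⟩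

/-- The member `λ a² + μ b` of the Igusa pencil spanned by the double quadric `2A = div(a²)` and
the Igusa quartic `B = div(b)`. -/
def quartic (a : Forms 2) (l m : ℂ) : Forms 4 := l • sq a + m • b

lemma perm_sq (σ : Equiv.Perm (Fin 6)) (a : Forms 2) :
    permForms 4 σ (sq a) = sq (permForms 2 σ a) := rfl

lemma perm_b (σ : Equiv.Perm (Fin 6)) : permForms 4 σ b = b := by
  apply Subtype.ext
  funext z
  change (∑ i, (z : Fin 6 → ℂ) (σ i) ^ 4 - 1 / 4 * (∑ i, (z : Fin 6 → ℂ) (σ i) ^ 2) ^ 2) =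
    ∑ i, (z : Fin 6 → ℂ) i ^ 4 - 1 / 4 * (∑ i, (z : Fin 6 → ℂ) i ^ 2) ^ 2
  rw [Equiv.sum_comp σ (fun i => (z : Fin 6 → ℂ) i ^ 4),
    Equiv.sum_comp σ (fun i => (z : Fin 6 → ℂ) i ^ 2)]

lemma perm_quartic (σ : Equiv.Perm (Fin 6)) (a : Forms 2) (l m : ℂ) :
    permForms 4 σ (quartic a l m) = quartic (permForms 2 σ a) l m := by
  simp [quartic, perm_sq, perm_b]

lemma smul_quartic (c : ℂ) (a : Forms 2) (l m : ℂ) :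
    c • quartic a l m = quartic a (c * l) (c * m) := by
  simp [quartic, smul_smul]

/-- The affine cone over `𝕍 ⊂ |𝒪(4)|`, the union of all Igusa pencils. -/
def coneV : InvariantCone (permForms 4) where
  carrier := {v | ∃ a l m, v = quartic a l m}
  smul_mem := by
    rintro c _ ⟨a, l, m, rfl⟩
    exact ⟨a, c * l, c * m, smul_quartic c a l m⟩
  act_mem := by
    rintro σ _ ⟨a, l, m, rfl⟩
    exact ⟨permForms 2 σ a, l, m, perm_quartic σ a l m⟩

/-- The affine cone over `𝕍₂ ⊂ 𝕍`, the set of all double quadrics, which parametrises the Igusa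
pencils. -/
def coneV2 : InvariantCone (permForms 4) where
  carrier := {v | ∃ a l, v = quartic a l 0}
  smul_mem := by
    rintro c _ ⟨a, l, rfl⟩
    exact ⟨a, c * l, by simp [smul_quartic]⟩
  act_mem := by
    rintro σ _ ⟨a, l, rfl⟩
    exact ⟨permForms 2 σ a, l, perm_quartic σ a l 0⟩

/-- The affine cone over the blow-up `{(x, p) ∈ 𝕍 × 𝕍₂ | x lies on the line through B and p}` of
the cone `𝕍` at its vertex `B` (the closure of the graph of the projection of `𝕍` from its vertex
onto `𝕍₂`), Segre embedded. Its points are the lines spanned by `(λ a² + μ b) ⊗ a²`, and its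
exceptional divisor is the set of those with `λ = 0`. -/
def coneBlowup : InvariantCone (E := Forms 4 ⊗[ℂ] Forms 4)
    ((permForms 4).tprod (permForms 4)) where
  carrier := {v | ∃ a l m, v = quartic a l m ⊗ₜ[ℂ] sq a}
  smul_mem := by
    rintro c _ ⟨a, l, m, rfl⟩
    exact ⟨a, c * l, c * m, by rw [TensorProduct.smul_tmul', smul_quartic]⟩
  act_mem := by
    rintro σ _ ⟨a, l, m, rfl⟩
    refine ⟨permForms 2 σ a, l, m, ?_⟩
    rw [Representation.tprod_apply, TensorProduct.map_tmul, perm_quartic, perm_sq]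

/-- The moduli space `𝒳 = 𝕍 // 𝔖₆` of `E₆`-quartic threefolds. -/
abbrev moduliX : Scheme := coneV.quotient

/-- The moduli space `𝒫ᴵ = 𝕍₂ // 𝔖₆` of Igusa pencils. -/
abbrev moduliP : Scheme := coneV2.quotient

/-- The quotient by `𝔖₆` of the blow-up of `𝕍` at its vertex. -/
abbrev moduliBlowup : Scheme := coneBlowup.quotient

lemma sq_ne_zero {a : Forms 2} (ha : a ≠ 0) : sq a ≠ 0 := by
  intro h
  apply ha
  apply Subtype.ext
  funext z
  have h1 := congrFun (congrArg Subtype.val h) z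
  exact mul_self_eq_zero.mp h1

lemma tmul_ne_zero {v w : Forms 4} (hv : v ≠ 0) (hw : w ≠ 0) : v ⊗ₜ[ℂ] w ≠ 0 := by
  intro h
  obtain ⟨φ, hφ⟩ := Module.exists_dual_forall_apply_ne_zero (K := ℂ) (fun _ : Unit => v)
    fun _ => hv
  obtain ⟨ψ, hψ⟩ := Module.exists_dual_forall_apply_ne_zero (K := ℂ) (fun _ : Unit => w)
    fun _ => hw
  have h1 := congrArg (LinearMap.mul' ℂ ℂ ∘ₗ TensorProduct.map φ ψ) h
  simp only [LinearMap.comp_apply, TensorProduct.map_tmul, LinearMap.mul'_apply, map_zero,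
    mul_eq_zero] at h1
  exact h1.elim (hφ ()) (hψ ())

/-- The moduli point `[X]` of the quartic threefold `X = div(λ a² + μ b)`. -/
def pointX (a : Forms 2) (l m : ℂ) (h : quartic a l m ≠ 0) : moduliX :=
  coneV.point (quartic a l m) ⟨a, l, m, rfl⟩ h

/-- The moduli point `[P]` of the Igusa pencil `P` spanned by `2A = div(a²)` and `B`. -/
def pointP (a : Forms 2) (ha : a ≠ 0) : moduliP :=
  coneV2.point (sq a) ⟨a, 1, by simp [quartic]⟩ (sq_ne_zero ha)

/-- The image in the quotient of the point `(div(λ a² + μ b), 2A)` of the blown-up cone. -/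
def pointBlowup (a : Forms 2) (ha : a ≠ 0) (l m : ℂ) (h : quartic a l m ≠ 0) : moduliBlowup :=
  coneBlowup.point (quartic a l m ⊗ₜ[ℂ] sq a) ⟨a, l, m, rfl⟩
    (tmul_ne_zero h (sq_ne_zero ha))

end Igusa

end

/-! On the hyperplane `∑ zᵢ = 0` each square `z_k²` equals `-∑_{l ≠ k} z_k z_l`, so a quadratic form
`a` is the same thing as a weighting `c_kl` of the fifteen edges of the complete graph on six
vertices, and `𝔖₆` permutes the vertices. Let `x_k = ∑_l c_kl` be the vertex weights and normalise
`∑ x_k = 1`; this fixes the scalar, including the sign that `a²` forgets. When the `x_k` are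
distinct, Lagrange interpolation recovers `c` from the moments `∑ c_kl x_k^p x_l^q` with `p, q ≤ 4`.
Those with `p = 0` are power sums of the weights, and the moment of type `(1,4)` is a function of
the others because the divided difference of `∏ (t - x_k)` vanishes at pairs of distinct nodes. Nine
moments and the elementary symmetric functions `e₂, …, e₆` of the weights remain. After inverting an
invariant denominator `F` divisible by the discriminant, they present the ring `R` of invariants of
normalised forms as a localisation of a polynomial ring in fourteen variables (`exists_invCoord_eq`,
`exists_eval_invCoord_eq`, `exists_isLocalization`). Hence `Spec R` is a dense open part of affine
space, and it is a chart of `𝒫ᴵ`.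

Since `b` is invariant, `(a, m) ↦ a² + m b` with `a` normalised should give a chart `Spec R[T]` of
`𝒳`, and `(a, c) ↦ (c a² + b) ⊗ a²` a chart `Spec R[T]` of the quotient of the blow-up. In these
charts `f` is the projection to `Spec R`, the blow-down is `T ↦ T⁻¹`, the exceptional divisor is `T
= 0`, and the product with `ℙ¹` is visible. All assertions follow formally from the three charts
(`exists_maps_of_charts`).

The work is to show that these are charts of `Proj` of the actual invariant rings: the available
functions are polynomials in the coefficients of the quartic, so every even function of `a` has to
be expressed, up to powers of `F`, through linear functions of `a²` that kill `b` (the algebra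
`sqFun`). This is done along a singular line of the Igusa quartic. There `b` vanishes to second
order, so the expansion of `a²` to first order is visible modulo `b`; in second order the
coefficients of `b` are so special that enough combinations kill `b` (`lineFun_mul_lineFun_mem`,
`evenFun_le_lineClosure`). Multiplying conjugates makes the denominator invariant
(`nonempty_denominator`). -/

noncomputable section

attribute [local instance] MvPolynomial.gradedAlgebra

/-! ## Charts of projective spectra -/

section ProjCharts

variable {k : CommRingCat.{0}} {A : Type} [CommRing A] [Algebra k A] (𝒜 : ℕ → Submodule k A)
  [GradedAlgebra 𝒜]

/-- The zero ideal is a point of `Proj`, the element `f` witnessing that it is relevant, and this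
generic point lies in every nonempty basic open set. -/
lemma Proj.isDominant_awayι [IsDomain A] {f : A} {m : ℕ} (hf : f ∈ 𝒜 m) (hm : 0 < m)
    (h0 : f ≠ 0) : IsDominant (Proj.awayι 𝒜 f hf hm) := by
  let η : Proj 𝒜 :=
    { asHomogeneousIdeal := ⊥
      isPrime := by
        rw [HomogeneousIdeal.toIdeal_bot]
        exact Ideal.isPrime_bot
      not_irrelevant_le := fun hle => h0 (by
        have h1 := hle (HomogeneousIdeal.mem_irrelevant_of_mem 𝒜 hm hf)
        exact (Submodule.mem_bot A).mp h1) }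
  have hmem : ∀ g : A, g ≠ 0 → η ∈ Proj.basicOpen 𝒜 g := by
    intro g hg
    rw [Proj.mem_basicOpen]
    intro h
    apply hg
    have h2 : g ∈ (⊥ : HomogeneousIdeal 𝒜) := h
    exact (Submodule.mem_bot A).mp h2
  refine ⟨?_⟩
  have hr : Set.range (Proj.awayι 𝒜 f hf hm) = (Proj.basicOpen 𝒜 f : Set (Proj 𝒜)) := by
    rw [← Proj.opensRange_awayι 𝒜 f hf hm]
    rfl
  rw [DenseRange, hr, dense_iff_inter_open]
  intro U hU ⟨x, hx⟩
  have hx' : x ∈ (⟨U, hU⟩ : TopologicalSpace.Opens (Proj 𝒜)) := hx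
  obtain ⟨V, ⟨g, rfl⟩, hxV, hVU⟩ :=
    TopologicalSpace.Opens.isBasis_iff_nbhd.mp (Proj.isBasis_basicOpen 𝒜) hx'
  have hg : g ≠ 0 := by
    rintro rfl
    rw [Proj.basicOpen_zero] at hxV
    exact hxV
  exact ⟨η, hVU (hmem g hg), hmem f h0⟩

lemma Proj.awayι_projToSpec {f : A} {m : ℕ} (hf : f ∈ 𝒜 m) (hm : 0 < m) :
    Proj.awayι 𝒜 f hf hm ≫ projToSpec k 𝒜 = Spec.map (CommRingCat.ofHom
      ((HomogeneousLocalization.fromZeroRingHom 𝒜 (.powers f)).comp (algebraMap k (𝒜 0)))) := by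
  rw [projToSpec, Proj.awayι_toSpecZero_assoc, ← Spec.map_comp]
  rfl

end ProjCharts

lemma MvPolynomial.IsHomogeneous.eval₂_smul {σ R S : Type*} [CommSemiring R] [CommSemiring S]
    {p : MvPolynomial σ R} {n : ℕ} (hp : p.IsHomogeneous n) (f : R →+* S) (g : σ → S) (c : S) :
    p.eval₂ f (fun i => c * g i) = c ^ n * p.eval₂ f g := by
  rw [MvPolynomial.eval₂_eq, MvPolynomial.eval₂_eq, Finset.mul_sum]
  refine Finset.sum_congr rfl fun d hd => ?_
  have h1 : d.degree = n := by
    by_contra h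
    exact (MvPolynomial.mem_support_iff.mp hd) (hp.coeff_eq_zero h)
  simp only [mul_pow, Finset.prod_mul_distrib]
  rw [Finset.prod_pow_eq_pow_sum]
  have h2 : ∑ i ∈ d.support, d i = n := by rw [← h1]; rfl
  rw [h2]
  ring

/-! ### The affine line as a dense open chart of the projective line. -/

section ProjLine

variable (k : CommRingCat.{0})

lemma X_mem_homogeneousSubmodule (i : Fin 2) : (MvPolynomial.X i : MvPolynomial (Fin 2) k) ∈
    MvPolynomial.homogeneousSubmodule (Fin 2) k 1 :=
  MvPolynomial.isHomogeneous_X k i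

/-- The ring of functions of the standard affine chart of the projective line. -/
def projLineChartHom : Polynomial k →+*
    HomogeneousLocalization.Away (MvPolynomial.homogeneousSubmodule (Fin 2) k)
      (MvPolynomial.X 0) :=
  Polynomial.eval₂RingHom
    ((HomogeneousLocalization.fromZeroRingHom _ _).comp
      (algebraMap k (MvPolynomial.homogeneousSubmodule (Fin 2) k 0)))
    (HomogeneousLocalization.Away.mk _ (X_mem_homogeneousSubmodule k 0) 1 (MvPolynomial.X 1)
      (X_mem_homogeneousSubmodule k 1))

lemma projLineChartHom_C (c : k) : (projLineChartHom k (.C c)).val =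
    algebraMap (MvPolynomial (Fin 2) k)
      (Localization.Away (MvPolynomial.X 0 : MvPolynomial (Fin 2) k)) (MvPolynomial.C c) := by
  simp only [projLineChartHom, Polynomial.coe_eval₂RingHom, Polynomial.eval₂_C]
  rfl

lemma projLineChartHom_X : algebraMap (MvPolynomial (Fin 2) k) _ (MvPolynomial.X 0) *
      (projLineChartHom k .X).val =
    algebraMap (MvPolynomial (Fin 2) k)
      (Localization.Away (MvPolynomial.X 0 : MvPolynomial (Fin 2) k)) (MvPolynomial.X 1) := by
  simp only [projLineChartHom, Polynomial.coe_eval₂RingHom, Polynomial.eval₂_X,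
    HomogeneousLocalization.Away.val_mk]
  rw [← Localization.mk_one_eq_algebraMap, ← Localization.mk_one_eq_algebraMap, Localization.mk_mul,
    Localization.mk_eq_mk_iff, Localization.r_iff_exists]
  exact ⟨1, by simp⟩

/-- Dehomogenisation. -/
def projLineChartInv : HomogeneousLocalization.Away (MvPolynomial.homogeneousSubmodule (Fin 2) k)
      (MvPolynomial.X 0) →+* Polynomial k :=
  (Localization.awayLift (MvPolynomial.eval₂Hom Polynomial.C ![1, Polynomial.X])
    (MvPolynomial.X 0) (by simp)).comp (algebraMap _ (Localization.Away _))

lemma awayLift_algebraMap {R P : Type*} [CommRing R] [CommRing P] (f : R →+* P) (r : R)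
    (hr : IsUnit (f r)) (x : R) :
    Localization.awayLift f r hr (algebraMap R _ x) = f x :=
  IsLocalization.Away.lift_eq r hr x

/-- Dehomogenisation is the inverse. Surjectivity is the identity `p(X₀, X₁) = X₀ⁿ p(1, X₁ / X₀)`
for `p` homogeneous of degree `n`. -/
lemma projLineChartHom_bijective : Function.Bijective (projLineChartHom k) := by
  have h1 : (projLineChartInv k).comp (projLineChartHom k) = RingHom.id _ := by
    refine Polynomial.ringHom_ext (fun c => ?_) ?_
    · simp only [projLineChartInv, RingHom.comp_apply, HomogeneousLocalization.algebraMap_apply,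
        projLineChartHom_C, awayLift_algebraMap]
      simp
    · have h2 := congrArg (Localization.awayLift
        (MvPolynomial.eval₂Hom Polynomial.C ![1, Polynomial.X])
        (MvPolynomial.X 0 : MvPolynomial (Fin 2) k) (by simp)) (projLineChartHom_X k)
      rw [map_mul, awayLift_algebraMap, awayLift_algebraMap] at h2
      simpa [projLineChartInv] using h2
  refine ⟨Function.LeftInverse.injective (g := projLineChartInv k)
    fun p => congrArg (fun f => f p) h1, fun z => ⟨projLineChartInv k z, ?_⟩⟩
  obtain ⟨n, x, hx, rfl⟩ := HomogeneousLocalization.Away.mk_surjective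
    (MvPolynomial.homogeneousSubmodule (Fin 2) k) (X_mem_homogeneousSubmodule k 0) z
  have hx' : x.IsHomogeneous n := by simpa using hx
  apply HomogeneousLocalization.val_injective
  set L := Localization.Away (MvPolynomial.X 0 : MvPolynomial (Fin 2) k)
  have hu : IsUnit (algebraMap _ L (MvPolynomial.X 0 : MvPolynomial (Fin 2) k)) :=
    IsLocalization.Away.algebraMap_isUnit _
  have hz : algebraMap (MvPolynomial (Fin 2) k) L (MvPolynomial.X 0) ^ n *
      (HomogeneousLocalization.Away.mk (MvPolynomial.homogeneousSubmodule (Fin 2) k)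
        (X_mem_homogeneousSubmodule k 0) n x hx).val = algebraMap _ L x := by
    rw [HomogeneousLocalization.Away.val_mk, ← map_pow, ← Localization.mk_one_eq_algebraMap,
      ← Localization.mk_one_eq_algebraMap, Localization.mk_mul, Localization.mk_eq_mk_iff,
      Localization.r_iff_exists]
    exact ⟨1, by simp⟩
  have hinv : projLineChartInv k (HomogeneousLocalization.Away.mk
      (MvPolynomial.homogeneousSubmodule (Fin 2) k)
      (X_mem_homogeneousSubmodule k 0) n x hx) =
      MvPolynomial.eval₂ Polynomial.C ![1, Polynomial.X] x := by
    have h2 := congrArg (Localization.awayLift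
        (MvPolynomial.eval₂Hom Polynomial.C ![1, Polynomial.X])
        (MvPolynomial.X 0 : MvPolynomial (Fin 2) k) (by simp)) hz
    rw [map_mul, map_pow, awayLift_algebraMap, awayLift_algebraMap] at h2
    simpa [projLineChartInv] using h2
  refine (hu.pow n).mul_left_cancel ?_
  rw [hz, hinv]
  let φ : Polynomial k →+* L := (algebraMap _ L).comp (projLineChartHom k)
  rw [show (projLineChartHom k (MvPolynomial.eval₂ Polynomial.C ![1, Polynomial.X] x)).val =
    φ (MvPolynomial.eval₂ Polynomial.C ![1, Polynomial.X] x) from rfl,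
    MvPolynomial.hom_eval₂, ← hx'.eval₂_smul]
  have hC : φ.comp Polynomial.C = (algebraMap (MvPolynomial (Fin 2) k) L).comp MvPolynomial.C := by
    ext c
    exact projLineChartHom_C k c
  have hX : (fun i => algebraMap (MvPolynomial (Fin 2) k) L
      (MvPolynomial.X 0 : MvPolynomial (Fin 2) k) *
        φ ((![1, Polynomial.X] : Fin 2 → Polynomial k) i)) =
      fun i => algebraMap (MvPolynomial (Fin 2) k) L (.X i) := by
    funext i
    fin_cases i
    · simp
    · exact projLineChartHom_X k
  rw [hC, hX, ← MvPolynomial.hom_eval₂, MvPolynomial.eval₂_eta]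

/-- The standard affine chart of the projective line. -/
def projLineChart : Spec (.of (Polynomial k)) ⟶ projLine k :=
  Spec.map (RingEquiv.ofBijective _ (projLineChartHom_bijective k)).toCommRingCatIso.inv ≫
    Proj.awayι _ (MvPolynomial.X 0) (X_mem_homogeneousSubmodule k 0) one_pos

instance : IsOpenImmersion (projLineChart k) := by
  unfold projLineChart
  infer_instance

instance [IsDomain k] : IsDominant (projLineChart k) := by
  unfold projLineChart
  have := Proj.isDominant_awayι (MvPolynomial.homogeneousSubmodule (Fin 2) k)
    (X_mem_homogeneousSubmodule k 0) one_pos (MvPolynomial.X_ne_zero 0)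
  infer_instance

lemma projLineChart_projLineToSpec :
    projLineChart k ≫ projLineToSpec k = Spec.map (CommRingCat.ofHom Polynomial.C) := by
  rw [projLineChart, projLineToSpec, Category.assoc, Proj.awayι_projToSpec, ← Spec.map_comp]
  congr 1
  refine CommRingCat.hom_ext (RingHom.ext fun c => ?_)
  apply (RingEquiv.ofBijective _ (projLineChartHom_bijective k)).injective
  refine (RingEquiv.apply_symm_apply _ _).trans ?_
  apply HomogeneousLocalization.val_injective
  exact (projLineChartHom_C k c).symm

end ProjLine

/-! ## Partial maps given on a chart -/

namespace AlgebraicGeometry.Scheme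

variable {U V X Y Z : Scheme.{0}}

/-- The partial map given by a morphism on a dense open chart. -/
def PartialMap.ofChart (i : U ⟶ X) [IsOpenImmersion i] [IsDominant i] (g : U ⟶ Y) :
    X.PartialMap Y where
  domain := i.opensRange
  dense_domain := i.denseRange
  hom := i.isoOpensRange.inv ≫ g

/-- The partial isomorphism given by a scheme that is a dense open chart of both sides. -/
def PartialIso.ofSpan (i : U ⟶ X) [IsOpenImmersion i] [IsDominant i] (j : U ⟶ Y)
    [IsOpenImmersion j] [IsDominant j] : X.PartialIso Y where
  source := i.opensRange
  dense_source := i.denseRange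
  target := j.opensRange
  dense_target := j.denseRange
  iso := i.isoOpensRange.symm ≪≫ j.isoOpensRange

lemma PartialIso.ofSpan_toPartialMap (i : U ⟶ X) [IsOpenImmersion i] [IsDominant i] (j : U ⟶ Y)
    [IsOpenImmersion j] [IsDominant j] :
    (PartialIso.ofSpan i j).toPartialMap = PartialMap.ofChart i j := by
  have h : (i.isoOpensRange.inv ≫ j.isoOpensRange.hom) ≫ j.opensRange.ι =
      i.isoOpensRange.inv ≫ j := by
    rw [Category.assoc, Hom.isoOpensRange_hom_ι]
  exact congrArg (fun k => (⟨i.opensRange, i.denseRange, k⟩ : X.PartialMap Y)) h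

lemma PartialIso.ofSpan_isOver {S : Scheme.{0}} (i : U ⟶ X) [IsOpenImmersion i] [IsDominant i]
    (j : U ⟶ Y) [IsOpenImmersion j] [IsDominant j] {sX : X ⟶ S} {sY : Y ⟶ S}
    (h : i ≫ sX = j ≫ sY) : (PartialIso.ofSpan i j).IsOver sX sY := by
  have h1 : i.isoOpensRange.inv ≫ j ≫ sY = i.opensRange.ι ≫ sX := by
    rw [← h, ← Category.assoc, Hom.isoOpensRange_inv_comp]
  have h2 : j.isoOpensRange.hom ≫ j.opensRange.ι ≫ sY = j ≫ sY := by
    rw [← Category.assoc, Hom.isoOpensRange_hom_ι]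
  change (i.isoOpensRange.inv ≫ j.isoOpensRange.hom) ≫ j.opensRange.ι ≫ sY = i.opensRange.ι ≫ sX
  rw [Category.assoc, h2, h1]

lemma PartialMap.ofChart_over {S : Scheme.{0}} (i : U ⟶ X) [IsOpenImmersion i] [IsDominant i]
    (g : U ⟶ Y) {sX : X ⟶ S} {sY : Y ⟶ S} (h : i ≫ sX = g ≫ sY) :
    (PartialMap.ofChart i g).hom ≫ sY = (PartialMap.ofChart i g).domain.ι ≫ sX := by
  change (i.isoOpensRange.inv ≫ g) ≫ sY = i.opensRange.ι ≫ sX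
  rw [Category.assoc, ← h, ← Category.assoc, Hom.isoOpensRange_inv_comp]

lemma PartialMap.ofChart_apply (i : U ⟶ X) [IsOpenImmersion i] [IsDominant i] (g : U ⟶ Y)
    (u : U) (hu : i u ∈ (PartialMap.ofChart i g).domain) :
    (PartialMap.ofChart i g).hom ⟨i u, hu⟩ = g u := by
  have h1 : i.isoOpensRange.hom u = ⟨i u, hu⟩ := by
    apply Subtype.ext
    change i.opensRange.ι (i.isoOpensRange.hom u) = i u
    rw [← Hom.comp_apply, Hom.isoOpensRange_hom_ι]
  change (i.isoOpensRange.inv ≫ g) (⟨i u, hu⟩ : i.opensRange.toScheme) = g u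
  rw [← h1]
  rw [← Hom.comp_apply, Iso.hom_inv_id_assoc]

lemma PartialIso.ofSpan_apply (i : U ⟶ X) [IsOpenImmersion i] [IsDominant i] (j : U ⟶ Y)
    [IsOpenImmersion j] [IsDominant j] (u : U) (x : X)
    (hx : x ∈ (PartialIso.ofSpan i j).toPartialMap.domain) (hu : i u = x) :
    (PartialIso.ofSpan i j).toPartialMap.hom ⟨x, hx⟩ = j u := by
  subst hu
  rw [← PartialMap.ofChart_apply i j u hx]
  have h : (i.isoOpensRange.inv ≫ j.isoOpensRange.hom) ≫ j.opensRange.ι =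
      i.isoOpensRange.inv ≫ j := by
    rw [Category.assoc, Hom.isoOpensRange_hom_ι]
  exact congrArg (fun k : i.opensRange.toScheme ⟶ Y => k ⟨i u, hx⟩) h

/-- Brings identities and projections into the form to which `isRationalComp_ofChart` applies. -/
lemma Hom.toPartialMap_eq_ofChart (g : X ⟶ Y) :
    g.toPartialMap = PartialMap.ofChart (𝟙 X) g := by
  have htop : (𝟙 X : X ⟶ X).opensRange = ⊤ := by
    ext x
    exact ⟨fun _ => trivial, fun _ => ⟨x, by simp⟩⟩
  have aux : ∀ (W : X.Opens) (h : W = (𝟙 X : X ⟶ X).opensRange),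
      W.ι = (X.isoOfEq h).hom ≫ (𝟙 X : X ⟶ X).isoOpensRange.inv := by
    rintro W rfl
    have h1 := Hom.isoOpensRange_inv_comp (𝟙 X)
    rw [Category.comp_id] at h1
    rw [h1, Scheme.isoOfEq_hom_ι]
  refine PartialMap.ext _ _ htop.symm ?_
  exact (congrArg (· ≫ g) (aux ⊤ htop.symm)).trans (Category.assoc _ _ _)

end AlgebraicGeometry.Scheme

-- A composition of rational maps can be checked on one chart `U` contained in both source charts,
-- provided that the first map carries `U` into the chart `V` on which the second is given; `k` is
-- this restricted map.
open AlgebraicGeometry.Scheme in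
lemma isRationalComp_ofChart {U U₀ U₁ V X Y Z : Scheme.{0}} (i : U ⟶ X) [IsOpenImmersion i]
    [IsDominant i] (i₀ : U₀ ⟶ X) [IsOpenImmersion i₀] [IsDominant i₀] (i₁ : U₁ ⟶ X)
    [IsOpenImmersion i₁] [IsDominant i₁] (a₀ : U ⟶ U₀) (a₁ : U ⟶ U₁) (h₀ : a₀ ≫ i₀ = i)
    (h₁ : a₁ ≫ i₁ = i) (g₀ : U₀ ⟶ Y) (j : V ⟶ Y) [IsOpenImmersion j] [IsDominant j] (h : V ⟶ Z)
    (k : U ⟶ V) (hk : k ≫ j = a₀ ≫ g₀) (g₁ : U₁ ⟶ Z) (hk' : k ≫ h = a₁ ≫ g₁) :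
    IsRationalComp (PartialMap.ofChart i₀ g₀) (PartialMap.ofChart j h)
      (PartialMap.ofChart i₁ g₁) := by
  have aux : ∀ {U' : Scheme.{0}} (i' : U' ⟶ X) [IsOpenImmersion i'] (a : U ⟶ U')
      (ha : a ≫ i' = i) (hle : i.opensRange ≤ i'.opensRange),
      X.homOfLE hle ≫ i'.isoOpensRange.inv = i.isoOpensRange.inv ≫ a := by
    intro U' i' _ a ha hle
    rw [← cancel_mono i', Category.assoc, Category.assoc, ha, Hom.isoOpensRange_inv_comp,
      Hom.isoOpensRange_inv_comp, Scheme.homOfLE_ι]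
  have hle : ∀ {U' : Scheme.{0}} (i' : U' ⟶ X) [IsOpenImmersion i'] (a : U ⟶ U')
      (ha : a ≫ i' = i), i.opensRange ≤ i'.opensRange := by
    rintro U' i' _ a rfl _ ⟨u, rfl⟩
    exact ⟨a u, (Hom.comp_apply _ _ _).symm⟩
  refine ⟨i.opensRange, i.denseRange, hle i₀ a₀ h₀, hle i₁ a₁ h₁,
    i.isoOpensRange.inv ≫ k ≫ j.isoOpensRange.hom, ?_, ?_⟩
  · change (i.isoOpensRange.inv ≫ k ≫ j.isoOpensRange.hom) ≫ j.opensRange.ι =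
      X.homOfLE _ ≫ i₀.isoOpensRange.inv ≫ g₀
    rw [Category.assoc, Category.assoc, Hom.isoOpensRange_hom_ι, hk, ← Category.assoc, ←
      Category.assoc, aux i₀ a₀ h₀]
  · change (i.isoOpensRange.inv ≫ k ≫ j.isoOpensRange.hom) ≫ j.isoOpensRange.inv ≫ h =
      X.homOfLE _ ≫ i₁.isoOpensRange.inv ≫ g₁
    rw [Category.assoc, Category.assoc, Iso.hom_inv_id_assoc, hk', ← Category.assoc, ←
      Category.assoc, aux i₁ a₁ h₁]

/-! ## Fibrations by affine lines -/

/-- Used to replace an affine chart of the base by the whole base without changing the fibre. -/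
lemma CategoryTheory.IsPullback.comp_mono {C : Type*} [Category* C] {P X Y Z W : C} {p : P ⟶ X}
    {q : P ⟶ Y} {f : X ⟶ Z} {g : Y ⟶ Z} (h : IsPullback p q f g) (i : Z ⟶ W) [Mono i] :
    IsPullback p q (f ≫ i) (g ≫ i) := by
  refine ⟨⟨by rw [← Category.assoc, h.w, Category.assoc]⟩,
    ⟨Limits.PullbackCone.IsLimit.mk _ (fun s => h.lift s.fst s.snd ?_) (fun s => ?_)
      (fun s => ?_) (fun s m h1 h2 => ?_)⟩⟩
  · rw [← cancel_mono i, Category.assoc, Category.assoc, s.condition]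
  · exact h.lift_fst _ _ _
  · exact h.lift_snd _ _ _
  · apply h.hom_ext
    · rw [h1, h.lift_fst]
    · rw [h2, h.lift_snd]

/-- Because `K ⊗_R R[T] = K[T]`. The same square computes the fibres, the chart of the product with
`ℙ¹`, and the extension of open immersions to polynomial rings. -/
lemma isPullback_Spec_polynomial {R K : CommRingCat.{0}} (ψ : R ⟶ K) :
    IsPullback (Spec.map (CommRingCat.ofHom (Polynomial.mapRingHom ψ.hom)))
      (Spec.map (CommRingCat.ofHom (Polynomial.C : K →+* Polynomial K)))
      (Spec.map (CommRingCat.ofHom (Polynomial.C : R →+* Polynomial R))) (Spec.map ψ) := by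
  algebraize [ψ.hom]
  let := (Polynomial.mapRingHom ψ.hom).toAlgebra
  refine isPullback_SpecMap_of_isPushout _ _ _ _ ?_
  exact CommRingCat.isPushout_of_isPushout R (Polynomial R) K (Polynomial K)

open AlgebraicGeometry.Scheme in
/-- A partial map that is, on suitable charts, the projection of the product of an integral affine
scheme with the affine line. -/
lemma isRationalCurveFibration_ofChart {X P : Scheme.{0}} {R : Type} [CommRing R]
    (jP : Spec (.of R) ⟶ P) [IsOpenImmersion jP] [IsDominant jP]
    (jX : Spec (.of (Polynomial R)) ⟶ X) [IsOpenImmersion jX] [IsDominant jX] :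
    IsRationalCurveFibration (PartialMap.ofChart jX
      (Spec.map (CommRingCat.ofHom (Polynomial.C : R →+* Polynomial R)) ≫ jP)) := by
  set c := Spec.map (CommRingCat.ofHom (Polynomial.C : R →+* Polynomial R)) with hc
  refine ⟨?_, jP.opensRange, jP.denseRange, fun y hy => ?_⟩
  · have : Surjective c := ⟨fun p => by
      exact Polynomial.comap_C_surjective p⟩
    change IsDominant (jX.isoOpensRange.inv ≫ c ≫ jP)
    infer_instance
  · set κ := P.residueField y
    have hr : Set.range (P.fromSpecResidueField y) ⊆ Set.range jP := by
      rw [Scheme.range_fromSpecResidueField]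
      rintro _ rfl
      exact hy
    let g : Spec κ ⟶ Spec (.of R) := IsOpenImmersion.lift jP (P.fromSpecResidueField y) hr
    have hg : g ≫ jP = P.fromSpecResidueField y := IsOpenImmersion.lift_fac _ _ _
    obtain ⟨ψ, hψ⟩ := Spec.map_surjective g
    have h1 := isPullback_Spec_polynomial ψ
    rw [hψ] at h1
    let f := PartialMap.ofChart jX (c ≫ jP)
    -- Over a point of the chart the residue field map factors through `Spec R`, so the fibre is the
    -- base change of the affine line over `R`, that is, the affine line over `κ`.
    have h2 : IsPullback
        (Spec.map (CommRingCat.ofHom (Polynomial.mapRingHom ψ.hom)) ≫ jX.isoOpensRange.hom)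
        (Spec.map (CommRingCat.ofHom (Polynomial.C : κ →+* Polynomial κ)))
        f.hom (P.fromSpecResidueField y) := by
      have h3 : IsPullback
        (Spec.map (CommRingCat.ofHom (Polynomial.mapRingHom ψ.hom)))
        (Spec.map (CommRingCat.ofHom (Polynomial.C : κ →+* Polynomial κ)))
        (c ≫ jP) (g ≫ jP) := h1.comp_mono jP
      rw [hg] at h3
      refine IsPullback.of_iso h3 (Iso.refl _) jX.isoOpensRange (Iso.refl _) (Iso.refl _)
        ?_ ?_ ?_ ?_
      · simp
      · simp
      · change (c ≫ jP) ≫ 𝟙 _ = jX.isoOpensRange.hom ≫ jX.isoOpensRange.inv ≫ c ≫ jP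
        simp
      · simp
    let e : f.hom.fiber y ≅ Spec (.of (Polynomial κ)) := h2.isoPullback.symm
    have he : e.hom ≫ Spec.map (CommRingCat.ofHom (Polynomial.C : κ →+* Polynomial κ)) =
        f.hom.fiberToSpecResidueField y := h2.isoPullback_inv_snd
    refine ⟨?_, ?_⟩
    · have : Nonempty (f.hom.fiber y) :=
        ⟨e.inv (Classical.arbitrary (Spec (.of (Polynomial κ))))⟩
      exact isIntegral_of_isOpenImmersion e.hom
    -- The affine line over `κ` is a dense open part of the projective line over `κ`.
    · refine Scheme.Hom.birationalOver (e.hom ≫ projLineChart κ) _ _ ?_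
      rw [Category.assoc, projLineChart_projLineToSpec, he]

/-! ## Rationality, and the product with the projective line -/

lemma isDominant_Spec_map {R S : CommRingCat.{0}} (φ : R ⟶ S)
    (h : Function.Injective φ.hom) : IsDominant (Spec.map φ) := by
  refine ⟨(PrimeSpectrum.denseRange_comap_iff_ker_le_nilRadical φ.hom).mpr ?_⟩
  rw [(RingHom.injective_iff_ker_eq_bot φ.hom).mp h]
  exact bot_le

lemma isOpenImmersion_Spec_map_polynomial {R S : CommRingCat.{0}} (φ : R ⟶ S)
    [IsOpenImmersion (Spec.map φ)] :
    IsOpenImmersion (Spec.map (CommRingCat.ofHom (Polynomial.mapRingHom φ.hom))) :=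
  MorphismProperty.of_isPullback (P := @IsOpenImmersion) (isPullback_Spec_polynomial φ).flip
    inferInstance

/-- An affine dense open chart that is a dense open subscheme of an affine space. -/
lemma isRationalVariety_of_chart {X : Scheme.{0}} {sX : X ⟶ Spec (.of ℂ)} {S : Type} [CommRing S]
    [Algebra ℂ S] (j : Spec (.of S) ⟶ X) [IsOpenImmersion j] [IsDominant j]
    (hj : j ≫ sX = Spec.map (CommRingCat.ofHom (algebraMap ℂ S))) {n : ℕ}
    (φ : MvPolynomial (Fin n) ℂ →ₐ[ℂ] S)
    [IsOpenImmersion (Spec.map (CommRingCat.ofHom φ.toRingHom))] (hφ : Function.Injective φ) :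
    IsRationalVariety sX := by
  have := isDominant_Spec_map (CommRingCat.ofHom φ.toRingHom) hφ
  refine ⟨n, (j.birationalOver sX _ hj).symm.trans ?_⟩
  refine Scheme.Hom.birationalOver (Spec.map (CommRingCat.ofHom φ.toRingHom) ≫
    (AffineSpace.SpecIso (Fin n) (.of ℂ)).inv) _ _ ?_
  rw [Category.assoc, AffineSpace.SpecIso_inv_over, ← Spec.map_comp]
  congr 1
  exact CommRingCat.hom_ext (RingHom.ext fun c => φ.commutes c)

/-- If `Spec S` is open in affine `n`-space, then `Spec S[T]` is open in affine `(n+1)`-space, by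
base change along the projection. -/
lemma isRationalVariety_of_polynomial_chart {X : Scheme.{0}} {sX : X ⟶ Spec (.of ℂ)} {S : Type}
    [CommRing S] [Algebra ℂ S] (j : Spec (.of (Polynomial S)) ⟶ X) [IsOpenImmersion j]
    [IsDominant j] (hj : j ≫ sX = Spec.map (CommRingCat.ofHom (algebraMap ℂ (Polynomial S))))
    {n : ℕ} (φ : MvPolynomial (Fin n) ℂ →ₐ[ℂ] S)
    [IsOpenImmersion (Spec.map (CommRingCat.ofHom φ.toRingHom))] (hφ : Function.Injective φ) :
    IsRationalVariety sX := by
  let e := MvPolynomial.finSuccEquiv ℂ n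
  let ψ : MvPolynomial (Fin (n + 1)) ℂ →ₐ[ℂ] Polynomial S :=
    (Polynomial.mapAlgHom φ).comp e.toAlgHom
  have h1 := isOpenImmersion_Spec_map_polynomial (CommRingCat.ofHom φ.toRingHom)
  have h2 : IsOpenImmersion (Spec.map (CommRingCat.ofHom ψ.toRingHom)) := by
    have : Spec.map (CommRingCat.ofHom ψ.toRingHom) =
        Spec.map (CommRingCat.ofHom (Polynomial.mapRingHom φ.toRingHom)) ≫
          Spec.map e.toRingEquiv.toCommRingCatIso.hom := by
      rw [← Spec.map_comp]
      rfl
    rw [this]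
    infer_instance
  exact isRationalVariety_of_chart j hj ψ
    ((Polynomial.map_injective φ.toRingHom hφ).comp e.injective)

section Product

variable {P : Scheme.{0}} (sP : P ⟶ Spec (.of ℂ)) {R : Type} [CommRing R] [Algebra ℂ R]
  (jP : Spec (.of R) ⟶ P)

/-- The chart of `P × ℙ¹` that is the product of a chart of `P` with the affine line. -/
lemma exists_product_chart [IsOpenImmersion jP] [IsDominant jP]
    (hP : jP ≫ sP = Spec.map (CommRingCat.ofHom (algebraMap ℂ R))) :
    ∃ jZ : Spec (.of (Polynomial R)) ⟶ Limits.pullback sP (projLineToSpec (.of ℂ)),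
      IsOpenImmersion jZ ∧ IsDominant jZ ∧ jZ ≫ Limits.pullback.fst _ _ =
        Spec.map (CommRingCat.ofHom (Polynomial.C : R →+* Polynomial R)) ≫ jP := by
  have h1 := isPullback_Spec_polynomial (R := .of ℂ) (K := .of R)
    (CommRingCat.ofHom (algebraMap ℂ R))
  have hL := projLineChart_projLineToSpec (.of ℂ)
  let m : Limits.pullback (Spec.map (CommRingCat.ofHom (algebraMap ℂ R)))
      (Spec.map (CommRingCat.ofHom (Polynomial.C : ℂ →+* Polynomial ℂ))) ⟶
        Limits.pullback sP (projLineToSpec (.of ℂ)) :=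
    Limits.pullback.map _ _ _ _ jP (projLineChart (.of ℂ)) (𝟙 _)
      (by rw [Category.comp_id, hP]) (by rw [Category.comp_id, hL])
  have hm : IsOpenImmersion m := inferInstance
  have hr : Set.range m = Limits.pullback.fst sP (projLineToSpec (.of ℂ)) ⁻¹' Set.range jP ∩
      Limits.pullback.snd sP (projLineToSpec (.of ℂ)) ⁻¹' Set.range (projLineChart (.of ℂ)) :=
    Scheme.Pullback.range_map _ _ _ _ _ _ _ _ _
  have hd : IsDominant m := by
    have o1 : IsOpenMap (Limits.pullback.fst sP (projLineToSpec (.of ℂ))) :=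
      Scheme.Hom.isOpenMap _
    have o2 : IsOpenMap (Limits.pullback.snd sP (projLineToSpec (.of ℂ))) :=
      Scheme.Hom.isOpenMap _
    refine ⟨?_⟩
    rw [DenseRange, hr]
    -- The image is the intersection of the preimages of two dense open sets under the projections.
    -- These are open maps, so both preimages are dense.
    refine Dense.inter_of_isOpen_left (Dense.preimage jP.denseRange o1)
      (Dense.preimage (projLineChart (.of ℂ)).denseRange o2) ?_
    exact jP.opensRange.2.preimage (Scheme.Hom.continuous _)
  refine ⟨h1.flip.isoPullback.hom ≫ m, inferInstance, inferInstance, ?_⟩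
  rw [Category.assoc, Limits.pullback.lift_fst, ← Category.assoc, h1.flip.isoPullback_hom_fst]

end Product

/-! ## Complex points of affine charts -/

/-- The point of `Spec S` given by a homomorphism to `ℂ`. -/
def kerPoint {S : Type} [CommRing S] (ψ : S →+* ℂ) : Spec (.of S) := PrimeSpectrum.comap ψ ⊥

lemma Spec_map_kerPoint {S T : Type} [CommRing S] [CommRing T] (φ : S →+* T) (ψ : T →+* ℂ) :
    Spec.map (CommRingCat.ofHom φ) (kerPoint ψ) = kerPoint (ψ.comp φ) := rfl

open Polynomial Scheme in
/-- Rational maps between schemes with charts `Spec R`, `Spec R[T]` and `Spec R[T]`. -/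
theorem exists_maps_of_charts {P X B : Scheme.{0}} {sP : P ⟶ Spec (.of ℂ)}
    {sX : X ⟶ Spec (.of ℂ)} {sB : B ⟶ Spec (.of ℂ)} {R : Type} [CommRing R] [IsDomain R]
    [Algebra ℂ R] (jP : Spec (.of R) ⟶ P) [IsOpenImmersion jP] [IsDominant jP]
    (jX : Spec (.of R[X]) ⟶ X) [IsOpenImmersion jX] [IsDominant jX]
    (jB : Spec (.of R[X]) ⟶ B) [IsOpenImmersion jB] [IsDominant jB]
    (hP : jP ≫ sP = Spec.map (CommRingCat.ofHom (algebraMap ℂ R)))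
    (hX : jX ≫ sX = Spec.map (CommRingCat.ofHom (algebraMap ℂ R[X])))
    (hB : jB ≫ sB = Spec.map (CommRingCat.ofHom (algebraMap ℂ R[X]))) :
    ∃ f : X.PartialMap P, f.hom ≫ sP = f.domain.ι ≫ sX ∧ f.domain = jX.opensRange ∧
      (∀ ψ c hd, f.hom ⟨jX (kerPoint (eval₂RingHom ψ c)), hd⟩ = jP (kerPoint ψ)) ∧
      IsRationalCurveFibration f ∧
      (∃ (σ : B.PartialIso X) (f' : B.PartialMap P) (t : P.PartialMap B),
        σ.IsOver sB sX ∧ (σ.toPartialMap.domain ≤ jB.opensRange) ∧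
        (∀ ψ c hd, c ≠ 0 ∧ σ.toPartialMap.hom ⟨jB (kerPoint (eval₂RingHom ψ c)), hd⟩ =
          jX (kerPoint (eval₂RingHom ψ c⁻¹))) ∧
        IsRationalComp σ.toPartialMap f f' ∧ t.hom ≫ sB = t.domain.ι ≫ sP ∧
        t.domain = jP.opensRange ∧
        (∀ ψ hd, t.hom ⟨jP (kerPoint ψ), hd⟩ = jB (kerPoint (eval₂RingHom ψ 0))) ∧
        IsRationalComp t f' (PartialMap.id P)) ∧
      ∃ e : X.PartialIso (Limits.pullback sP (projLineToSpec (.of ℂ))),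
        e.IsOver sX (Limits.pullback.fst _ _ ≫ sP) ∧
        IsRationalComp e.toPartialMap
          (Limits.pullback.fst sP (projLineToSpec (.of ℂ))).toPartialMap f := by
  set c : Spec (.of R[X]) ⟶ Spec (.of R) := Spec.map (CommRingCat.ofHom (C : R →+* R[X])) with hc
  have hcP : (c ≫ jP) ≫ sP = Spec.map (CommRingCat.ofHom (algebraMap ℂ R[X])) := by
    rw [Category.assoc, hP, hc, ← Spec.map_comp]
    rfl
  -- The overlap of the charts of the blow-up and of `X`: where `T` is invertible, `c a² + b` is
  -- proportional to `a² + c⁻¹ b`, so the gluing is the inversion `v`.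
  let i₁ : Spec (.of (LaurentPolynomial R)) ⟶ Spec (.of R[X]) :=
    Spec.map (CommRingCat.ofHom (algebraMap R[X] (LaurentPolynomial R)))
  let v : Spec (.of (LaurentPolynomial R)) ⟶ Spec (.of (LaurentPolynomial R)) :=
    Spec.map (LaurentPolynomial.invert (R := R)).toRingEquiv.toCommRingCatIso.hom
  have o1 : IsOpenImmersion i₁ := IsOpenImmersion.of_isLocalization (Polynomial.X : R[X])
  have d1 : IsDominant i₁ := isDominant_Spec_map _
    (IsLocalization.injective (LaurentPolynomial R)
      (powers_le_nonZeroDivisors_of_noZeroDivisors (X_ne_zero (R := R))))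
  have hic : i₁ ≫ c = (v ≫ i₁) ≫ c := by
    simp only [i₁, v, hc, ← Spec.map_comp]
    congr 1
    refine CommRingCat.hom_ext (RingHom.ext fun r => ?_)
    change algebraMap R[X] (LaurentPolynomial R) (C r) =
      LaurentPolynomial.invert (algebraMap R[X] (LaurentPolynomial R) (C r))
    simp [LaurentPolynomial.algebraMap_eq_toLaurent]
  have hover : ∀ (k : Spec (.of (LaurentPolynomial R)) ⟶ Spec (.of R[X])),
      k ≫ Spec.map (CommRingCat.ofHom (algebraMap ℂ R[X])) =
        (k ≫ c) ≫ Spec.map (CommRingCat.ofHom (algebraMap ℂ R)) := by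
    intro k
    rw [Category.assoc, hc, ← Spec.map_comp]
    rfl
  -- The zero section `T = 0`, which is the exceptional divisor in the chart of the blow-up.
  let z : Spec (.of R) ⟶ Spec (.of R[X]) := Spec.map (CommRingCat.ofHom (evalRingHom (0 : R)))
  have hzc : z ≫ c = 𝟙 _ := by
    simp only [z, hc, ← Spec.map_comp]
    rw [← Spec.map_id]
    congr 1
    refine CommRingCat.hom_ext (RingHom.ext fun r => ?_)
    exact eval_C
  obtain ⟨jZ, o2, d2, hjZ⟩ := exists_product_chart sP jP hP
  refine ⟨PartialMap.ofChart jX (c ≫ jP), PartialMap.ofChart_over _ _ (hX.trans hcP.symm), rfl,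
    fun ψ a hd => ?_, isRationalCurveFibration_ofChart jP jX, ?_, ?_⟩
  · rw [PartialMap.ofChart_apply, Scheme.Hom.comp_apply, hc, Spec_map_kerPoint]
    congr 2
    ext r
    simp
  · refine ⟨PartialIso.ofSpan (i₁ ≫ jB) ((v ≫ i₁) ≫ jX), PartialMap.ofChart jB (c ≫ jP),
      PartialMap.ofChart jP (z ≫ jB), ?_, ?_, ?_, ?_, ?_, rfl, ?_, ?_⟩
    · refine PartialIso.ofSpan_isOver _ _ ?_
      rw [Category.assoc, Category.assoc _ jX, hX, hB, hover, hover, hic]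
    · rintro _ ⟨u, rfl⟩
      exact ⟨i₁ u, (Scheme.Hom.comp_apply _ _ _).symm⟩
    · intro ψ a hd
      -- The source of the partial isomorphism lies where `T` is invertible, while `T` vanishes at a
      -- point with coordinate `0`.
      have ha : a ≠ 0 := by
        obtain ⟨u, hu⟩ := hd
        rw [Scheme.Hom.comp_apply] at hu
        have h1 := jB.isOpenEmbedding.injective hu
        rintro rfl
        have h2 : (Polynomial.X : R[X]) ∈ (i₁ u).asIdeal := by
          rw [h1]
          change eval₂RingHom ψ 0 Polynomial.X ∈ (⊥ : Ideal ℂ)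
          simp
        have h3 : algebraMap R[X] (LaurentPolynomial R) Polynomial.X ∈ u.asIdeal := h2
        exact u.isPrime.ne_top (Ideal.eq_top_of_isUnit_mem _ h3
          (IsLocalization.Away.algebraMap_isUnit (Polynomial.X : R[X])))
      refine ⟨ha, ?_⟩
      let χ : (LaurentPolynomial R) →+* ℂ := LaurentPolynomial.eval₂ ψ (Units.mk0 a ha)
      have h1 : kerPoint (eval₂RingHom ψ a) = i₁ (kerPoint χ) := by
        rw [Spec_map_kerPoint]
        congr 1
        ext r <;> simp [χ, LaurentPolynomial.algebraMap_eq_toLaurent]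
      have h2 : (v ≫ i₁) (kerPoint χ) = kerPoint (eval₂RingHom ψ a⁻¹) := by
        rw [← Spec.map_comp]
        refine (Spec_map_kerPoint _ _).trans ?_
        congr 1
        ext r
        · change LaurentPolynomial.eval₂ ψ _
            (LaurentPolynomial.invert (algebraMap R[X] (LaurentPolynomial R) (C r))) = _
          simp [LaurentPolynomial.algebraMap_eq_toLaurent]
        · change LaurentPolynomial.eval₂ ψ _
            (LaurentPolynomial.invert (algebraMap R[X] (LaurentPolynomial R) Polynomial.X)) = _
          simp [LaurentPolynomial.algebraMap_eq_toLaurent]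
      rw [← h2, ← Scheme.Hom.comp_apply _ jX]
      exact PartialIso.ofSpan_apply _ _ _ _ hd
        ((Scheme.Hom.comp_apply _ _ _).trans (congrArg jB h1.symm))
    · rw [PartialIso.ofSpan_toPartialMap]
      refine isRationalComp_ofChart (i₁ ≫ jB) (i₁ ≫ jB) jB (𝟙 _) i₁ (Category.id_comp _) rfl _ jX
        _ (v ≫ i₁) (Category.id_comp _).symm _ ?_
      rw [← Category.assoc, ← hic, Category.assoc]
    · refine PartialMap.ofChart_over _ _ ?_
      rw [Category.assoc, hB, hP, ← Spec.map_comp]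
      congr 1
      refine CommRingCat.hom_ext (RingHom.ext fun r => ?_)
      exact (eval_C (x := (0 : R)) (a := algebraMap ℂ R r)).symm
    · intro ψ hd
      rw [PartialMap.ofChart_apply, Scheme.Hom.comp_apply, Spec_map_kerPoint]
      congr 2
      ext r <;> simp
    · have h1 : PartialMap.id P = PartialMap.ofChart (𝟙 P) (𝟙 P) :=
        Scheme.Hom.toPartialMap_eq_ofChart (𝟙 P)
      rw [h1]
      refine isRationalComp_ofChart jP jP (𝟙 P) (𝟙 _) jP (Category.id_comp _)
        (Category.comp_id _) _ jB _ z (Category.id_comp _).symm _ ?_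
      rw [← Category.assoc, hzc, Category.id_comp, Category.comp_id]
  · refine ⟨PartialIso.ofSpan jX jZ, PartialIso.ofSpan_isOver _ _ ?_, ?_⟩
    · rw [← Category.assoc, hjZ, hX, hcP]
    · rw [PartialIso.ofSpan_toPartialMap, Scheme.Hom.toPartialMap_eq_ofChart]
      exact isRationalComp_ofChart jX jX jX (𝟙 _) (𝟙 _) (Category.id_comp _)
        (Category.id_comp _) _ (𝟙 _) _ jZ (by rw [Category.comp_id, Category.id_comp]) _
        (by rw [Category.id_comp, hjZ])

/-! ## Charts of quotients of cones -/

namespace InvariantCone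

variable {G E : Type} [Group G] [AddCommGroup E] [Module ℂ E] {ρ : Representation ℂ G E}
  (C : InvariantCone ρ)

lemma point_congr [Finite G] {v w : E} (hv : v ∈ C.carrier) (hv0 : v ≠ 0) (hw : w ∈ C.carrier)
    (hw0 : w ≠ 0) {c : ℂ} (h : v = c • w) : C.point v hv hv0 = C.point w hw hw0 := by
  have hc : c ≠ 0 := by
    rintro rfl
    exact hv0 (by rw [h, zero_smul])
  have hs : ∀ d, C.scale d ⟨v, hv⟩ = C.scale (d * c) ⟨w, hw⟩ := by
    intro d
    apply Subtype.ext
    simp [scale, h, mul_smul]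
  have hI : C.lineIdeal ⟨v, hv⟩ = C.lineIdeal ⟨w, hw⟩ := by
    ext F
    refine ⟨fun hF d => ?_, fun hF d => ?_⟩
    · have h1 := hF (d * c⁻¹)
      rwa [hs, mul_assoc, inv_mul_cancel₀ hc, mul_one] at h1
    · rw [hs]
      exact hF _
  apply ProjectiveSpectrum.ext
  apply HomogeneousIdeal.toIdeal_injective
  exact hI

variable {F : C.invariantRing} {ι : Type} (x : ι → C.carrier)

/-- Values of invariants at a family of vectors of the cone. -/
def evalFamily : C.invariantRing →+* (ι → ℂ) where
  toFun H i := H.1 (x i)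
  map_one' := rfl
  map_mul' _ _ := rfl
  map_zero' := rfl
  map_add' _ _ := rfl

lemma isUnit_evalFamily (hx : ∀ i, F.1 (x i) ≠ 0) : IsUnit (C.evalFamily x F) := by
  rw [Pi.isUnit_iff]
  exact fun i => (hx i).isUnit

variable (hx : ∀ i, F.1 (x i) ≠ 0)

/-- Values of quotients of invariants at a family of vectors of the cone. -/
def chartHom : HomogeneousLocalization.Away C.invariantPart F →+* (ι → ℂ) :=
  (Localization.awayLift (C.evalFamily x) F (C.isUnit_evalFamily x hx)).comp
    (algebraMap _ (Localization.Away F))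

lemma val_away_mk {n : ℕ} (hF : F ∈ C.invariantPart n) (k : ℕ) (H : C.invariantRing)
    (hH : H ∈ C.invariantPart (k • n)) :
    (HomogeneousLocalization.Away.mk C.invariantPart hF k H hH).val *
      algebraMap _ (Localization.Away F) F ^ k = algebraMap _ _ H := by
  rw [HomogeneousLocalization.Away.val_mk, ← map_pow, ← Localization.mk_one_eq_algebraMap,
    ← Localization.mk_one_eq_algebraMap, Localization.mk_mul, Localization.mk_eq_mk_iff,
    Localization.r_iff_exists]
  exact ⟨1, by simp [mul_comm]⟩

lemma chartHom_mk {n : ℕ} (hF : F ∈ C.invariantPart n) (k : ℕ) (H : C.invariantRing)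
    (hH : H ∈ C.invariantPart (k • n)) (i : ι) :
    C.chartHom x hx (HomogeneousLocalization.Away.mk C.invariantPart hF k H hH) i *
      F.1 (x i) ^ k = H.1 (x i) := by
  have h1 := congrArg (Localization.awayLift (C.evalFamily x) F (C.isUnit_evalFamily x hx))
    (C.val_away_mk hF k H hH)
  rw [map_mul, map_pow, awayLift_algebraMap, awayLift_algebraMap] at h1
  exact congrFun h1 i

lemma chartHom_fromZero (c : ℂ) : C.chartHom x hx (HomogeneousLocalization.fromZeroRingHom
      C.invariantPart (.powers F) (algebraMap ℂ (C.invariantPart 0) c)) = algebraMap ℂ _ c := by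
  have h1 : (HomogeneousLocalization.fromZeroRingHom C.invariantPart (.powers F)
      (algebraMap ℂ (C.invariantPart 0) c)).val =
      algebraMap _ (Localization.Away F) (algebraMap ℂ C.invariantRing c) := rfl
  rw [chartHom, RingHom.comp_apply, HomogeneousLocalization.algebraMap_apply, h1,
    awayLift_algebraMap]
  rfl

/-- If `H / F^k` vanishes on the family, then by homogeneity `H` vanishes wherever `F` does not, so
`H * F = 0`, and `F` is a unit in the localisation. -/
lemma chartHom_injective {n : ℕ} (hF : F ∈ C.invariantPart n)
    (hcov : ∀ v, F.1 v ≠ 0 → ∃ c i, v = C.scale c (x i)) :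
    Function.Injective (C.chartHom x hx) := by
  rw [injective_iff_map_eq_zero]
  intro z hz
  obtain ⟨k, H, hH, rfl⟩ := HomogeneousLocalization.Away.mk_surjective C.invariantPart hF z
  have h1 : H * F = 0 := by
    apply Subtype.ext
    funext v
    change H.1 v * F.1 v = 0
    by_cases hv : F.1 v = 0
    · rw [hv, mul_zero]
    · obtain ⟨c, i, rfl⟩ := hcov v hv
      have h2 := C.chartHom_mk x hx hF k H hH i
      rw [hz] at h2
      rw [C.mem_invariantPart.mp hH c (x i)]
      have h3 : H.1 (x i) = 0 := by rw [← h2]; simp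
      simp [h3]
  apply HomogeneousLocalization.val_injective
  rw [HomogeneousLocalization.val_zero]
  have h2 := congrArg (algebraMap _ (Localization.Away F)) h1
  have hu : IsUnit (algebraMap _ (Localization.Away F) F) :=
    IsLocalization.Away.algebraMap_isUnit _
  rw [map_mul, map_zero, hu.mul_left_eq_zero, ← C.val_away_mk hF k H hH,
    (hu.pow k).mul_left_eq_zero] at h2
  exact h2

/-- Both sides are homogeneous primes, so it suffices to compare their homogeneous elements; on
either side these are the invariants that vanish at `x i`. -/
lemma awayι_kerPoint [Finite G] {n : ℕ} (hF : F ∈ C.invariantPart n) (hn : 0 < n) (i : ι)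
    (h0 : (x i : E) ≠ 0) :
    Proj.awayι C.invariantPart F hF hn
      (kerPoint ((Pi.evalRingHom (fun _ : ι => ℂ) i).comp (C.chartHom x hx))) =
      C.point (x i) (x i).2 h0 := by
  set q := kerPoint ((Pi.evalRingHom (fun _ : ι => ℂ) i).comp (C.chartHom x hx)) with hq
  have key : ∀ m, 0 < m → ∀ H ∈ C.invariantPart m,
      H ∈ (Proj.awayι C.invariantPart F hF hn q).asHomogeneousIdeal ↔ H.1 (x i) = 0 := by
    intro m hm H hH
    have h1 : q ∈ Proj.awayι C.invariantPart F hF hn ⁻¹ᵁ Proj.basicOpen C.invariantPart H ↔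
        q ∈ PrimeSpectrum.basicOpen (HomogeneousLocalization.Away.isLocalizationElem hF hH) := by
      exact iff_of_eq (congrArg (fun U : (Spec (.of (HomogeneousLocalization.Away
        C.invariantPart F))).Opens => q ∈ U)
        (Proj.awayι_preimage_basicOpen C.invariantPart hF hn hH hm))
    have h2 : q ∈ Proj.awayι C.invariantPart F hF hn ⁻¹ᵁ Proj.basicOpen C.invariantPart H ↔
        H ∉ (Proj.awayι C.invariantPart F hF hn q).asHomogeneousIdeal := Iff.rfl
    have h3 : q ∈ PrimeSpectrum.basicOpen
        (HomogeneousLocalization.Away.isLocalizationElem hF hH) ↔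
        C.chartHom x hx (HomogeneousLocalization.Away.isLocalizationElem hF hH) i ≠ 0 := Iff.rfl
    rw [← not_iff_not, h2.symm.trans (h1.trans h3), not_iff_not]
    have h4 := C.chartHom_mk x hx hF m (H ^ n) (by
      rw [smul_eq_mul, mul_comm]; exact SetLike.pow_mem_graded n hH) i
    have h5 : (H ^ n).1 (x i) = H.1 (x i) ^ n := rfl
    rw [h5] at h4
    constructor
    · intro h
      refine (pow_eq_zero_iff hn.ne').mp (h4.symm.trans ?_)
      exact mul_eq_zero_of_left h _
    · intro h
      rw [h, zero_pow hn.ne', mul_eq_zero] at h4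
      exact h4.resolve_right (pow_ne_zero _ (hx i))
  -- Basic open sets only test positive degrees. Degree zero is reached through `H * F`, as `F` lies
  -- outside the prime.
  have key' : ∀ m, ∀ H ∈ C.invariantPart m,
      H ∈ (Proj.awayι C.invariantPart F hF hn q).asHomogeneousIdeal ↔ H.1 (x i) = 0 := by
    intro m H hH
    have hp := (Proj.awayι C.invariantPart F hF hn q).isPrime
    have hFn : F ∉ (Proj.awayι C.invariantPart F hF hn q).asHomogeneousIdeal.toIdeal :=
      fun h => hx i ((key n hn F hF).mp h)
    have h1 := key (m + n) (by omega) (H * F) (SetLike.mul_mem_graded hH hF)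
    have h2 : (H * F).1 (x i) = H.1 (x i) * F.1 (x i) := rfl
    rw [h2, mul_eq_zero, or_iff_left (hx i)] at h1
    rw [← h1]
    exact ⟨fun h => Ideal.mul_mem_right _ _ h, fun h => (hp.mem_or_mem h).resolve_right hFn⟩
  apply ProjectiveSpectrum.ext
  refine HomogeneousIdeal.ext' fun m H hH => ?_
  rw [key' m H hH]
  constructor
  · intro h c
    exact (hH c (x i)).trans (mul_eq_zero_of_right _ h)
  · intro h
    have h1 := h 1
    have h2 : C.scale 1 (x i) = x i := Subtype.ext (one_smul _ _)
    rwa [h2] at h1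

/-- A chart of the quotient of a cone, described by a family of vectors that meets all lines of the
cone on which the invariant `F` does not vanish. -/
theorem exists_chart [Finite G] [IsDomain C.invariantRing] {n : ℕ}
    (hF : F ∈ C.invariantPart n) (hn : 0 < n) [Nonempty ι] {S : Type} [CommRing S] [Algebra ℂ S]
    (θ : S →ₐ[ℂ] (ι → ℂ)) (hθ : Function.Injective θ) (hx : ∀ i, F.1 (x i) ≠ 0)
    (hcov : ∀ v, F.1 v ≠ 0 → ∃ c i, v = C.scale c (x i))
    (h1 : ∀ s, ∃ k, ∃ H ∈ C.invariantPart (k * n), ∀ i, θ s i * F.1 (x i) ^ k = H.1 (x i))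
    (h2 : ∀ k, ∀ H ∈ C.invariantPart (k * n), ∃ s, ∀ i, θ s i * F.1 (x i) ^ k = H.1 (x i)) :
    ∃ (j : Spec (.of S) ⟶ C.quotient) (_ : IsOpenImmersion j), IsDominant j ∧
      j ≫ C.quotientToSpec = Spec.map (CommRingCat.ofHom (algebraMap ℂ S)) ∧
      (∀ i (h0 : (x i : E) ≠ 0), j (kerPoint ((Pi.evalRingHom (fun _ : ι => ℂ) i).comp
        (θ : S →+* (ι → ℂ)))) = C.point (x i) (x i).2 h0) ∧
      ∀ v (hv : v ∈ C.carrier) (h0 : v ≠ 0), C.point v hv h0 ∈ j.opensRange → F.1 ⟨v, hv⟩ ≠ 0 := by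
  have hinj := C.chartHom_injective x hx hF hcov
  -- The coordinate ring of the chart and `S` both embed into the functions on `ι`; `h1` and `h2`
  -- say that they have the same image there.
  have hrange : (C.chartHom x hx).range = (θ : S →+* (ι → ℂ)).range := by
    ext f
    constructor
    · rintro ⟨z, rfl⟩
      obtain ⟨k, H, hH, rfl⟩ := HomogeneousLocalization.Away.mk_surjective C.invariantPart hF z
      obtain ⟨s, hs⟩ := h2 k H hH
      refine ⟨s, ?_⟩
      funext i
      apply mul_right_cancel₀ (pow_ne_zero k (hx i))
      rw [C.chartHom_mk x hx hF k H hH i]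
      exact hs i
    · rintro ⟨s, rfl⟩
      obtain ⟨k, H, hH, hs⟩ := h1 s
      refine ⟨HomogeneousLocalization.Away.mk C.invariantPart hF k H hH, ?_⟩
      funext i
      apply mul_right_cancel₀ (pow_ne_zero k (hx i))
      rw [C.chartHom_mk x hx hF k H hH i]
      exact (hs i).symm
  let e : HomogeneousLocalization.Away C.invariantPart F ≃+* S :=
    (RingEquiv.ofBijective _ ⟨fun a b h => hinj (congrArg Subtype.val h),
      (C.chartHom x hx).rangeRestrict_surjective⟩).trans
    ((RingEquiv.subringCongr hrange).trans
    (RingEquiv.ofBijective _ ⟨fun a b h => hθ (congrArg Subtype.val h),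
      (θ : S →+* (ι → ℂ)).rangeRestrict_surjective⟩).symm)
  have he : ∀ z, θ (e z) = C.chartHom x hx z := by
    intro z
    let w := RingEquiv.subringCongr hrange ((C.chartHom x hx).rangeRestrict z)
    have h := RingEquiv.apply_symm_apply (RingEquiv.ofBijective _
      ⟨fun a b h => hθ (congrArg Subtype.val h),
      (θ : S →+* (ι → ℂ)).rangeRestrict_surjective⟩) w
    exact congrArg Subtype.val h
  have hF0 : F ≠ 0 := by
    rintro rfl
    exact hx (Classical.arbitrary ι) rfl
  have hdom := Proj.isDominant_awayι (k := .of ℂ) C.invariantPart hF hn hF0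
  refine ⟨Spec.map e.toCommRingCatIso.hom ≫ Proj.awayι C.invariantPart F hF hn, inferInstance,
    inferInstance, ?_, ?_, ?_⟩
  · rw [Category.assoc]
    refine (congrArg (Spec.map e.toCommRingCatIso.hom ≫ ·)
      (Proj.awayι_projToSpec (k := .of ℂ) C.invariantPart hF hn)).trans ?_
    refine (Spec.map_comp _ _).symm.trans ?_
    congr 1
    refine CommRingCat.hom_ext (RingHom.ext fun c => hθ ?_)
    refine (he _).trans ((C.chartHom_fromZero x hx c).trans (θ.commutes c).symm)
  · intro i h0
    rw [← C.awayι_kerPoint x hx hF hn i h0, Scheme.Hom.comp_apply]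
    congr 1
    refine (Spec_map_kerPoint _ _).trans ?_
    congr 1
    ext z
    exact congrFun (he z) i
  · intro v hv h0 hmem h
    have h3 : C.point v hv h0 ∈ (Proj.awayι C.invariantPart F hF hn).opensRange := by
      obtain ⟨u, hu⟩ := hmem
      exact ⟨_, (Scheme.Hom.comp_apply _ _ _).symm.trans hu⟩
    rw [Proj.opensRange_awayι, Proj.mem_basicOpen] at h3
    apply h3
    intro c
    exact (hF c ⟨v, hv⟩).trans (mul_eq_zero_of_right _ h)

end InvariantCone

/-! ## Polynomial functions on complex vector spaces -/

section PolyFun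

variable {V W : Type} [AddCommGroup V] [Module ℂ V] [AddCommGroup W] [Module ℂ W]

variable (V) in
/-- The algebra of polynomial functions on a complex vector space. -/
def polyFun : Subalgebra ℂ (V → ℂ) :=
  Algebra.adjoin ℂ (Set.range fun (φ : Module.Dual ℂ V) (x : V) => φ x)

lemma dual_mem_polyFun (φ : Module.Dual ℂ V) : (fun x => φ x) ∈ polyFun V :=
  Algebra.subset_adjoin ⟨φ, rfl⟩

lemma const_mem_polyFun (c : ℂ) : (fun _ : V => c) ∈ polyFun V :=
  (polyFun V).algebraMap_mem c

lemma comp_mem_polyFun {f : W → V} (hf : ∀ φ : Module.Dual ℂ V, (fun x => φ (f x)) ∈ polyFun W)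
    {P : V → ℂ} (hP : P ∈ polyFun V) : (fun x => P (f x)) ∈ polyFun W := by
  unfold polyFun at hP
  induction hP using Algebra.adjoin_induction with
  | mem P hP =>
    obtain ⟨φ, rfl⟩ := hP
    exact hf φ
  | algebraMap r => exact const_mem_polyFun r
  | add P Q _ _ h1 h2 => exact add_mem h1 h2
  | mul P Q _ _ h1 h2 => exact mul_mem h1 h2

lemma comp_linear_mem_polyFun (f : W →ₗ[ℂ] V) {P : V → ℂ} (hP : P ∈ polyFun V) :
    (fun x => P (f x)) ∈ polyFun W :=
  comp_mem_polyFun (fun φ => dual_mem_polyFun (φ.comp f)) hP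

lemma exists_polynomial_line {P : V → ℂ} (hP : P ∈ polyFun V) (x y : V) :
    ∃ p : Polynomial ℂ, ∀ t, P (x + t • y) = p.eval t := by
  unfold polyFun at hP
  induction hP using Algebra.adjoin_induction with
  | mem P hP =>
    obtain ⟨φ, rfl⟩ := hP
    exact ⟨.C (φ x) + .C (φ y) * .X, fun t => by simp; ring⟩
  | algebraMap r => exact ⟨.C r, fun t => by simp⟩
  | add P Q _ _ h1 h2 =>
    obtain ⟨p, hp⟩ := h1
    obtain ⟨q, hq⟩ := h2
    exact ⟨p + q, fun t => by simp [hp, hq]⟩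
  | mul P Q _ _ h1 h2 =>
    obtain ⟨p, hp⟩ := h1
    obtain ⟨q, hq⟩ := h2
    exact ⟨p * q, fun t => by simp [hp, hq]⟩

/-- On the line joining a point where `P ≠ 0` to a point where `Q ≠ 0`, both restrict to nonzero
polynomials in one variable. -/
lemma polyFun_eq_zero_or {P Q : V → ℂ} (hP : P ∈ polyFun V) (hQ : Q ∈ polyFun V)
    (h : ∀ x, P x * Q x = 0) : P = 0 ∨ Q = 0 := by
  by_contra! hne
  obtain ⟨x, hx⟩ := Function.ne_iff.mp hne.1
  obtain ⟨y, hy⟩ := Function.ne_iff.mp hne.2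
  obtain ⟨p, hp⟩ := exists_polynomial_line hP x (y - x)
  obtain ⟨q, hq⟩ := exists_polynomial_line hQ x (y - x)
  have hpq : p * q = 0 := by
    apply Polynomial.funext
    intro t
    rw [Polynomial.eval_mul, ← hp, ← hq, h, Polynomial.eval_zero]
  rcases mul_eq_zero.mp hpq with h0 | h0
  · apply hx
    have := hp 0
    simpa [h0] using this
  · apply hy
    have := hq 1
    simpa [h0] using this

lemma polyFun_mul_ne_zero {P Q : V → ℂ} (hP : P ∈ polyFun V) (hQ : Q ∈ polyFun V)
    (hP0 : P ≠ 0) (hQ0 : Q ≠ 0) : P * Q ≠ 0 := fun h =>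
  (polyFun_eq_zero_or hP hQ fun x => congrFun h x).elim hP0 hQ0

lemma polyFun_prod_ne_zero {ι : Type} (s : Finset ι) {P : ι → V → ℂ}
    (hP : ∀ i ∈ s, P i ∈ polyFun V) (h0 : ∀ i ∈ s, P i ≠ 0) : ∏ i ∈ s, P i ≠ 0 := by
  classical
  induction s using Finset.induction_on with
  | empty =>
    rw [Finset.prod_empty]
    exact one_ne_zero
  | insert i s hi ih =>
    rw [Finset.prod_insert hi]
    exact polyFun_mul_ne_zero (hP i (Finset.mem_insert_self i s))
      (prod_mem fun j hj => hP j (Finset.mem_insert_of_mem hj))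
      (h0 i (Finset.mem_insert_self i s))
      (ih (fun j hj => hP j (Finset.mem_insert_of_mem hj))
        fun j hj => h0 j (Finset.mem_insert_of_mem hj))

/-- Powers of the linear form `e`, which are `1` on the slice `e = 1`, raise the degrees. Every
large degree has to be reached at once, so that two summands can be brought to the same degree. -/
lemma exists_homogenization (e : Module.Dual ℂ V) {P : V → ℂ} (hP : P ∈ polyFun V) :
    ∃ D, ∀ d ≥ D, ∃ Q ∈ polyFun V, (∀ (t : ℂ) x, Q (t • x) = t ^ d * Q x) ∧
      ∀ x, e x = 1 → Q x = P x := by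
  unfold polyFun at hP
  induction hP using Algebra.adjoin_induction with
  | mem P hP =>
    obtain ⟨φ, rfl⟩ := hP
    refine ⟨1, fun d hd => ⟨fun x => e x ^ (d - 1) * φ x,
      mul_mem (pow_mem (dual_mem_polyFun e) _) (dual_mem_polyFun φ), fun t x => ?_, ?_⟩⟩
    · obtain ⟨k, rfl⟩ := Nat.exists_eq_add_of_le' hd
      simp
      ring
    · intro x hx
      simp [hx]
  | algebraMap r =>
    refine ⟨0, fun d _ => ⟨fun x => e x ^ d * r,
      mul_mem (pow_mem (dual_mem_polyFun e) _) (const_mem_polyFun r), fun t x => ?_, ?_⟩⟩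
    · simp
      ring
    · intro x hx
      simp [hx]
  | add P Q _ _ h1 h2 =>
    obtain ⟨D1, h1⟩ := h1
    obtain ⟨D2, h2⟩ := h2
    refine ⟨max D1 D2, fun d hd => ?_⟩
    obtain ⟨P', a1, b1, c1⟩ := h1 d (le_of_max_le_left hd)
    obtain ⟨Q', a2, b2, c2⟩ := h2 d (le_of_max_le_right hd)
    exact ⟨P' + Q', add_mem a1 a2, fun t x => by simp [b1, b2, mul_add],
      fun x hx => by simp [c1 x hx, c2 x hx]⟩
  | mul P Q _ _ h1 h2 =>
    obtain ⟨D1, h1⟩ := h1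
    obtain ⟨D2, h2⟩ := h2
    refine ⟨D1 + D2, fun d hd => ?_⟩
    obtain ⟨P', a1, b1, c1⟩ := h1 D1 le_rfl
    obtain ⟨Q', a2, b2, c2⟩ := h2 (d - D1) (by omega)
    refine ⟨P' * Q', mul_mem a1 a2, fun t x => ?_, fun x hx => by simp [c1 x hx, c2 x hx]⟩
    have : d = D1 + (d - D1) := by omega
    simp only [Pi.mul_apply, b1, b2]
    rw [this, pow_add]
    simp only [add_tsub_cancel_left]
    ring

/-- Polynomial functions on `V × ℂ` are polynomials over the polynomial functions on `V`. -/
lemma exists_polynomial_prod {P : V × ℂ → ℂ} (hP : P ∈ polyFun (V × ℂ)) :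
    ∃ p : Polynomial (polyFun V), ∀ x t,
      P (x, t) = p.eval₂ ((Pi.evalRingHom (fun _ : V => ℂ) x).comp (polyFun V).val.toRingHom)
        t := by
  unfold polyFun at hP
  induction hP using Algebra.adjoin_induction with
  | mem P hP =>
    obtain ⟨φ, rfl⟩ := hP
    refine ⟨.C ⟨_, dual_mem_polyFun (φ.comp (LinearMap.inl ℂ V ℂ))⟩ +
      .C ⟨_, const_mem_polyFun (φ (0, 1))⟩ * .X, fun x t => ?_⟩
    simp only [Polynomial.eval₂_add, Polynomial.eval₂_mul, Polynomial.eval₂_C,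
      Polynomial.eval₂_X, LinearMap.comp_apply, LinearMap.inl_apply]
    change φ (x, t) = φ (x, 0) + φ (0, 1) * t
    have : (x, t) = (x, (0 : ℂ)) + t • ((0, 1) : V × ℂ) := by simp
    rw [this, map_add, map_smul, smul_eq_mul, mul_comm t]
  | algebraMap r =>
    exact ⟨.C ⟨_, const_mem_polyFun r⟩, fun x t => by rw [Polynomial.eval₂_C]; rfl⟩
  | add P Q _ _ h1 h2 =>
    obtain ⟨p, hp⟩ := h1
    obtain ⟨q, hq⟩ := h2
    exact ⟨p + q, fun x t => by rw [Polynomial.eval₂_add, ← hp, ← hq]; rfl⟩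
  | mul P Q _ _ h1 h2 =>
    obtain ⟨p, hp⟩ := h1
    obtain ⟨q, hq⟩ := h2
    exact ⟨p * q, fun x t => by rw [Polynomial.eval₂_mul, ← hp, ← hq]; rfl⟩

variable (V) in
/-- The algebra generated by products of two linear forms. -/
def evenFun : Subalgebra ℂ (V → ℂ) :=
  Algebra.adjoin ℂ (Set.range fun (φ : Module.Dual ℂ V × Module.Dual ℂ V) (x : V) =>
    φ.1 x * φ.2 x)

lemma evenFun_neg {P : V → ℂ} (hP : P ∈ evenFun V) (x : V) : P (-x) = P x := by
  unfold evenFun at hP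
  induction hP using Algebra.adjoin_induction with
  | mem P hP =>
    obtain ⟨φ, rfl⟩ := hP
    simp
  | algebraMap r => rfl
  | add P Q _ _ h1 h2 => simp [h1, h2]
  | mul P Q _ _ h1 h2 => simp [h1, h2]

variable (V) in
/-- Linear combinations of linear forms with coefficients in `evenFun V`. -/
def oddFun : Submodule (evenFun V) (V → ℂ) :=
  Submodule.span _ (Set.range fun (φ : Module.Dual ℂ V) (x : V) => φ x)

lemma oddFun_neg {P : V → ℂ} (hP : P ∈ oddFun V) (x : V) : P (-x) = -P x := by
  unfold oddFun at hP
  induction hP using Submodule.span_induction with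
  | mem P hP =>
    obtain ⟨φ, rfl⟩ := hP
    simp
  | zero => simp
  | add P Q _ _ h1 h2 => simp [h1, h2]; ring
  | smul a P _ h =>
    change a.1 (-x) * P (-x) = -(a.1 x * P x)
    rw [h, evenFun_neg a.2]
    ring

lemma oddFun_mul {P Q : V → ℂ} (hP : P ∈ oddFun V) (hQ : Q ∈ oddFun V) :
    P * Q ∈ evenFun V := by
  unfold oddFun at hP
  induction hP using Submodule.span_induction with
  | mem P hP =>
    obtain ⟨φ, rfl⟩ := hP
    unfold oddFun at hQ
    induction hQ using Submodule.span_induction with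
    | mem Q hQ =>
      obtain ⟨ψ, rfl⟩ := hQ
      exact Algebra.subset_adjoin ⟨(φ, ψ), rfl⟩
    | zero => simp
    | add P Q _ _ h1 h2 => rw [mul_add]; exact add_mem h1 h2
    | smul a Q _ h =>
      rw [mul_smul_comm]
      exact mul_mem a.2 h
  | zero => simp
  | add P Q _ _ h1 h2 => rw [add_mul]; exact add_mem h1 h2
  | smul a P _ h =>
    rw [smul_mul_assoc]
    exact mul_mem a.2 h

lemma exists_even_add_odd {P : V → ℂ} (hP : P ∈ polyFun V) :
    ∃ P₀ ∈ evenFun V, ∃ P₁ ∈ oddFun V, P = P₀ + P₁ := by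
  unfold polyFun at hP
  induction hP using Algebra.adjoin_induction with
  | mem P hP => exact ⟨0, zero_mem _, P, Submodule.subset_span hP, (zero_add P).symm⟩
  | algebraMap r => exact ⟨_, (evenFun V).algebraMap_mem r, 0, zero_mem _, (add_zero _).symm⟩
  | add P Q _ _ h1 h2 =>
    obtain ⟨P₀, a0, P₁, a1, rfl⟩ := h1
    obtain ⟨Q₀, b0, Q₁, b1, rfl⟩ := h2
    exact ⟨_, add_mem a0 b0, _, add_mem a1 b1, by ring⟩
  | mul P Q _ _ h1 h2 =>
    obtain ⟨P₀, a0, P₁, a1, rfl⟩ := h1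
    obtain ⟨Q₀, b0, Q₁, b1, rfl⟩ := h2
    refine ⟨P₀ * Q₀ + P₁ * Q₁, add_mem (mul_mem a0 b0) (oddFun_mul a1 b1), P₀ * Q₁ + Q₀ * P₁,
      add_mem ((oddFun V).smul_mem ⟨P₀, a0⟩ b1) ((oddFun V).smul_mem ⟨Q₀, b0⟩ a1), by ring⟩

/-- Split into even and odd parts; the odd part satisfies `P₁ = -P₁`. -/
lemma mem_evenFun {P : V → ℂ} (hP : P ∈ polyFun V) (h : ∀ x, P (-x) = P x) : P ∈ evenFun V := by
  obtain ⟨P₀, h0, P₁, h1, rfl⟩ := exists_even_add_odd hP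
  have : P₁ = 0 := by
    funext x
    have h2 := h x
    simp only [Pi.add_apply, evenFun_neg h0, oddFun_neg h1] at h2
    have h3 : 2 * P₁ x = 0 := by linear_combination -h2
    simpa using h3
  rw [this, add_zero]
  exact h0

end PolyFun

/-! ### Integrality of invariant rings of parametrised cones. -/

namespace InvariantCone

variable {G E W : Type} [Group G] [AddCommGroup E] [Module ℂ E] [AddCommGroup W] [Module ℂ W]
  {ρ : Representation ℂ G E} (C : InvariantCone ρ) {θ : W → C.carrier}

lemma comp_coordRing_mem_polyFun
    (hθ : ∀ φ : Module.Dual ℂ E, (fun w => φ (θ w : E)) ∈ polyFun W)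
    {H : C.carrier → ℂ} (hH : H ∈ C.coordRing) : (fun w => H (θ w)) ∈ polyFun W := by
  unfold coordRing at hH
  induction hH using Algebra.adjoin_induction with
  | mem P hP =>
    obtain ⟨φ, rfl⟩ := hP
    exact hθ φ
  | algebraMap r => exact const_mem_polyFun r
  | add P Q _ _ h1 h2 => exact add_mem h1 h2
  | mul P Q _ _ h1 h2 => exact mul_mem h1 h2

/-- Pulling back along a surjective polynomial parametrisation by a vector space embeds the
invariants into polynomial functions, which have no zero divisors. -/
lemma isDomain_invariantRing
    (hθ : ∀ φ : Module.Dual ℂ E, (fun w => φ (θ w : E)) ∈ polyFun W)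
    (hsurj : Function.Surjective θ) : IsDomain C.invariantRing := by
  have : Nontrivial C.invariantRing := ⟨0, 1, fun h => by
    have h1 := congrFun (congrArg Subtype.val h) (θ 0)
    exact zero_ne_one h1⟩
  have : NoZeroDivisors C.invariantRing := ⟨fun {H K} h => by
    have h1 := polyFun_eq_zero_or (C.comp_coordRing_mem_polyFun hθ H.2.1)
      (C.comp_coordRing_mem_polyFun hθ K.2.1) fun w => congrFun (congrArg Subtype.val h) (θ w)
    refine h1.imp (fun h0 => ?_) fun h0 => ?_ <;>
    · apply Subtype.ext
      funext x
      obtain ⟨w, rfl⟩ := hsurj x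
      exact congrFun h0 w⟩
  exact NoZeroDivisors.to_isDomain _

end InvariantCone

/-! ## Quadratic forms on the hyperplane as weighted graphs -/

namespace Igusa

/-- The vector `ε_k - ε_l` of the hyperplane. -/
def diffVec (k l : Fin 6) : hyperplane :=
  ⟨Pi.single k 1 - Pi.single l 1, by
    change ∑ i, (Pi.single k 1 - Pi.single l 1 : Fin 6 → ℂ) i = 0
    simp⟩

/-- Evaluation of forms at a vector. -/
def evalForm (d : ℕ) (z : hyperplane) : Module.Dual ℂ (Forms d) where
  toFun F := F.1 z
  map_add' _ _ := rfl
  map_smul' _ _ := rfl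

lemma evalForm_apply (d : ℕ) (z : hyperplane) (F : Forms d) : evalForm d z F = F.1 z := rfl

/-- The coefficient of `z_k z_l` of a quadratic form on the hyperplane, written without squares. -/
def coef (k l : Fin 6) : Module.Dual ℂ (Forms 2) := -evalForm 2 (diffVec k l)

lemma coef_apply (k l : Fin 6) (a : Forms 2) : coef k l a = -a.1 (diffVec k l) := rfl

/-- The product of two coordinates. -/
def coordProd (i j : Fin 6) : Forms 2 :=
  ⟨restrict (MvPolynomial.X i * MvPolynomial.X j), MvPolynomial.X i * MvPolynomial.X j,
    (MvPolynomial.isHomogeneous_X ℂ i).mul (MvPolynomial.isHomogeneous_X ℂ j), rfl⟩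

lemma coordProd_apply (i j : Fin 6) (z : hyperplane) : (coordProd i j).1 z = z.1 i * z.1 j := by
  simp [coordProd, restrict]

lemma forms_two_induction {p : Forms 2 → Prop} (h0 : p 0) (hadd : ∀ a b, p a → p b → p (a + b))
    (hmon : ∀ (c : ℂ) i j, p (c • coordProd i j)) (a : Forms 2) : p a := by
  obtain ⟨_, P, hP, rfl⟩ := a
  have hP' : P.IsHomogeneous 2 := hP
  have key : ∀ s : Finset (Fin 6 →₀ ℕ), (∀ d ∈ s, d.degree = 2) →
      ∀ h : restrict (∑ d ∈ s, MvPolynomial.monomial d (P.coeff d)) ∈ Forms 2, p ⟨_, h⟩ := by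
    classical
    intro s
    induction s using Finset.induction_on with
    | empty =>
      intro _ h
      convert h0
      simp
    | insert d s hd ih =>
      intro hs h
      have hdeg := hs d (Finset.mem_insert_self d s)
      obtain ⟨i, hi⟩ : ∃ i, d i ≠ 0 := by
        by_contra! h
        rw [show d = 0 from Finsupp.ext h] at hdeg
        simp at hdeg
      have h1 : Finsupp.single i 1 ≤ d := by
        rw [Finsupp.single_le_iff]
        omega
      obtain ⟨d', rfl⟩ := exists_add_of_le h1
      rw [map_add, Finsupp.degree_single] at hdeg
      obtain ⟨j, rfl⟩ : ∃ j, d' = Finsupp.single j 1 := by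
        obtain ⟨j, hj⟩ : ∃ j, d' j ≠ 0 := by
          by_contra! h
          rw [show d' = 0 from Finsupp.ext h] at hdeg
          simp at hdeg
        obtain ⟨d'', rfl⟩ := exists_add_of_le (Finsupp.single_le_iff.mpr
          (show 1 ≤ d' j by omega))
        rw [map_add, Finsupp.degree_single] at hdeg
        obtain rfl : d'' = 0 := (Finsupp.degree_eq_zero_iff d'').mp (by omega)
        exact ⟨j, add_zero _⟩
      have hm : restrict (∑ d ∈ s, MvPolynomial.monomial d (P.coeff d)) ∈ Forms 2 :=
        ⟨_, Submodule.sum_mem _ fun d hd => MvPolynomial.isHomogeneous_monomial _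
          (hs d (Finset.mem_insert_of_mem hd)), rfl⟩
      convert hadd _ _ (hmon (P.coeff (Finsupp.single i 1 + Finsupp.single j 1)) i j)
        (ih (fun d hd => hs d (Finset.mem_insert_of_mem hd)) hm) using 1
      have h2 : MvPolynomial.monomial (Finsupp.single i 1 + Finsupp.single j 1)
          (P.coeff (Finsupp.single i 1 + Finsupp.single j 1)) =
          P.coeff (Finsupp.single i 1 + Finsupp.single j 1) •
            (MvPolynomial.X i * MvPolynomial.X j) := by
        rw [MvPolynomial.X, MvPolynomial.X, MvPolynomial.monomial_mul, MvPolynomial.smul_monomial]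
        simp
      refine Subtype.ext ((congrArg restrict (Finset.sum_insert hd)).trans ?_)
      rw [map_add, h2, map_smul]
      rfl
  have h1 : ∀ d ∈ P.support, d.degree = 2 := fun d hd => by
    by_contra h
    exact (MvPolynomial.mem_support_iff.mp hd) (hP'.coeff_eq_zero h)
  have h2 := P.support_sum_monomial_coeff
  have h3 := key P.support h1
  rw [h2] at h3
  exact h3 _

/-- With `x` and `y` indicator functions of two vertices this becomes the rewriting of `z_i z_j`
without squares on the hyperplane. -/
lemma sum_sub_mul_sub {x y z : Fin 6 → ℂ} (hz : ∑ i, z i = 0) :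
    ∑ k, ∑ l, (x k - x l) * (y k - y l) * (z k * z l) =
      -(2 * ((∑ k, x k * z k) * ∑ k, y k * z k)) := by
  have e : ∀ k l, (x k - x l) * (y k - y l) * (z k * z l) =
      (x k * y k * z k) * z l - (x k * z k) * (y l * z l) - (y k * z k) * (x l * z l) +
        z k * (x l * y l * z l) := fun k l => by ring
  simp only [e, Finset.sum_add_distrib, Finset.sum_sub_distrib, ← Finset.mul_sum,
    ← Finset.sum_mul, hz]
  ring

/-- The factor `1 / 2` is there because each edge is counted in both orders. Together with
`exists_form` this identifies quadratic forms with symmetric matrices of zero diagonal. -/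
lemma form_eq_sum (a : Forms 2) : a = ∑ k, ∑ l, (1 / 2 * coef k l a) • coordProd k l := by
  induction a using forms_two_induction with
  | h0 => simp
  | hadd a b ha hb =>
    simp only [map_add, mul_add, add_smul, Finset.sum_add_distrib]
    rw [← ha, ← hb]
  | hmon c i j =>
    have h : coordProd i j = ∑ k, ∑ l, (1 / 2 * coef k l (coordProd i j)) • coordProd k l := by
      apply Subtype.ext
      funext z
      have hz : ∑ i, z.1 i = 0 := z.2
      have h1 := sum_sub_mul_sub (x := fun k => (Pi.single k 1 : Fin 6 → ℂ) i)
        (y := fun k => (Pi.single k 1 : Fin 6 → ℂ) j) hz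
      have h2 : ∀ i, ∑ k, (Pi.single k 1 : Fin 6 → ℂ) i * z.1 k = z.1 i := by
        intro i
        simp [Pi.single_apply]
      rw [h2, h2] at h1
      have h3 : ((∑ k, ∑ l, (1 / 2 * coef k l (coordProd i j)) • coordProd k l : Forms 2)).1 z =
          ∑ k, ∑ l, (1 / 2 * coef k l (coordProd i j)) * (z.1 k * z.1 l) := by
        simp only [Submodule.coe_sum, Finset.sum_apply, Submodule.coe_smul, Pi.smul_apply,
          coordProd_apply, smul_eq_mul]
      rw [h3, coordProd_apply]
      have h4 : ∀ k l, (1 / 2 * coef k l (coordProd i j)) * (z.1 k * z.1 l) =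
          -(1 / 2) * (((Pi.single k 1 : Fin 6 → ℂ) i - (Pi.single l 1 : Fin 6 → ℂ) i) *
            ((Pi.single k 1 : Fin 6 → ℂ) j - (Pi.single l 1 : Fin 6 → ℂ) j) *
            (z.1 k * z.1 l)) := by
        intro k l
        rw [coef_apply, coordProd_apply]
        simp only [diffVec, Pi.sub_apply]
        ring
      simp only [h4, ← Finset.mul_sum, h1]
      ring
    conv_lhs => rw [h]
    simp only [Finset.smul_sum, map_smul, smul_eq_mul, smul_smul]
    refine Finset.sum_congr rfl fun k _ => Finset.sum_congr rfl fun l _ => ?_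
    congr 1
    ring

lemma form_apply (a : Forms 2) (z : hyperplane) :
    a.1 z = ∑ k, ∑ l, 1 / 2 * coef k l a * (z.1 k * z.1 l) := by
  conv_lhs => rw [form_eq_sum a]
  simp only [Submodule.coe_sum, Finset.sum_apply, Submodule.coe_smul, Pi.smul_apply,
    coordProd_apply, smul_eq_mul]

lemma dual_eq_sum (φ : Module.Dual ℂ (Forms 2)) (a : Forms 2) :
    φ a = ∑ k, ∑ l, 1 / 2 * φ (coordProd k l) * coef k l a := by
  conv_lhs => rw [form_eq_sum a]
  simp only [map_sum, map_smul, smul_eq_mul]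
  refine Finset.sum_congr rfl fun k _ => Finset.sum_congr rfl fun l _ => ?_
  ring

lemma coef_self (k : Fin 6) (a : Forms 2) : coef k k a = 0 := by
  rw [coef_apply, form_apply]
  simp [diffVec]

lemma coef_comm (k l : Fin 6) (a : Forms 2) : coef k l a = coef l k a := by
  rw [coef_apply, coef_apply, form_apply, form_apply]
  congr 1
  refine Finset.sum_congr rfl fun k _ => Finset.sum_congr rfl fun l _ => ?_
  simp only [diffVec, Pi.sub_apply]
  ring

lemma coef_perm (σ : Equiv.Perm (Fin 6)) (k l : Fin 6) (a : Forms 2) :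
    coef k l (permForms 2 σ a) = coef (σ⁻¹ k) (σ⁻¹ l) a := by
  rw [coef_apply, coef_apply]
  change -a.1 (permute σ (diffVec k l)) = _
  refine congrArg (fun v => -a.1 v) (Subtype.ext (funext fun i => ?_))
  change (Pi.single k 1 - Pi.single l 1 : Fin 6 → ℂ) (σ i) =
    (Pi.single (σ⁻¹ k) 1 - Pi.single (σ⁻¹ l) 1 : Fin 6 → ℂ) i
  simp only [Pi.sub_apply, Pi.single_apply, Equiv.Perm.eq_inv_iff_eq]

lemma exists_form (c : Fin 6 → Fin 6 → ℂ) (hc : ∀ k l, c k l = c l k) (h0 : ∀ k, c k k = 0) :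
    ∃ a : Forms 2, ∀ k l, coef k l a = c k l := by
  refine ⟨∑ k, ∑ l, (1 / 2 * c k l) • coordProd k l, fun i j => ?_⟩
  rw [coef_apply]
  simp only [Submodule.coe_sum, Finset.sum_apply, Submodule.coe_smul, Pi.smul_apply,
    coordProd_apply, smul_eq_mul]
  simp only [diffVec, Pi.sub_apply, Pi.single_apply, mul_sub, sub_mul, Finset.sum_sub_distrib]
  simp [h0, hc i j]
  ring

/-! ### Vertex weights and moments -/

/-- The sum of the weights of the edges at a vertex. -/
def deg (k : Fin 6) : Module.Dual ℂ (Forms 2) := ∑ l, coef k l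

lemma deg_apply (k : Fin 6) (a : Forms 2) : deg k a = ∑ l, coef k l a := by
  simp [deg]

/-- Twice the sum of all coefficients. -/
def tot : Module.Dual ℂ (Forms 2) := ∑ k, deg k

lemma tot_apply (a : Forms 2) : tot a = ∑ k, deg k a := by
  simp [tot]

lemma deg_perm (σ : Equiv.Perm (Fin 6)) (k : Fin 6) (a : Forms 2) :
    deg k (permForms 2 σ a) = deg (σ⁻¹ k) a := by
  simp only [deg_apply, coef_perm]
  exact Equiv.sum_comp σ⁻¹ fun l => coef (σ⁻¹ k) l a

lemma tot_perm (σ : Equiv.Perm (Fin 6)) (a : Forms 2) : tot (permForms 2 σ a) = tot a := by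
  simp only [tot_apply, deg_perm]
  exact Equiv.sum_comp σ⁻¹ fun k => deg k a

/-- The moments `∑ c_kl x_k^p x_l^q`. -/
def moment {A : Type} [CommRing A] (c : Fin 6 → Fin 6 → A) (x : Fin 6 → A) (p q : ℕ) : A :=
  ∑ k, ∑ l, c k l * (x k ^ p * x l ^ q)

/-- The product of all differences of two coordinates. -/
def diffProd {A : Type} [CommRing A] (x : Fin 6 → A) : A :=
  ∏ k, ∏ l ∈ Finset.univ.erase k, (x k - x l)

lemma moment_comm {A : Type} [CommRing A] {c : Fin 6 → Fin 6 → A} (hc : ∀ k l, c k l = c l k)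
    (x : Fin 6 → A) (p q : ℕ) : moment c x p q = moment c x q p := by
  rw [moment, Finset.sum_comm]
  refine Finset.sum_congr rfl fun k _ => Finset.sum_congr rfl fun l _ => ?_
  rw [hc l k]
  ring

lemma moment_zero_left {A : Type} [CommRing A] {c : Fin 6 → Fin 6 → A}
    (hc : ∀ k l, c k l = c l k) (x : Fin 6 → A) (q : ℕ) :
    moment c x 0 q = ∑ k, (∑ l, c k l) * x k ^ q := by
  rw [moment, Finset.sum_comm]
  refine Finset.sum_congr rfl fun k _ => ?_
  rw [Finset.sum_mul]
  refine Finset.sum_congr rfl fun l _ => ?_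
  rw [hc l k]
  ring

lemma moment_perm {A : Type} [CommRing A] (c : Fin 6 → Fin 6 → A) (x : Fin 6 → A) (p q : ℕ)
    (σ : Equiv.Perm (Fin 6)) :
    moment (fun k l => c (σ k) (σ l)) (fun k => x (σ k)) p q = moment c x p q := by
  exact (Finset.sum_congr rfl fun k _ =>
    Equiv.sum_comp σ fun l => c (σ k) l * (x (σ k) ^ p * x l ^ q)).trans
    (Equiv.sum_comp σ fun k => ∑ l, c k l * (x k ^ p * x l ^ q))

lemma diffProd_perm {A : Type} [CommRing A] (x : Fin 6 → A) (σ : Equiv.Perm (Fin 6)) :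
    diffProd (fun k => x (σ k)) = diffProd x := by
  refine (Finset.prod_congr rfl fun k _ => ?_).trans
    (Equiv.prod_comp σ fun k => ∏ l ∈ Finset.univ.erase k, (x k - x l))
  refine Finset.prod_bij (fun l _ => σ l) ?_ ?_ ?_ ?_
  · intro l hl
    simpa using hl
  · intro l _ l' _ h
    exact σ.injective h
  · intro l hl
    exact ⟨σ⁻¹ l, by
      rw [Finset.mem_erase, ne_eq, Equiv.Perm.inv_eq_iff_eq]
      simpa using hl, by simp⟩
  · intro l _
    rfl

lemma diffProd_ne_zero_iff (x : Fin 6 → ℂ) : diffProd x ≠ 0 ↔ Function.Injective x := by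
  simp only [diffProd, Finset.prod_ne_zero_iff, Finset.mem_univ, true_implies, Finset.mem_erase,
    and_true, sub_ne_zero]
  constructor
  · intro h k l hkl
    by_contra hne
    exact h k l (Ne.symm hne) hkl
  · intro h k l hne hkl
    exact hne (h hkl).symm

end Igusa

namespace Igusa

/-! ### Identities between moments -/

section Moments

variable {A : Type} [CommRing A] {c : Fin 6 → Fin 6 → A} {x : Fin 6 → A}

lemma sum_eval_mul_eval (c : Fin 6 → Fin 6 → A) (x : Fin 6 → A) {K : Polynomial A} {n : ℕ}
    (hK : K.natDegree < n) :
    ∑ k, ∑ l, c k l * (K.eval (x k) * K.eval (x l)) =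
      ∑ p ∈ Finset.range n, ∑ q ∈ Finset.range n, K.coeff p * K.coeff q * moment c x p q := by
  have e : ∀ k l, c k l * (K.eval (x k) * K.eval (x l)) =
      ∑ p ∈ Finset.range n, ∑ q ∈ Finset.range n,
        K.coeff p * K.coeff q * (c k l * (x k ^ p * x l ^ q)) := by
    intro k l
    rw [Polynomial.eval_eq_sum_range' hK, Polynomial.eval_eq_sum_range' hK,
      Finset.sum_mul_sum, Finset.mul_sum]
    refine Finset.sum_congr rfl fun p _ => ?_
    rw [Finset.mul_sum]
    refine Finset.sum_congr rfl fun q _ => ?_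
    ring
  simp only [e, moment, Finset.mul_sum]
  rw [Finset.sum_congr rfl fun k _ => Finset.sum_comm, Finset.sum_comm]
  refine Finset.sum_congr rfl fun p _ => ?_
  rw [Finset.sum_congr rfl fun k _ => Finset.sum_comm, Finset.sum_comm]

/-- A polynomial that vanishes at all nodes but two isolates a single edge weight. Since the left
side is a combination of moments, this inverts the passage from weights to moments. -/
lemma sum_eval_mul_eval_of_eval_eq_zero (hc : ∀ k l, c k l = c l k) (h0 : ∀ k, c k k = 0)
    {K : Polynomial A} {i j : Fin 6} (hij : i ≠ j)
    (hK : ∀ m, m ≠ i → m ≠ j → K.eval (x m) = 0) :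
    ∑ k, ∑ l, c k l * (K.eval (x k) * K.eval (x l)) =
      2 * (c i j * (K.eval (x i) * K.eval (x j))) := by
  have e : ∀ k, ∑ l, c k l * (K.eval (x k) * K.eval (x l)) =
      c k i * (K.eval (x k) * K.eval (x i)) + c k j * (K.eval (x k) * K.eval (x j)) := fun k =>
    Finset.sum_eq_add i j hij (fun m _ hm => by rw [hK m hm.1 hm.2]; ring) (by simp) (by simp)
  simp only [e]
  rw [Finset.sum_eq_add i j hij (fun m _ hm => by rw [hK m hm.1 hm.2]; ring) (by simp) (by simp),
    h0, h0, hc j i]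
  ring

/-- The monic polynomial vanishing at the given points, except at those of `s`. -/
def nodal (x : Fin 6 → A) (s : Finset (Fin 6)) : Polynomial A :=
  ∏ m ∈ Finset.univ \ s, (.X - .C (x m))

lemma eval_nodal (x : Fin 6 → A) (s : Finset (Fin 6)) (t : A) :
    (nodal x s).eval t = ∏ m ∈ Finset.univ \ s, (t - x m) := by
  simp [nodal, Polynomial.eval_prod]

lemma eval_nodal_eq_zero (x : Fin 6 → A) {s : Finset (Fin 6)} {m : Fin 6} (hm : m ∉ s) :
    (nodal x s).eval (x m) = 0 := by
  rw [eval_nodal]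
  exact Finset.prod_eq_zero (Finset.mem_sdiff.mpr ⟨Finset.mem_univ m, hm⟩) (sub_self _)

lemma natDegree_nodal_le (x : Fin 6 → A) (s : Finset (Fin 6)) :
    (nodal x s).natDegree ≤ 6 - s.card := by
  refine (Polynomial.natDegree_prod_le _ _).trans ((Finset.sum_le_card_nsmul _ _ 1
    fun m _ => Polynomial.natDegree_X_sub_C_le _).trans ?_)
  rw [Finset.card_sdiff_of_subset (Finset.subset_univ s)]
  simp

lemma coeff_nodal_mem (S : Subring A) (hx : ∀ m, x m ∈ S) (s : Finset (Fin 6)) (n : ℕ) :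
    (nodal x s).coeff n ∈ S := by
  have h : nodal x s = (∏ m ∈ Finset.univ \ s, (.X - .C ⟨x m, hx m⟩ : Polynomial S)).map
      S.subtype := by
    simp [nodal, Polynomial.map_prod]
  rw [h, Polynomial.coeff_map]
  exact Subtype.prop _

lemma coeff_nodal_empty (x : Fin 6 → A) : (nodal x ∅).coeff 6 = 1 := by
  rcases subsingleton_or_nontrivial A with h | h
  · exact Subsingleton.elim _ _
  · have h1 : (nodal x ∅).natDegree = 6 := by
      simp [nodal]
    have h2 : (nodal x ∅).Monic := Polynomial.monic_prod_of_monic _ _ fun m _ =>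
      Polynomial.monic_X_sub_C _
    exact (congrArg _ h1).symm.trans h2

/-- The linear relation between the moments of a function supported off the diagonal that comes
from the divided difference of a polynomial of degree at most six. -/
lemma sum_coeff_mul_moment (h0 : ∀ k, c k k = 0) (hx : ∀ k l, k ≠ l → IsUnit (x k - x l))
    {E : Polynomial A} (hE : E.natDegree ≤ 6) (hEx : ∀ k, E.eval (x k) = 0) :
    ∑ j ∈ Finset.range 7, E.coeff j * ∑ p ∈ Finset.range j, moment c x p (j - 1 - p) = 0 := by
  have e : ∀ k l, c k l * (∑ j ∈ Finset.range 7, E.coeff j *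
      ∑ p ∈ Finset.range j, x k ^ p * x l ^ (j - 1 - p)) = 0 := by
    intro k l
    rcases eq_or_ne k l with rfl | hkl
    · rw [h0, zero_mul]
    -- The geometric sum is the divided difference `(E(x_k) - E(x_l)) / (x_k - x_l)`, and `E`
    -- vanishes at both nodes.
    · refine mul_eq_zero_of_right _ ((hx k l hkl).mul_right_cancel ?_)
      rw [Finset.sum_mul, zero_mul]
      simp only [mul_assoc, geom_sum₂_mul]
      simp only [mul_sub, Finset.sum_sub_distrib]
      rw [← Polynomial.eval_eq_sum_range' (by omega), ← Polynomial.eval_eq_sum_range' (by omega),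
        hEx, hEx, sub_self]
  have h := Finset.sum_eq_zero fun k (_ : k ∈ Finset.univ) =>
    Finset.sum_eq_zero fun l (_ : l ∈ Finset.univ) => e k l
  rw [← h]
  simp only [Finset.mul_sum, moment]
  rw [Finset.sum_congr rfl fun k _ => Finset.sum_comm, Finset.sum_comm]
  refine Finset.sum_congr rfl fun j _ => ?_
  rw [Finset.sum_congr rfl fun k _ => Finset.sum_comm, Finset.sum_comm]
  refine Finset.sum_congr rfl fun p _ => Finset.sum_congr rfl fun k _ =>
    Finset.sum_congr rfl fun l _ => ?_
  ring

/-- The moment of type `(1,4)` in terms of the others. -/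
lemma two_mul_moment_one_four (hc : ∀ k l, c k l = c l k) (h0 : ∀ k, c k k = 0)
    (hx : ∀ k l, k ≠ l → IsUnit (x k - x l)) :
    2 * moment c x 1 4 = -(2 * moment c x 0 5 + 2 * moment c x 2 3 +
      ∑ j ∈ Finset.range 6, (nodal x ∅).coeff j *
        ∑ p ∈ Finset.range j, moment c x p (j - 1 - p)) := by
  have h := sum_coeff_mul_moment h0 hx (natDegree_nodal_le x ∅)
    fun k => eval_nodal_eq_zero x (Finset.notMem_empty k)
  -- The leading term `j = 6` contributes the moments of total degree five: types `(0,5)`, `(1,4)`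
  -- and `(2,3)`, each twice by symmetry.
  rw [Finset.sum_range_succ, coeff_nodal_empty, one_mul] at h
  simp only [Finset.sum_range_succ _ 5, Finset.sum_range_succ _ 4, Finset.sum_range_succ _ 3,
    Finset.sum_range_succ _ 2, Finset.sum_range_succ _ 1, Finset.sum_range_succ _ 0,
    Finset.sum_range_zero] at h ⊢
  norm_num at h ⊢
  rw [moment_comm hc x 5 0, moment_comm hc x 4 1, moment_comm hc x 3 2] at h
  linear_combination h

end Moments

lemma sum_mul_pow_injective {x : Fin 6 → ℂ} (hx : Function.Injective x) {s t : Fin 6 → ℂ}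
    (h : ∀ q : Fin 6, ∑ k, s k * x k ^ (q : ℕ) = ∑ k, t k * x k ^ (q : ℕ)) : s = t := by
  have := Matrix.eq_zero_of_forall_pow_sum_mul_pow_eq_zero hx (v := s - t) fun q => by
    simp [sub_mul, Finset.sum_sub_distrib, h q]
  exact sub_eq_zero.mp this

/-- A function supported off the diagonal is determined by its moments, which are arbitrary. -/
lemma exists_moment_eq {x : Fin 6 → ℂ} (hx : Function.Injective x) (t : Fin 5 → Fin 5 → ℂ)
    (ht : ∀ p q, t p q = t q p) :
    ∃ c : Fin 6 → Fin 6 → ℂ, (∀ k l, c k l = c l k) ∧ (∀ k, c k k = 0) ∧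
      ∀ p q : Fin 5, moment c x p q = t p q := by
  let ext (f : {e : Fin 6 × Fin 6 // e.1 < e.2} → ℂ) (k l : Fin 6) : ℂ :=
    if h : k < l then f ⟨(k, l), h⟩ else if h : l < k then f ⟨(l, k), h⟩ else 0
  have hsymm : ∀ f k l, ext f k l = ext f l k := by
    intro f k l
    rcases lt_trichotomy k l with h | rfl | h
    · simp [ext, h, h.not_gt]
    · rfl
    · simp [ext, h, h.not_gt]
  have hdiag : ∀ f k, ext f k k = 0 := by
    intro f k
    simp [ext]
  let L : ({e : Fin 6 × Fin 6 // e.1 < e.2} → ℂ) →ₗ[ℂ] ({e : Fin 5 × Fin 5 // e.1 ≤ e.2} → ℂ) :=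
    { toFun := fun f e => moment (ext f) x e.1.1 e.1.2
      map_add' := fun f g => by
        funext e
        simp only [Pi.add_apply, moment, ← Finset.sum_add_distrib, ← add_mul]
        refine Finset.sum_congr rfl fun k _ => Finset.sum_congr rfl fun l _ => ?_
        congr 1
        simp only [ext]
        split_ifs <;> simp
      map_smul' := fun r f => by
        funext e
        simp only [Pi.smul_apply, smul_eq_mul, moment, Finset.mul_sum, ← mul_assoc,
          RingHom.id_apply]
        refine Finset.sum_congr rfl fun k _ => Finset.sum_congr rfl fun l _ => ?_
        congr 2
        simp only [ext]
        split_ifs <;> simp }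
  have hinj : Function.Injective L := by
    rw [injective_iff_map_eq_zero]
    intro f hf
    have hm : ∀ p ∈ Finset.range 5, ∀ q ∈ Finset.range 5, moment (ext f) x p q = 0 := by
      intro p hp q hq
      rw [Finset.mem_range] at hp hq
      rcases le_total p q with h | h
      · exact congrFun hf ⟨(⟨p, hp⟩, ⟨q, hq⟩), h⟩
      · rw [moment_comm (hsymm f)]
        exact congrFun hf ⟨(⟨q, hq⟩, ⟨p, hp⟩), h⟩
    funext ⟨⟨i, j⟩, hij⟩
    have hne : i ≠ j := ne_of_lt hij
    -- Removing two of the six nodes leaves a polynomial of degree four, so only moments with both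
    -- exponents at most four occur.
    have h1 := sum_eval_mul_eval (ext f) x (K := nodal x {i, j}) (n := 5)
      (lt_of_le_of_lt (natDegree_nodal_le x {i, j}) (by rw [Finset.card_pair hne]; norm_num))
    rw [sum_eval_mul_eval_of_eval_eq_zero (hsymm f) (hdiag f) hne
      fun m h1 h2 => eval_nodal_eq_zero x (by simp [h1, h2]),
      Finset.sum_eq_zero fun p hp => Finset.sum_eq_zero fun q hq => by
        rw [hm p hp q hq, mul_zero]] at h1
    have h2 : ∀ k ∈ ({i, j} : Finset (Fin 6)), (nodal x {i, j}).eval (x k) ≠ 0 := by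
      intro k hk
      rw [eval_nodal, Finset.prod_ne_zero_iff]
      intro m hm h
      rw [hx (sub_eq_zero.mp h)] at hk
      exact (Finset.mem_sdiff.mp hm).2 hk
    have h3 : ext f i j = 0 := by
      have := h2 i (by simp)
      have := h2 j (by simp)
      simp_all
    have h4 : ext f i j = f ⟨(i, j), hij⟩ := dif_pos hij
    rw [← h4, h3]
    rfl
  -- Both spaces have dimension fifteen: pairs `i < j` of six vertices against pairs `p ≤ q` of five
  -- exponents.
  have hsurj : Function.Surjective L :=
    (LinearMap.injective_iff_surjective_of_finrank_eq_finrank (by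
      rw [Module.finrank_fintype_fun_eq_card, Module.finrank_fintype_fun_eq_card]
      decide)).mp hinj
  obtain ⟨f, hf⟩ := hsurj fun e => t e.1.1 e.1.2
  refine ⟨ext f, hsymm f, hdiag f, fun p q => ?_⟩
  rcases le_total p q with h | h
  · exact congrFun hf ⟨(p, q), h⟩
  · rw [moment_comm (hsymm f), ht]
    exact congrFun hf ⟨(q, p), h⟩

/-- By Vieta, the roots of the monic sextic with the corresponding signed coefficients will do. -/
lemma exists_aeval_esymm_eq (s : Fin 6 → ℂ) : ∃ x : Fin 6 → ℂ,
    ∀ i : Fin 6, MvPolynomial.aeval x (MvPolynomial.esymm (Fin 6) ℂ (i + 1)) = s i := by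
  let p : Polynomial ℂ := .X ^ 6 + ∑ i : Fin 6, .C ((-1) ^ ((i : ℕ) + 1) * s i) * .X ^ (5 - (i : ℕ))
  have hdeg : (∑ i : Fin 6, .C ((-1) ^ ((i : ℕ) + 1) * s i) * .X ^ (5 - (i : ℕ)) :
      Polynomial ℂ).degree < (6 : ℕ) := by
    refine (Polynomial.degree_sum_le _ _).trans_lt ?_
    rw [Finset.sup_lt_iff (by exact WithBot.bot_lt_coe 6)]
    intro i _
    refine (Polynomial.degree_C_mul_X_pow_le _ _).trans_lt ?_
    exact_mod_cast show 5 - (i : ℕ) < 6 by omega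
  have hmonic : p.Monic := Polynomial.monic_X_pow_add hdeg
  have hnat : p.natDegree = 6 := by
    refine Polynomial.natDegree_eq_of_degree_eq_some ?_
    rw [Polynomial.degree_add_eq_left_of_degree_lt (by rwa [Polynomial.degree_X_pow]),
      Polynomial.degree_X_pow]
  have hcard : p.roots.card = 6 := by
    rw [← hnat]
    exact Polynomial.splits_iff_card_roots.mp (IsAlgClosed.splits p)
  obtain ⟨x, hx⟩ : ∃ x : Fin 6 → ℂ, Finset.univ.val.map x = p.roots := by
    refine ⟨fun i => p.roots.toList.get (i.cast (by rw [Multiset.length_toList, hcard])), ?_⟩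
    rw [Fin.univ_val_map]
    conv_rhs => rw [← Multiset.coe_toList p.roots]
    congr 1
    apply List.ext_get
    · simp [hcard]
    · intro n h1 h2
      rw [List.get_ofFn]
      rfl
  refine ⟨x, fun i => ?_⟩
  rw [MvPolynomial.aeval_esymm_eq_multiset_esymm, hx]
  have h := Polynomial.coeff_eq_esymm_roots_of_splits (IsAlgClosed.splits p)
    (k := 5 - (i : ℕ)) (by omega)
  rw [hmonic.leadingCoeff, hnat, show 6 - (5 - (i : ℕ)) = i + 1 by omega, one_mul] at h
  have h2 : p.coeff (5 - (i : ℕ)) = (-1) ^ ((i : ℕ) + 1) * s i := by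
    simp only [p, Polynomial.coeff_add, Polynomial.coeff_X_pow, Polynomial.finsetSum_coeff,
      Polynomial.coeff_C_mul]
    rw [Finset.sum_eq_single i]
    · rw [if_neg (by omega)]
      simp
    · intro j _ hj
      rw [if_neg, mul_zero]
      intro h
      apply hj
      apply Fin.ext
      omega
    · simp
  rw [h2] at h
  exact (mul_left_cancel₀ (pow_ne_zero _ (by norm_num)) h).symm

end Igusa

namespace Igusa

/-! ### The invariants of the symmetric group on quadratic forms -/

/-- The types of the moments used as coordinates. -/
def momentType : Fin 9 → ℕ × ℕ :=
  ![(1, 1), (1, 2), (1, 3), (2, 2), (2, 3), (2, 4), (3, 3), (3, 4), (4, 4)]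

/-- Fourteen invariants of a quadratic form: five elementary symmetric functions of the vertex
weights, and nine moments. -/
def invCoord (a : Forms 2) : Fin 5 ⊕ Fin 9 → ℂ :=
  Sum.elim (fun i => MvPolynomial.aeval (fun k => deg k a) (MvPolynomial.esymm (Fin 6) ℂ (i + 2)))
    fun r => moment (fun k l => coef k l a) (fun k => deg k a) (momentType r).1 (momentType r).2

lemma aeval_mem_polyFun {V ι : Type} [AddCommGroup V] [Module ℂ V] {f : ι → V → ℂ}
    (hf : ∀ i, f i ∈ polyFun V) (P : MvPolynomial ι ℂ) :
    (fun x => MvPolynomial.aeval (fun i => f i x) P) ∈ polyFun V := by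
  induction P using MvPolynomial.induction_on with
  | C c => simpa using const_mem_polyFun c
  | add P Q h1 h2 =>
    simp only [map_add]
    exact add_mem h1 h2
  | mul_X P i h =>
    simp only [map_mul, MvPolynomial.aeval_X]
    exact mul_mem h (hf i)

lemma sum_mem_polyFun {V ι : Type} [AddCommGroup V] [Module ℂ V] (s : Finset ι) {f : ι → V → ℂ}
    (hf : ∀ i ∈ s, (fun x => f i x) ∈ polyFun V) : (fun x => ∑ i ∈ s, f i x) ∈ polyFun V := by
  have := sum_mem hf
  rwa [show ∑ i ∈ s, (fun x => f i x) = fun x => ∑ i ∈ s, f i x by funext x; simp] at this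

lemma prod_mem_polyFun {V ι : Type} [AddCommGroup V] [Module ℂ V] (s : Finset ι) {f : ι → V → ℂ}
    (hf : ∀ i ∈ s, (fun x => f i x) ∈ polyFun V) : (fun x => ∏ i ∈ s, f i x) ∈ polyFun V := by
  have := prod_mem hf
  rwa [show ∏ i ∈ s, (fun x => f i x) = fun x => ∏ i ∈ s, f i x by funext x; simp] at this

lemma invCoord_mem_polyFun (j : Fin 5 ⊕ Fin 9) :
    (fun a => invCoord a j) ∈ polyFun (Forms 2) := by
  rcases j with i | r
  · exact aeval_mem_polyFun (fun k => dual_mem_polyFun (deg k)) _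
  · change (fun a => ∑ k, ∑ l, coef k l a * (deg k a ^ _ * deg l a ^ _)) ∈ _
    exact sum_mem_polyFun _ fun k _ => sum_mem_polyFun _ fun l _ =>
      mul_mem (dual_mem_polyFun (coef k l)) (mul_mem (pow_mem (dual_mem_polyFun (deg k)) _)
        (pow_mem (dual_mem_polyFun (deg l)) _))

lemma invCoord_perm (σ : Equiv.Perm (Fin 6)) (a : Forms 2) :
    invCoord (permForms 2 σ a) = invCoord a := by
  funext j
  rcases j with i | r
  · change MvPolynomial.aeval _ _ = MvPolynomial.aeval _ _
    conv_rhs => rw [← MvPolynomial.rename_esymm (Fin 6) ℂ _ σ⁻¹, MvPolynomial.aeval_rename]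
    simp only [deg_perm]
    rfl
  · change moment (fun k l => coef k l (permForms 2 σ a)) (fun k => deg k (permForms 2 σ a)) _ _ =
      moment (fun k l => coef k l a) (fun k => deg k a) _ _
    simp only [deg_perm, coef_perm]
    exact moment_perm (fun k l => coef k l a) (fun k => deg k a) _ _ σ⁻¹

lemma diffProd_deg_perm (σ : Equiv.Perm (Fin 6)) (a : Forms 2) :
    diffProd (fun k => deg k (permForms 2 σ a)) = diffProd fun k => deg k a := by
  simp only [deg_perm]
  exact diffProd_perm (fun k => deg k a) σ⁻¹

lemma diffProd_deg_mem_polyFun : (fun a => diffProd fun k => deg k a) ∈ polyFun (Forms 2) :=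
  prod_mem_polyFun _ fun k _ => prod_mem_polyFun _ fun l _ =>
    sub_mem (dual_mem_polyFun (deg k)) (dual_mem_polyFun (deg l))

/-- Evaluation of polynomials in six variables over a polynomial ring. -/
def eval₂At {J : Type} (x : Fin 6 → ℂ) (y : J → ℂ) :
    MvPolynomial (Fin 6) (MvPolynomial J ℂ) →+* ℂ :=
  MvPolynomial.eval₂Hom (MvPolynomial.eval y) x

/-- A symmetric polynomial is a polynomial in the elementary symmetric functions. -/
lemma exists_eval_eq_of_isSymmetric (Q : MvPolynomial (Fin 6) (MvPolynomial (Fin 5 ⊕ Fin 9) ℂ))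
    (hQ : Q.IsSymmetric) : ∃ q : MvPolynomial (Fin 5 ⊕ Fin 9) ℂ, ∀ x y, ∑ k, x k = 1 →
      (∀ i : Fin 5, MvPolynomial.aeval x (MvPolynomial.esymm (Fin 6) ℂ (i + 2)) = y (.inl i)) →
      eval₂At x y Q = MvPolynomial.eval y q := by
  obtain ⟨p, hp⟩ := MvPolynomial.esymmAlgHom_surjective (MvPolynomial (Fin 5 ⊕ Fin 9) ℂ)
    (σ := Fin 6) (n := 6) (by simp) ⟨Q, hQ⟩
  have hp' : MvPolynomial.aeval (fun i : Fin 6 => MvPolynomial.esymm (Fin 6)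
      (MvPolynomial (Fin 5 ⊕ Fin 9) ℂ) (i + 1)) p = Q := by
    rw [← MvPolynomial.esymmAlgHom_apply, hp]
  -- The first elementary symmetric function is the total weight, which is normalised to `1`; the
  -- other five are variables.
  refine ⟨MvPolynomial.aeval (Fin.cons 1 fun i => MvPolynomial.X (.inl i)) p,
    fun x y hx hy => ?_⟩
  have hes : ∀ n, eval₂At x y (MvPolynomial.esymm (Fin 6) (MvPolynomial (Fin 5 ⊕ Fin 9) ℂ) n) =
      MvPolynomial.aeval x (MvPolynomial.esymm (Fin 6) ℂ n) := by
    intro n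
    simp [eval₂At, MvPolynomial.esymm, map_sum, map_prod]
  have h := RingHom.congr_fun (MvPolynomial.ringHom_ext
    (f := (eval₂At x y).comp (MvPolynomial.aeval (fun i : Fin 6 => MvPolynomial.esymm (Fin 6)
      (MvPolynomial (Fin 5 ⊕ Fin 9) ℂ) (i + 1))).toRingHom)
    (g := (MvPolynomial.eval y).comp (MvPolynomial.aeval (R := MvPolynomial (Fin 5 ⊕ Fin 9) ℂ)
      (Fin.cons 1 fun i : Fin 5 => MvPolynomial.X (.inl i) : Fin 6 → _)).toRingHom)
    (fun c => by simp [eval₂At]) fun i => by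
      simp only [RingHom.comp_apply, AlgHom.toRingHom_eq_coe, RingHom.coe_coe,
        MvPolynomial.aeval_X, hes]
      refine Fin.cases ?_ (fun i => ?_) i
      · simp [MvPolynomial.esymm_one, hx]
      · simpa using hy i) p
  rw [← hp']
  exact h

lemma map_diffProd {A B : Type} [CommRing A] [CommRing B] (f : A →+* B) (x : Fin 6 → A) :
    f (diffProd x) = diffProd fun k => f (x k) := by
  simp [diffProd, map_prod]

lemma exists_eval_eq_diffProd : ∃ D : MvPolynomial (Fin 5 ⊕ Fin 9) ℂ, ∀ x y, ∑ k, x k = 1 →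
    (∀ i : Fin 5, MvPolynomial.aeval x (MvPolynomial.esymm (Fin 6) ℂ (i + 2)) = y (.inl i)) →
    diffProd x = MvPolynomial.eval y D := by
  obtain ⟨D, hD⟩ := exists_eval_eq_of_isSymmetric (diffProd MvPolynomial.X) fun σ => by
    change (MvPolynomial.rename σ : _ →ₐ[_] _).toRingHom _ = _
    rw [map_diffProd]
    simpa using diffProd_perm (MvPolynomial.X : Fin 6 → MvPolynomial (Fin 6)
      (MvPolynomial (Fin 5 ⊕ Fin 9) ℂ)) σ
  refine ⟨D, fun x y hx hy => ?_⟩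
  rw [← hD x y hx hy, map_diffProd]
  simp [eval₂At]

/-- The invariants take all values at which the discriminant does not vanish. -/
lemma exists_invCoord_eq {x : Fin 6 → ℂ} {y : Fin 5 ⊕ Fin 9 → ℂ} (hx : Function.Injective x)
    (hy : ∀ i : Fin 5, MvPolynomial.aeval x (MvPolynomial.esymm (Fin 6) ℂ (i + 2)) = y (.inl i)) :
    ∃ a : Forms 2, (∀ k, deg k a = x k) ∧ invCoord a = y := by
  let s : ℕ → ℂ := fun q => ∑ k, x k * x k ^ q
  let z : Fin 9 → ℂ := fun r => y (.inr r)
  let e : ℕ → ℂ := (nodal x ∅).coeff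
  -- The value that `two_mul_moment_one_four` forces on the moment of type `(1,4)` if the one of
  -- type `(0,5)` is to be `s 5`.
  let u : ℂ := -(s 5 + z 4 + (e 1 * s 0 + e 2 * (2 * s 1) + e 3 * (2 * s 2 + z 0) +
    e 4 * (2 * s 3 + 2 * z 1) + e 5 * (2 * s 4 + 2 * z 2 + z 3)) / 2)
  let t : Fin 5 → Fin 5 → ℂ := ![![s 0, s 1, s 2, s 3, s 4], ![s 1, z 0, z 1, z 2, u],
    ![s 2, z 1, z 3, z 4, z 5], ![s 3, z 2, z 4, z 6, z 7], ![s 4, u, z 5, z 7, z 8]]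
  obtain ⟨c, hc, h0, hm⟩ := exists_moment_eq hx t (by
    intro p q
    fin_cases p <;> fin_cases q <;> rfl)
  have m00 : moment c x 0 0 = s 0 := hm 0 0
  have m01 : moment c x 0 1 = s 1 := hm 0 1
  have m02 : moment c x 0 2 = s 2 := hm 0 2
  have m03 : moment c x 0 3 = s 3 := hm 0 3
  have m04 : moment c x 0 4 = s 4 := hm 0 4
  have m11 : moment c x 1 1 = z 0 := hm 1 1
  have m12 : moment c x 1 2 = z 1 := hm 1 2
  have m13 : moment c x 1 3 = z 2 := hm 1 3
  have m14 : moment c x 1 4 = u := hm 1 4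
  have m22 : moment c x 2 2 = z 3 := hm 2 2
  have m23 : moment c x 2 3 = z 4 := hm 2 3
  have m05 : moment c x 0 5 = s 5 := by
    have h := two_mul_moment_one_four hc h0 fun k l hkl =>
      (sub_ne_zero.mpr (hx.ne hkl)).isUnit
    simp only [Finset.sum_range_succ _ 5, Finset.sum_range_succ _ 4, Finset.sum_range_succ _ 3,
      Finset.sum_range_succ _ 2, Finset.sum_range_succ _ 1, Finset.sum_range_succ _ 0,
      Finset.sum_range_zero] at h
    norm_num at h
    rw [moment_comm hc x 1 0, moment_comm hc x 2 0, moment_comm hc x 3 0, moment_comm hc x 4 0,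
      moment_comm hc x 2 1, moment_comm hc x 3 1, m00, m01, m02, m03, m04, m11, m12, m13, m14,
      m22, m23] at h
    simp only [u, e] at h
    linear_combination h / 2
  have hdeg : (fun k => ∑ l, c k l) = x := by
    -- The moments of type `(0, q)` are the power moments of the row sums at the nodes. Six of them
    -- agree with those of `x`, so the Vandermonde matrix gives that the row sums are `x`: the nodes
    -- really are the vertex weights.
    refine sum_mul_pow_injective hx fun q => ?_
    rw [← moment_zero_left hc]
    fin_cases q
    exacts [m00, m01, m02, m03, m04, m05]
  obtain ⟨a, ha⟩ := exists_form c hc h0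
  have hda : ∀ k, deg k a = x k := fun k => by
    rw [deg_apply]
    simp only [ha]
    exact congrFun hdeg k
  refine ⟨a, hda, funext fun j => ?_⟩
  rcases j with i | r
  · change MvPolynomial.aeval (fun k => deg k a) _ = _
    simp only [hda]
    exact hy i
  · change moment (fun k l => coef k l a) (fun k => deg k a) _ _ = _
    simp only [hda, ha]
    fin_cases r
    exacts [hm 1 1, hm 1 2, hm 1 3, hm 2 2, hm 2 3, hm 2 4, hm 3 3, hm 3 4, hm 4 4]

/-- The discriminant is a multiple of the denominator `K(x_i) K(x_j)` of the interpolation formula.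
-/
lemma diffProd_eq_mul {A : Type} [CommRing A] (x : Fin 6 → A) {i j : Fin 6} (hij : i ≠ j) :
    diffProd x = (nodal x {i, j}).eval (x i) * (nodal x {i, j}).eval (x j) *
      ((x i - x j) * (x j - x i) * ∏ k ∈ (Finset.univ.erase i).erase j,
        ∏ l ∈ Finset.univ.erase k, (x k - x l)) := by
  have h : ∀ {i j : Fin 6}, i ≠ j → ∏ l ∈ Finset.univ.erase i, (x i - x l) =
      (x i - x j) * (nodal x {i, j}).eval (x i) := by
    intro i j hij
    rw [← Finset.mul_prod_erase _ _ (Finset.mem_erase.mpr ⟨hij.symm, Finset.mem_univ j⟩),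
      eval_nodal]
    congr 2
    ext m
    simp
    tauto
  rw [diffProd, ← Finset.mul_prod_erase _ _ (Finset.mem_univ i), h hij,
    ← Finset.mul_prod_erase _ _ (Finset.mem_erase.mpr ⟨hij.symm, Finset.mem_univ j⟩),
    h hij.symm, Finset.pair_comm j i]
  ring

/-- The quadratic forms with normalised total weight and distinct vertex weights. -/
def NormForms : Type := {a : Forms 2 // tot a = 1 ∧ diffProd (fun k => deg k a) ≠ 0}

/-- The polynomials in the vertex weights and in the invariants. -/
def weightRing : Subring (NormForms → ℂ) :=
  (RingHom.pi fun u : NormForms => eval₂At (fun k => deg k u.1) (invCoord u.1)).range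

lemma deg_mem_weightRing (k : Fin 6) : (fun u : NormForms => deg k u.1) ∈ weightRing :=
  ⟨.X k, by
    funext u
    change eval₂At _ _ _ = _
    simp [eval₂At]⟩

lemma const_mem_weightRing (c : ℂ) : (fun _ : NormForms => c) ∈ weightRing :=
  ⟨.C (.C c), by
    funext u
    change eval₂At _ _ _ = _
    simp [eval₂At]⟩

lemma invCoord_mem_weightRing (j : Fin 5 ⊕ Fin 9) :
    (fun u : NormForms => invCoord u.1 j) ∈ weightRing :=
  ⟨.C (.X j), by
    funext u
    change eval₂At _ _ _ = _
    simp [eval₂At]⟩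

/-- Moments with a zero exponent are power sums of the weights, since the row sums of `c` are the
nodes; type `(1,4)` follows from the divided difference relation; all others are among the nine
coordinates, up to order. -/
lemma moment_mem_weightRing {p q : ℕ} (hp : p < 5) (hq : q < 5) :
    moment (fun k l (u : NormForms) => coef k l u.1) (fun k u => deg k u.1) p q ∈ weightRing := by
  have hc : ∀ k l, (fun u : NormForms => coef k l u.1) = fun u => coef l k u.1 := fun k l =>
    funext fun u => coef_comm k l u.1
  have hdiag : ∀ k, (fun u : NormForms => coef k k u.1) = 0 := fun k =>
    funext fun u => coef_self k u.1
  have h0 : ∀ q, moment (fun k l (u : NormForms) => coef k l u.1) (fun k u => deg k u.1) 0 q ∈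
      weightRing := by
    intro q
    rw [moment_zero_left hc]
    refine sum_mem fun k _ => mul_mem ?_ (pow_mem (deg_mem_weightRing k) q)
    convert deg_mem_weightRing k
    rw [deg_apply, Finset.sum_apply]
  have h0' : ∀ q, moment (fun k l (u : NormForms) => coef k l u.1) (fun k u => deg k u.1) q 0 ∈
      weightRing := fun q => moment_comm hc _ 0 q ▸ h0 q
  have hr : ∀ r, moment (fun k l (u : NormForms) => coef k l u.1) (fun k u => deg k u.1)
      (momentType r).1 (momentType r).2 ∈ weightRing := by
    intro r
    convert invCoord_mem_weightRing (.inr r) using 1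
    funext u
    simp [moment, invCoord]
  have hr' : ∀ r, moment (fun k l (u : NormForms) => coef k l u.1) (fun k u => deg k u.1)
      (momentType r).2 (momentType r).1 ∈ weightRing := fun r =>
    moment_comm hc _ (momentType r).1 _ ▸ hr r
  have h14 : moment (fun k l (u : NormForms) => coef k l u.1) (fun k u => deg k u.1) 1 4 ∈
      weightRing := by
    have h := two_mul_moment_one_four hc hdiag
      (x := fun k (u : NormForms) => deg k u.1) fun k l hkl => by
        rw [Pi.isUnit_iff]
        intro u
        exact (sub_ne_zero.mpr (((diffProd_ne_zero_iff _).mp u.2.2).ne hkl)).isUnit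
    have h2 : 2 * moment (fun k l (u : NormForms) => coef k l u.1) (fun k u => deg k u.1) 1 4 ∈
        weightRing := by
      have he := coeff_nodal_mem weightRing deg_mem_weightRing ∅
      rw [h]
      refine neg_mem (add_mem (add_mem (mul_mem (ofNat_mem _ 2) (h0 5))
        (mul_mem (ofNat_mem _ 2) (hr 4))) ?_)
      simp only [Finset.sum_range_succ _ 5, Finset.sum_range_succ _ 4, Finset.sum_range_succ _ 3,
        Finset.sum_range_succ _ 2, Finset.sum_range_succ _ 1, Finset.sum_range_succ _ 0,
        Finset.sum_range_zero]
      norm_num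
      refine add_mem (add_mem (add_mem (add_mem ?_ ?_) ?_) ?_) ?_ <;> refine mul_mem (he _) ?_
      · exact h0 0
      · exact add_mem (h0 1) (h0' 1)
      · exact add_mem (add_mem (h0 2) (hr 0)) (h0' 2)
      · exact add_mem (add_mem (add_mem (h0 3) (hr 1)) (hr' 1)) (h0' 3)
      · exact add_mem (add_mem (add_mem (add_mem (h0 4) (hr 2)) (hr 3)) (hr' 2)) (h0' 4)
    have h3 := mul_mem (const_mem_weightRing (1 / 2)) h2
    convert h3 using 1
    funext u
    simp
  interval_cases p <;> interval_cases q
  exacts [h0 _, h0 _, h0 _, h0 _, h0 _, h0' _, hr 0, hr 1, hr 2, h14, h0' _, hr' 1, hr 3, hr 4,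
    hr 5, h0' _, hr' 2, hr' 4, hr 6, hr 7, h0' _, moment_comm hc _ 1 4 ▸ h14, hr' 5, hr' 7, hr 8]

lemma diffProd_mem_weightRing :
    (fun u : NormForms => diffProd fun k => deg k u.1) ∈ weightRing := by
  have h : diffProd (fun k (u : NormForms) => deg k u.1) ∈ weightRing :=
    prod_mem fun k _ => prod_mem fun l _ => sub_mem (deg_mem_weightRing k) (deg_mem_weightRing l)
  convert h using 1
  funext u
  simp [diffProd]

/-- Interpolation writes `2 c_ij K(x_i) K(x_j)` through moments and symmetric functions of the
remaining weights. The discriminant then clears the denominator. -/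
lemma diffProd_mul_coef_mem (i j : Fin 6) :
    (fun u : NormForms => (diffProd fun k => deg k u.1) * coef i j u.1) ∈ weightRing := by
  rcases eq_or_ne i j with rfl | hij
  · simp only [coef_self, mul_zero]
    exact zero_mem _
  · have hc : ∀ k l, (fun u : NormForms => coef k l u.1) = fun u => coef l k u.1 := fun k l =>
      funext fun u => coef_comm k l u.1
    have hdiag : ∀ k, (fun u : NormForms => coef k k u.1) = 0 := fun k =>
      funext fun u => coef_self k u.1
    let x : Fin 6 → NormForms → ℂ := fun k u => deg k u.1
    have h1 := sum_eval_mul_eval (fun k l (u : NormForms) => coef k l u.1) x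
      (K := nodal x {i, j}) (n := 5)
      (lt_of_le_of_lt (natDegree_nodal_le x {i, j}) (by rw [Finset.card_pair hij]; norm_num))
    rw [sum_eval_mul_eval_of_eval_eq_zero hc hdiag hij
      fun m h1 h2 => eval_nodal_eq_zero x (by simp [h1, h2])] at h1
    have h2 := sum_mem (S := weightRing) fun p (hp : p ∈ Finset.range 5) =>
      sum_mem fun q (hq : q ∈ Finset.range 5) =>
        mul_mem (mul_mem (coeff_nodal_mem weightRing deg_mem_weightRing {i, j} p)
          (coeff_nodal_mem weightRing deg_mem_weightRing {i, j} q))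
          (moment_mem_weightRing (Finset.mem_range.mp hp) (Finset.mem_range.mp hq))
    rw [← h1] at h2
    have h3 : (x i - x j) * (x j - x i) * ∏ k ∈ (Finset.univ.erase i).erase j,
        ∏ l ∈ Finset.univ.erase k, (x k - x l) ∈ weightRing :=
      mul_mem (mul_mem (sub_mem (deg_mem_weightRing i) (deg_mem_weightRing j))
        (sub_mem (deg_mem_weightRing j) (deg_mem_weightRing i)))
        (prod_mem fun k _ => prod_mem fun l _ =>
          sub_mem (deg_mem_weightRing k) (deg_mem_weightRing l))
    have h4 := mul_mem (mul_mem (const_mem_weightRing (1 / 2)) h2) h3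
    convert h4 using 1
    have h5 : (fun u : NormForms => diffProd fun k => deg k u.1) = diffProd x := by
      funext u
      simp [diffProd, x]
    change (fun u : NormForms => diffProd fun k => deg k u.1) * (fun u => coef i j u.1) = _
    rw [h5, diffProd_eq_mul x hij]
    have h6 : (fun _ : NormForms => (1 / 2 : ℂ)) * 2 = 1 := by
      funext u
      simp
    linear_combination (-((nodal x {i, j}).eval (x i) * (nodal x {i, j}).eval (x j) *
      ((x i - x j) * (x j - x i) * ∏ k ∈ (Finset.univ.erase i).erase j,
        ∏ l ∈ Finset.univ.erase k, (x k - x l))) * (fun u : NormForms => coef i j u.1)) * h6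

lemma exists_diffProd_pow_mul_mem {P : Forms 2 → ℂ} (hP : P ∈ polyFun (Forms 2)) :
    ∃ N, (fun u : NormForms => (diffProd fun k => deg k u.1) ^ N * P u.1) ∈ weightRing := by
  have hlift : ∀ {N M : ℕ} {Q : Forms 2 → ℂ}, N ≤ M →
      (fun u : NormForms => (diffProd fun k => deg k u.1) ^ N * Q u.1) ∈ weightRing →
      (fun u : NormForms => (diffProd fun k => deg k u.1) ^ M * Q u.1) ∈ weightRing := by
    intro N M Q hNM h
    obtain ⟨k, rfl⟩ := Nat.exists_eq_add_of_le hNM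
    convert mul_mem (pow_mem diffProd_mem_weightRing k) h using 1
    funext u
    simp only [Pi.mul_apply, Pi.pow_apply]
    ring
  unfold polyFun at hP
  induction hP using Algebra.adjoin_induction with
  | mem P hP =>
    obtain ⟨φ, rfl⟩ := hP
    refine ⟨1, ?_⟩
    have h := sum_mem (S := weightRing) fun k (_ : k ∈ Finset.univ) =>
      sum_mem fun l (_ : l ∈ Finset.univ) => mul_mem
        (const_mem_weightRing (1 / 2 * φ (coordProd k l))) (diffProd_mul_coef_mem k l)
    convert h using 1
    funext u
    simp only [Finset.sum_apply, Pi.mul_apply]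
    rw [dual_eq_sum φ u.1, Finset.mul_sum]
    refine Finset.sum_congr rfl fun k _ => ?_
    rw [Finset.mul_sum]
    refine Finset.sum_congr rfl fun l _ => ?_
    ring
  | algebraMap r => exact ⟨0, by simpa using const_mem_weightRing r⟩
  | add P Q _ _ h1 h2 =>
    obtain ⟨N, h1⟩ := h1
    obtain ⟨M, h2⟩ := h2
    refine ⟨max N M, ?_⟩
    convert add_mem (hlift (le_max_left N M) h1) (hlift (le_max_right N M) h2) using 1
    funext u
    simp only [Pi.add_apply]
    ring
  | mul P Q _ _ h1 h2 =>
    obtain ⟨N, h1⟩ := h1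
    obtain ⟨M, h2⟩ := h2
    refine ⟨N + M, ?_⟩
    convert mul_mem h1 h2 using 1
    funext u
    simp only [Pi.mul_apply]
    ring

/-- Up to powers of the discriminant, all invariants are polynomials in the fourteen invariants. -/
theorem exists_eval_invCoord_eq {P : Forms 2 → ℂ} (hP : P ∈ polyFun (Forms 2))
    (hinv : ∀ (σ : Equiv.Perm (Fin 6)) a, P (permForms 2 σ a) = P a) :
    ∃ (N : ℕ) (q : MvPolynomial (Fin 5 ⊕ Fin 9) ℂ), ∀ a, tot a = 1 →
      diffProd (fun k => deg k a) ≠ 0 →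
      diffProd (fun k => deg k a) ^ N * P a = MvPolynomial.eval (invCoord a) q := by
  obtain ⟨N, Q, hQ⟩ := exists_diffProd_pow_mul_mem hP
  have hQ' : ∀ a, tot a = 1 → diffProd (fun k => deg k a) ≠ 0 →
      eval₂At (fun k => deg k a) (invCoord a) Q = diffProd (fun k => deg k a) ^ N * P a :=
    fun a h1 h2 => congrFun hQ ⟨a, h1, h2⟩
  -- `Q` need not be symmetric in the weights. The sum of its conjugates is, and each conjugate
  -- takes the same value because `P`, the discriminant and the fourteen coordinates are invariant;
  -- dividing by the group order recovers that value.
  obtain ⟨q, hq⟩ := exists_eval_eq_of_isSymmetric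
    (∑ σ : Equiv.Perm (Fin 6), MvPolynomial.rename σ Q) fun τ => by
      rw [map_sum]
      refine Fintype.sum_equiv (Equiv.mulLeft τ) _ _ fun σ => ?_
      rw [MvPolynomial.rename_rename]
      rfl
  have hren : ∀ (σ : Equiv.Perm (Fin 6)) (x : Fin 6 → ℂ) (y : Fin 5 ⊕ Fin 9 → ℂ),
      eval₂At x y (MvPolynomial.rename σ Q) = eval₂At (fun k => x (σ k)) y Q := by
    intro σ x y
    simp only [eval₂At, MvPolynomial.coe_eval₂Hom, MvPolynomial.eval₂_rename]
    rfl
  refine ⟨N, .C (1 / Fintype.card (Equiv.Perm (Fin 6))) * q, fun a h1 h2 => ?_⟩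
  have hcard : (Fintype.card (Equiv.Perm (Fin 6)) : ℂ) ≠ 0 :=
    Nat.cast_ne_zero.mpr Fintype.card_ne_zero
  rw [map_mul, ← hq (fun k => deg k a) (invCoord a) (by rw [← tot_apply, h1]) fun i => rfl,
    map_sum]
  have e : ∀ σ : Equiv.Perm (Fin 6), eval₂At (fun k => deg k a) (invCoord a)
      (MvPolynomial.rename σ Q) = diffProd (fun k => deg k a) ^ N * P a := by
    intro σ
    have h3 := hQ' (permForms 2 σ⁻¹ a) (by rw [tot_perm, h1]) (by rwa [diffProd_deg_perm])
    rw [diffProd_deg_perm, invCoord_perm, hinv] at h3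
    rw [hren, ← h3]
    simp only [deg_perm, inv_inv]
  rw [Finset.sum_congr rfl fun σ _ => e σ, Finset.sum_const, Finset.card_univ, nsmul_eq_mul,
    MvPolynomial.eval_C]
  field_simp

end Igusa

/-! ## Homogeneous functions -/

/-- A function on a complex vector space is homogeneous of degree `d`. -/
def IsHomogFun {V : Type} [AddCommGroup V] [Module ℂ V] (d : ℕ) (P : V → ℂ) : Prop :=
  ∀ (t : ℂ) x, P (t • x) = t ^ d * P x

section IsHomogFun

variable {V : Type} [AddCommGroup V] [Module ℂ V]

lemma isHomogFun_dual (φ : Module.Dual ℂ V) : IsHomogFun 1 fun x => φ x := fun t x => by simp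

lemma IsHomogFun.mul {d e : ℕ} {P Q : V → ℂ} (hP : IsHomogFun d P) (hQ : IsHomogFun e Q) :
    IsHomogFun (d + e) (P * Q) := fun t x => by
  rw [Pi.mul_apply, Pi.mul_apply, hP, hQ]
  ring

lemma IsHomogFun.pow {d : ℕ} {P : V → ℂ} (hP : IsHomogFun d P) (k : ℕ) :
    IsHomogFun (d * k) (P ^ k) := fun t x => by
  rw [Pi.pow_apply, Pi.pow_apply, hP, mul_pow, pow_mul]

lemma IsHomogFun.prod {ι : Type} (s : Finset ι) {d : ι → ℕ} {P : ι → V → ℂ}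
    (hP : ∀ i ∈ s, IsHomogFun (d i) (P i)) : IsHomogFun (∑ i ∈ s, d i) (∏ i ∈ s, P i) :=
  fun t x => by
  rw [Finset.prod_apply, Finset.prod_apply, ← Finset.prod_pow_eq_pow_sum,
    ← Finset.prod_mul_distrib]
  exact Finset.prod_congr rfl fun i hi => hP i hi t x

lemma IsHomogFun.mem_evenFun {n : ℕ} {P : V → ℂ} (hP : IsHomogFun (2 * n) P)
    (h : P ∈ polyFun V) : P ∈ evenFun V :=
  _root_.mem_evenFun h fun x => by
    have := hP (-1) x
    simpa [pow_mul] using this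

end IsHomogFun

namespace Igusa

/-! ### Functions of the square modulo the Igusa quartic -/

/-- The algebra generated by the linear functions of `a²` that are trivial on `b`. -/
def sqFun : Subalgebra ℂ (Forms 2 → ℂ) :=
  Algebra.adjoin ℂ {P | ∃ φ : Module.Dual ℂ (Forms 4), φ b = 0 ∧ P = fun a => φ (sq a)}

lemma mem_sqFun {φ : Module.Dual ℂ (Forms 4)} (h : φ b = 0) : (fun a => φ (sq a)) ∈ sqFun :=
  Algebra.subset_adjoin ⟨φ, h, rfl⟩

lemma comp_perm_mem_sqFun {P : Forms 2 → ℂ} (hP : P ∈ sqFun) (σ : Equiv.Perm (Fin 6)) :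
    (fun a => P (permForms 2 σ a)) ∈ sqFun := by
  unfold sqFun at hP
  induction hP using Algebra.adjoin_induction with
  | mem P hP =>
    obtain ⟨φ, hφ, rfl⟩ := hP
    exact mem_sqFun (φ := φ.comp (permForms 4 σ)) (by rw [LinearMap.comp_apply, perm_b, hφ])
  | algebraMap r => exact sqFun.algebraMap_mem r
  | add P Q _ _ h1 h2 => exact add_mem h1 h2
  | mul P Q _ _ h1 h2 => exact mul_mem h1 h2

/-- Elements of `sqFun` come from polynomial functions on quartic forms modulo `b`. This makes them
readable from any member of a pencil that involves `a²`. -/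
lemma exists_lift_of_mem_sqFun {P : Forms 2 → ℂ} (hP : P ∈ sqFun) :
    ∃ Q ∈ polyFun (Forms 4), (∀ v (m : ℂ), Q (v + m • b) = Q v) ∧ ∀ a, Q (sq a) = P a := by
  unfold sqFun at hP
  induction hP using Algebra.adjoin_induction with
  | mem P hP =>
    obtain ⟨φ, hφ, rfl⟩ := hP
    exact ⟨_, dual_mem_polyFun φ, fun v m => by simp [hφ], fun a => rfl⟩
  | algebraMap r => exact ⟨_, const_mem_polyFun r, fun _ _ => rfl, fun _ => rfl⟩
  | add P Q _ _ h1 h2 =>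
    obtain ⟨P', a1, b1, c1⟩ := h1
    obtain ⟨Q', a2, b2, c2⟩ := h2
    exact ⟨P' + Q', add_mem a1 a2, fun v m => by simp [b1, b2], fun a => by simp [c1, c2]⟩
  | mul P Q _ _ h1 h2 =>
    obtain ⟨P', a1, b1, c1⟩ := h1
    obtain ⟨Q', a2, b2, c2⟩ := h2
    exact ⟨P' * Q', mul_mem a1 a2, fun v m => by simp [b1, b2], fun a => by simp [c1, c2]⟩

/-! ### Coordinates along a singular line of the Igusa quartic -/

/-- The point with coordinates `s, t` on a singular line of the Igusa quartic, moved in the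
transversal direction `(x, y, w)`. -/
def linePt (s t x y w : ℂ) : hyperplane :=
  ⟨![s + x, s - x, t + y, t - y, -s - t + w, -s - t - w], by
    change ∑ i, ![s + x, s - x, t + y, t - y, -s - t + w, -s - t - w] i = 0
    simp only [Fin.sum_univ_six, Matrix.cons_val]
    ring⟩

/-- There are no terms of order below two in `(x, y, w)`, so the line is singular on the Igusa
quartic, and the quadratic terms are diagonal in `x², y², w²`. Both facts are exploited below. -/
lemma b_linePt (s t x y w : ℂ) : b.1 (linePt s t x y w) =
    12 * (s ^ 2 * x ^ 2 + t ^ 2 * y ^ 2 + (s + t) ^ 2 * w ^ 2) -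
      4 * (s ^ 2 + s * t + t ^ 2) * (x ^ 2 + y ^ 2 + w ^ 2) +
      2 * (x ^ 4 + y ^ 4 + w ^ 4) - (x ^ 2 + y ^ 2 + w ^ 2) ^ 2 := by
  change ∑ i, ![s + x, s - x, t + y, t - y, -s - t + w, -s - t - w] i ^ 4 - 1 / 4 *
    (∑ i, ![s + x, s - x, t + y, t - y, -s - t + w, -s - t - w] i ^ 2) ^ 2 = _
  simp only [Fin.sum_univ_six, Matrix.cons_val]
  ring

lemma exists_linePt (z : hyperplane) : ∃ s t x y w, z = linePt s t x y w := by
  refine ⟨(z.1 0 + z.1 1) / 2, (z.1 2 + z.1 3) / 2, (z.1 0 - z.1 1) / 2, (z.1 2 - z.1 3) / 2,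
    (z.1 4 - z.1 5) / 2, Subtype.ext (funext fun i => ?_)⟩
  have hz : ∑ i, z.1 i = 0 := z.2
  rw [Fin.sum_univ_six] at hz
  fin_cases i <;> simp [linePt] <;> first | ring1 | linear_combination (1 / 2) * hz

/-- The polarisation of quadratic forms. -/
def polar (u v : hyperplane) : Module.Dual ℂ (Forms 2) :=
  evalForm 2 (u + v) - evalForm 2 u - evalForm 2 v

/-- The basis of the hyperplane adapted to the singular line. -/
def lineBasis : Fin 5 → hyperplane :=
  ![linePt 1 0 0 0 0, linePt 0 1 0 0 0, linePt 0 0 1 0 0, linePt 0 0 0 1 0, linePt 0 0 0 0 1]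

/-- Coordinates on the space of quadratic forms. -/
def lineCoord (i j : Fin 5) : Module.Dual ℂ (Forms 2) :=
  if i = j then evalForm 2 (lineBasis i) else polar (lineBasis i) (lineBasis j)

lemma form_linePt (a : Forms 2) (s t x y w : ℂ) : a.1 (linePt s t x y w) =
    lineCoord 0 0 a * s ^ 2 + lineCoord 0 1 a * s * t + lineCoord 1 1 a * t ^ 2 +
      x * (lineCoord 0 2 a * s + lineCoord 1 2 a * t) +
      y * (lineCoord 0 3 a * s + lineCoord 1 3 a * t) +
      w * (lineCoord 0 4 a * s + lineCoord 1 4 a * t) +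
      lineCoord 2 2 a * x ^ 2 + lineCoord 3 3 a * y ^ 2 + lineCoord 4 4 a * w ^ 2 +
      lineCoord 2 3 a * x * y + lineCoord 2 4 a * x * w + lineCoord 3 4 a * y * w := by
  induction a using forms_two_induction with
  | h0 => simp
  | hadd a b ha hb =>
    simp only [map_add]
    change a.1 _ + b.1 _ = _
    rw [ha, hb]
    ring
  | hmon c i j =>
    have e : ∀ i, (linePt s t x y w).1 i = s * (lineBasis 0).1 i + t * (lineBasis 1).1 i +
        x * (lineBasis 2).1 i + y * (lineBasis 3).1 i + w * (lineBasis 4).1 i := by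
      intro i
      fin_cases i <;> simp [linePt, lineBasis] <;> ring
    have h1 : ∀ k, lineCoord k k (c • coordProd i j) =
        c * ((lineBasis k).1 i * (lineBasis k).1 j) := by
      intro k
      rw [lineCoord, if_pos rfl, map_smul, evalForm_apply, coordProd_apply, smul_eq_mul]
    have h2 : ∀ k l, k ≠ l → lineCoord k l (c • coordProd i j) =
        c * ((lineBasis k).1 i * (lineBasis l).1 j + (lineBasis l).1 i * (lineBasis k).1 j) := by
      intro k l hkl
      rw [lineCoord, if_neg hkl, map_smul, polar]
      simp only [LinearMap.sub_apply, evalForm_apply, coordProd_apply, smul_eq_mul,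
        Submodule.coe_add, Pi.add_apply]
      ring
    rw [h1, h1, h1, h1, h1, h2 _ _ (by decide), h2 _ _ (by decide), h2 _ _ (by decide),
      h2 _ _ (by decide), h2 _ _ (by decide), h2 _ _ (by decide), h2 _ _ (by decide),
      h2 _ _ (by decide), h2 _ _ (by decide), h2 _ _ (by decide)]
    change c * (coordProd i j).1 _ = _
    rw [coordProd_apply, e, e]
    ring

/-! ### Coefficients of quartic forms -/

section Stencil

variable {M : Type} [AddCommGroup M] [Module ℂ M]

/-- The linear coefficient of a polynomial of degree at most four. -/
def coeffOne (f : ℂ → Module.Dual ℂ M) : Module.Dual ℂ M :=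
  (1 / 12 : ℂ) • ((8 : ℂ) • (f 1 - f (-1)) - (f 2 - f (-2)))

/-- The quadratic coefficient of a polynomial of degree at most four. -/
def coeffTwo (f : ℂ → Module.Dual ℂ M) : Module.Dual ℂ M :=
  (1 / 24 : ℂ) • ((16 : ℂ) • (f 1 + f (-1)) - (f 2 + f (-2)) - (30 : ℂ) • f 0)

/-- The five-point difference formula at `-2, …, 2` is exact in degree four. It presents a
coefficient of a form as a linear functional built from evaluations. -/
lemma coeffOne_apply {f : ℂ → Module.Dual ℂ M} {x : M} (c₀ c₁ c₂ c₃ c₄ : ℂ)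
    (h : ∀ t, f t x = c₀ + c₁ * t + c₂ * t ^ 2 + c₃ * t ^ 3 + c₄ * t ^ 4) :
    coeffOne f x = c₁ := by
  simp only [coeffOne, LinearMap.smul_apply, LinearMap.sub_apply, h, smul_eq_mul]
  ring

lemma coeffTwo_apply {f : ℂ → Module.Dual ℂ M} {x : M} (c₀ c₁ c₂ c₃ c₄ : ℂ)
    (h : ∀ t, f t x = c₀ + c₁ * t + c₂ * t ^ 2 + c₃ * t ^ 3 + c₄ * t ^ 4) :
    coeffTwo f x = c₂ := by
  simp only [coeffTwo, LinearMap.smul_apply, LinearMap.sub_apply, LinearMap.add_apply, h,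
    smul_eq_mul]
  ring

end Stencil

end Igusa

/-! ### Clearing denominators from a subalgebra. -/

/-- The elements of an algebra that lie in the subalgebra `S` up to powers of the denominator
`F ∈ S`. -/
def Subalgebra.denomClosure {A : Type} [CommRing A] [Algebra ℂ A] (S : Subalgebra ℂ A) {F : A}
    (hF : F ∈ S) : Subalgebra ℂ A where
  carrier := {p | ∃ N, F ^ N * p ∈ S}
  algebraMap_mem' r := ⟨0, by simp⟩
  add_mem' := by
    rintro p q ⟨N, hN⟩ ⟨M, hM⟩
    refine ⟨N + M, ?_⟩
    convert add_mem (mul_mem (pow_mem hF M) hN) (mul_mem (pow_mem hF N) hM) using 1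
    ring
  mul_mem' := by
    rintro p q ⟨N, hN⟩ ⟨M, hM⟩
    refine ⟨N + M, ?_⟩
    convert mul_mem hN hM using 1
    ring

section DenomClosure

variable {A : Type} [CommRing A] [Algebra ℂ A] {S : Subalgebra ℂ A} {F : A} (hF : F ∈ S)

lemma Subalgebra.mem_denomClosure {p : A} (hp : p ∈ S) : p ∈ S.denomClosure hF :=
  ⟨0, by simpa using hp⟩

/-- A factor of the denominator may be cancelled as soon as its cofactor lies in the subalgebra; the
factor itself need not be checked. -/
lemma Subalgebra.mem_denomClosure_of_mul_mem {D E p : A} (hDE : D * E = F) (hE : E ∈ S)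
    (h : D * p ∈ S.denomClosure hF) : p ∈ S.denomClosure hF := by
  obtain ⟨N, hN⟩ := h
  refine ⟨N + 1, ?_⟩
  convert mul_mem hE hN using 1
  rw [pow_succ, ← hDE]
  ring

end DenomClosure

namespace Igusa

lemma mem_sqFun_of_eq {P : Forms 2 → ℂ} (φ : Module.Dual ℂ (Forms 4)) (hb : φ b = 0)
    (h : ∀ a, φ (sq a) = P a) : P ∈ sqFun := by
  rw [← show (fun a => φ (sq a)) = P from funext h]
  exact mem_sqFun hb

lemma evalForm_sq (a : Forms 2) (z : hyperplane) : evalForm 4 z (sq a) = a.1 z * a.1 z := rfl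

lemma evalForm_b (z : hyperplane) : evalForm 4 z b = b.1 z := rfl

/-- The coordinates as functions. -/
def lineFun (i j : Fin 5) : Forms 2 → ℂ := fun a => lineCoord i j a

/-- Write `α s² + β s t + γ t²` for the restriction of `a` to the singular line. As `b` vanishes
there, the coefficients `α²`, `2αβ` and `β² + 2αγ` of the square are available. -/
lemma lineFun_sq_mem : lineFun 0 0 ^ 2 ∈ sqFun :=
  mem_sqFun_of_eq (evalForm 4 (linePt 1 0 0 0 0)) (by rw [evalForm_b, b_linePt]; ring) fun a => by
    rw [evalForm_sq, form_linePt]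
    simp only [lineFun, Pi.pow_apply]
    ring

lemma two_lineFun_mul_mem : 2 * (lineFun 0 0 * lineFun 0 1) ∈ sqFun :=
  mem_sqFun_of_eq (coeffOne fun t => evalForm 4 (linePt 1 t 0 0 0))
    (coeffOne_apply 0 0 0 0 0 fun t => by rw [evalForm_b, b_linePt]; ring) fun a =>
    coeffOne_apply (lineCoord 0 0 a ^ 2) _ (lineCoord 0 1 a ^ 2 + 2 * lineCoord 0 0 a *
      lineCoord 1 1 a) (2 * lineCoord 0 1 a * lineCoord 1 1 a) (lineCoord 1 1 a ^ 2) fun t => by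
      rw [evalForm_sq, form_linePt]
      simp only [lineFun, Pi.mul_apply, Pi.ofNat_apply]
      ring

lemma lineFun_sq_add_mem : lineFun 0 1 ^ 2 + 2 * (lineFun 0 0 * lineFun 1 1) ∈ sqFun :=
  mem_sqFun_of_eq (coeffTwo fun t => evalForm 4 (linePt 1 t 0 0 0))
    (coeffTwo_apply 0 0 0 0 0 fun t => by rw [evalForm_b, b_linePt]; ring) fun a =>
    coeffTwo_apply (lineCoord 0 0 a ^ 2) (2 * lineCoord 0 0 a * lineCoord 0 1 a) _
      (2 * lineCoord 0 1 a * lineCoord 1 1 a) (lineCoord 1 1 a ^ 2) fun t => by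
      rw [evalForm_sq, form_linePt]
      simp only [lineFun, Pi.mul_apply, Pi.ofNat_apply, Pi.add_apply, Pi.pow_apply]
      ring

/-- The transversal linear coefficient in the given direction. -/
def normalFun (k : Fin 5) (x y w : ℂ) : Forms 2 → ℂ :=
  x • lineFun k 2 + y • lineFun k 3 + w • lineFun k 4

lemma normalFun_apply (k : Fin 5) (x y w : ℂ) (a : Forms 2) : normalFun k x y w a =
    x * lineCoord k 2 a + y * lineCoord k 3 a + w * lineCoord k 4 a := rfl

/-- The transversal quadratic coefficient in the given direction. -/
def normalQuad (x y w : ℂ) (a : Forms 2) : ℂ :=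
  lineCoord 2 2 a * x ^ 2 + lineCoord 3 3 a * y ^ 2 + lineCoord 4 4 a * w ^ 2 +
      lineCoord 2 3 a * x * y + lineCoord 2 4 a * x * w + lineCoord 3 4 a * y * w

lemma form_linePt_smul (a : Forms 2) (s t r x y w : ℂ) :
    a.1 (linePt s t (r * x) (r * y) (r * w)) =
      (lineCoord 0 0 a * s ^ 2 + lineCoord 0 1 a * s * t + lineCoord 1 1 a * t ^ 2) +
      r * (s * normalFun 0 x y w a + t * normalFun 1 x y w a) + r ^ 2 * normalQuad x y w a := by
  rw [form_linePt, normalFun_apply, normalFun_apply, normalQuad]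
  ring

lemma coeffOne_normal (s t x y w : ℂ) (a : Forms 2) :
    coeffOne (fun r => evalForm 4 (linePt s t (r * x) (r * y) (r * w))) (sq a) =
      2 * (lineCoord 0 0 a * s ^ 2 + lineCoord 0 1 a * s * t + lineCoord 1 1 a * t ^ 2) *
        (s * normalFun 0 x y w a + t * normalFun 1 x y w a) :=
  coeffOne_apply ((lineCoord 0 0 a * s ^ 2 + lineCoord 0 1 a * s * t + lineCoord 1 1 a * t ^ 2) ^ 2)
    _ ((s * normalFun 0 x y w a + t * normalFun 1 x y w a) ^ 2 + 2 * (lineCoord 0 0 a * s ^ 2 +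
      lineCoord 0 1 a * s * t + lineCoord 1 1 a * t ^ 2) * normalQuad x y w a)
    (2 * (s * normalFun 0 x y w a + t * normalFun 1 x y w a) * normalQuad x y w a)
    (normalQuad x y w a ^ 2) fun r => by
    rw [evalForm_sq, form_linePt_smul]
    ring

lemma coeffTwo_normal (s t x y w : ℂ) (a : Forms 2) :
    coeffTwo (fun r => evalForm 4 (linePt s t (r * x) (r * y) (r * w))) (sq a) =
      (s * normalFun 0 x y w a + t * normalFun 1 x y w a) ^ 2 + 2 * (lineCoord 0 0 a * s ^ 2 +
      lineCoord 0 1 a * s * t + lineCoord 1 1 a * t ^ 2) * normalQuad x y w a :=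
  coeffTwo_apply ((lineCoord 0 0 a * s ^ 2 + lineCoord 0 1 a * s * t + lineCoord 1 1 a * t ^ 2) ^ 2)
    (2 * (lineCoord 0 0 a * s ^ 2 + lineCoord 0 1 a * s * t + lineCoord 1 1 a * t ^ 2) *
        (s * normalFun 0 x y w a + t * normalFun 1 x y w a)) _
    (2 * (s * normalFun 0 x y w a + t * normalFun 1 x y w a) * normalQuad x y w a)
    (normalQuad x y w a ^ 2) fun r => by
    rw [evalForm_sq, form_linePt_smul]
    ring

/-- Singularity of the line: the first-order coefficients of `a²` transversal to it are functionals
that kill `b`. -/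
lemma coeffOne_normal_b (s t x y w : ℂ) :
    coeffOne (fun r => evalForm 4 (linePt s t (r * x) (r * y) (r * w))) b = 0 :=
  coeffOne_apply 0 _ (12 * (s ^ 2 * x ^ 2 + t ^ 2 * y ^ 2 + (s + t) ^ 2 * w ^ 2) -
      4 * (s ^ 2 + s * t + t ^ 2) * (x ^ 2 + y ^ 2 + w ^ 2)) 0
    (2 * (x ^ 4 + y ^ 4 + w ^ 4) - (x ^ 2 + y ^ 2 + w ^ 2) ^ 2) fun r => by
    rw [evalForm_b, b_linePt]
    ring

lemma coeffTwo_normal_b (s t x y w : ℂ) :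
    coeffTwo (fun r => evalForm 4 (linePt s t (r * x) (r * y) (r * w))) b =
      12 * (s ^ 2 * x ^ 2 + t ^ 2 * y ^ 2 + (s + t) ^ 2 * w ^ 2) -
      4 * (s ^ 2 + s * t + t ^ 2) * (x ^ 2 + y ^ 2 + w ^ 2) :=
  coeffTwo_apply 0 0 _ 0
    (2 * (x ^ 4 + y ^ 4 + w ^ 4) - (x ^ 2 + y ^ 2 + w ^ 2) ^ 2) fun r => by
    rw [evalForm_b, b_linePt]
    ring

lemma lineFun_mul_normalFun_mem (x y w : ℂ) : 2 * (lineFun 0 0 * normalFun 0 x y w) ∈ sqFun :=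
  mem_sqFun_of_eq _ (coeffOne_normal_b 1 0 x y w) fun a => by
    rw [coeffOne_normal]
    simp only [lineFun, Pi.mul_apply, Pi.ofNat_apply]
    ring

lemma lineFun_mul_normalFun_add_mem (x y w : ℂ) :
    2 * (lineFun 0 1 * normalFun 0 x y w + lineFun 0 0 * normalFun 1 x y w) ∈ sqFun :=
  mem_sqFun_of_eq (coeffOne fun t => coeffOne fun r =>
      evalForm 4 (linePt 1 t (r * x) (r * y) (r * w)))
    (coeffOne_apply 0 0 0 0 0 fun t => by rw [coeffOne_normal_b]; ring) fun a =>
    coeffOne_apply (2 * (lineCoord 0 0 a * normalFun 0 x y w a)) _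
      (2 * (lineCoord 1 1 a * normalFun 0 x y w a + lineCoord 0 1 a * normalFun 1 x y w a))
      (2 * (lineCoord 1 1 a * normalFun 1 x y w a)) 0 fun t => by
      rw [coeffOne_normal]
      simp only [lineFun, Pi.mul_apply, Pi.add_apply, Pi.ofNat_apply]
      ring

section Slope

variable (x y w : ℂ) (a : Forms 2)

/-- The coefficient of `s² d²` of a quartic form, where `d` is the transversal direction. -/
def sSq : Module.Dual ℂ (Forms 4) :=
  coeffTwo fun r => evalForm 4 (linePt 1 0 (r * x) (r * y) (r * w))

/-- The coefficient of `t² d²` of a quartic form, where `d` is the transversal direction. -/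
def tSq : Module.Dual ℂ (Forms 4) :=
  coeffTwo fun r => evalForm 4 (linePt 0 1 (r * x) (r * y) (r * w))

/-- The coefficient of `s t d²` of a quartic form, where `d` is the transversal direction. -/
def sMulT : Module.Dual ℂ (Forms 4) :=
  coeffOne fun t => coeffTwo fun r => evalForm 4 (linePt 1 t (r * x) (r * y) (r * w))

lemma sSq_sq : sSq x y w (sq a) =
    normalFun 0 x y w a ^ 2 + 2 * lineCoord 0 0 a * normalQuad x y w a := by
  rw [sSq, coeffTwo_normal]
  ring

lemma tSq_sq : tSq x y w (sq a) =
    normalFun 1 x y w a ^ 2 + 2 * lineCoord 1 1 a * normalQuad x y w a := by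
  rw [tSq, coeffTwo_normal]
  ring

lemma sMulT_sq : sMulT x y w (sq a) =
    2 * normalFun 0 x y w a * normalFun 1 x y w a + 2 * lineCoord 0 1 a * normalQuad x y w a :=
  coeffOne_apply (normalFun 0 x y w a ^ 2 + 2 * lineCoord 0 0 a * normalQuad x y w a) _
    (normalFun 1 x y w a ^ 2 + 2 * lineCoord 1 1 a * normalQuad x y w a) 0 0 fun t => by
    rw [coeffTwo_normal]
    ring

lemma sSq_b : sSq x y w b = 8 * x ^ 2 - 4 * y ^ 2 + 8 * w ^ 2 := by
  rw [sSq, coeffTwo_normal_b]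
  ring

lemma tSq_b : tSq x y w b = -4 * x ^ 2 + 8 * y ^ 2 + 8 * w ^ 2 := by
  rw [tSq, coeffTwo_normal_b]
  ring

lemma sMulT_b : sMulT x y w b = -4 * x ^ 2 - 4 * y ^ 2 + 20 * w ^ 2 :=
  coeffOne_apply (8 * x ^ 2 - 4 * y ^ 2 + 8 * w ^ 2) _
    (-4 * x ^ 2 + 8 * y ^ 2 + 8 * w ^ 2) 0 0 fun t => by
    rw [coeffTwo_normal_b]
    ring

end Slope

/-- The transversal coefficients on which the Igusa quartic puts no condition. -/
lemma normalQuad_sub_mem (x y w x' y' w' : ℂ)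
    (h : 8 * x ^ 2 - 4 * y ^ 2 + 8 * w ^ 2 = 8 * x' ^ 2 - 4 * y' ^ 2 + 8 * w' ^ 2) :
    normalFun 0 x y w ^ 2 + 2 * (lineFun 0 0 * normalQuad x y w) -
      (normalFun 0 x' y' w' ^ 2 + 2 * (lineFun 0 0 * normalQuad x' y' w')) ∈ sqFun :=
  mem_sqFun_of_eq (sSq x y w - sSq x' y' w')
    (by rw [LinearMap.sub_apply, sSq_b, sSq_b, h, sub_self]) fun a => by
    rw [LinearMap.sub_apply, sSq_sq, sSq_sq]
    simp only [lineFun, Pi.mul_apply, Pi.add_apply, Pi.sub_apply, Pi.pow_apply, Pi.ofNat_apply]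
    ring

/-- The coefficients of `b` at `(s², s t, t²)` are `(8, -4, -4)` for `x²`, `(-4, -4, 8)` for `y²`
and `(8, 20, 8)` for `w²`. In each triple two entries agree, and the difference of the corresponding
functionals kills `b`; this and the next two lemmas use these coincidences. -/
lemma sMulT_sub_tSq_mem :
    2 * (normalFun 0 1 0 0 * normalFun 1 1 0 0) - normalFun 1 1 0 0 ^ 2 +
      2 * ((lineFun 0 1 - lineFun 1 1) * lineFun 2 2) ∈ sqFun :=
  mem_sqFun_of_eq (sMulT 1 0 0 - tSq 1 0 0)
    (by rw [LinearMap.sub_apply, sMulT_b, tSq_b]; ring) fun a => by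
    rw [LinearMap.sub_apply, sMulT_sq, tSq_sq]
    simp only [lineFun, Pi.mul_apply, Pi.add_apply, Pi.sub_apply, Pi.pow_apply, Pi.ofNat_apply,
      normalQuad]
    ring

lemma sMulT_sub_sSq_mem :
    2 * (normalFun 0 0 1 0 * normalFun 1 0 1 0) - normalFun 0 0 1 0 ^ 2 +
      2 * ((lineFun 0 1 - lineFun 0 0) * lineFun 3 3) ∈ sqFun :=
  mem_sqFun_of_eq (sMulT 0 1 0 - sSq 0 1 0)
    (by rw [LinearMap.sub_apply, sMulT_b, sSq_b]; ring) fun a => by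
    rw [LinearMap.sub_apply, sMulT_sq, sSq_sq]
    simp only [lineFun, Pi.mul_apply, Pi.add_apply, Pi.sub_apply, Pi.pow_apply, Pi.ofNat_apply,
      normalQuad]
    ring

lemma sSq_sub_tSq_mem :
    normalFun 0 0 0 1 ^ 2 - normalFun 1 0 0 1 ^ 2 +
      2 * ((lineFun 0 0 - lineFun 1 1) * lineFun 4 4) ∈ sqFun :=
  mem_sqFun_of_eq (sSq 0 0 1 - tSq 0 0 1)
    (by rw [LinearMap.sub_apply, sSq_b, tSq_b]; ring) fun a => by
    rw [LinearMap.sub_apply, sSq_sq, tSq_sq]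
    simp only [lineFun, Pi.mul_apply, Pi.add_apply, Pi.sub_apply, Pi.pow_apply, Pi.ofNat_apply,
      normalQuad]
    ring

/-! ### The denominator attached to a singular line -/

/-- The first factor of `lineDenom`, up to `lineFun 0 0 ^ 2`. -/
lemma lineFun_mul_mem : lineFun 0 0 * lineFun 0 1 ∈ sqFun := by
  have h := sqFun.smul_mem two_lineFun_mul_mem (1 / 2)
  convert h using 1
  funext a
  simp

/-- From `α² (β² + 2αγ) - (αβ)² = 2α³γ`. -/
lemma lineFun_cube_mul_mem : lineFun 0 0 ^ 3 * lineFun 1 1 ∈ sqFun := by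
  have h := sqFun.smul_mem (sub_mem (mul_mem lineFun_sq_mem lineFun_sq_add_mem)
    (mul_mem lineFun_mul_mem lineFun_mul_mem)) (1 / 2)
  convert h using 1
  funext a
  simp
  ring

/-- The product of the factors of `lineDenom` other than the square of `lineFun 0 0`. -/
def lineCofactor : Fin 3 → Forms 2 → ℂ :=
  ![lineFun 0 0 ^ 3 * (lineFun 0 1 - lineFun 1 1), lineFun 0 0 * (lineFun 0 1 - lineFun 0 0),
    lineFun 0 0 ^ 3 * (lineFun 0 0 - lineFun 1 1)]

lemma lineCofactor_mem (i : Fin 3) : lineCofactor i ∈ sqFun := by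
  have h1 := lineFun_sq_mem
  have h2 := lineFun_mul_mem
  have h3 := lineFun_cube_mul_mem
  fin_cases i
  · convert sub_mem (mul_mem h1 h2) h3 using 1
    simp [lineCofactor]
    ring
  · convert sub_mem h2 h1 using 1
    simp [lineCofactor]
    ring
  · convert sub_mem (mul_mem h1 h1) h3 using 1
    simp [lineCofactor]
    ring

/-- The denominator attached to the singular line. -/
def lineDenom : Forms 2 → ℂ := lineFun 0 0 ^ 2 * ∏ i, lineCofactor i

lemma lineDenom_mem : lineDenom ∈ sqFun :=
  mul_mem lineFun_sq_mem (prod_mem fun i _ => lineCofactor_mem i)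

/-- The functions that lie in `sqFun` up to powers of `lineDenom`. -/
def lineClosure : Subalgebra ℂ (Forms 2 → ℂ) := sqFun.denomClosure lineDenom_mem

lemma mem_lineClosure_of_sq_mul {p : Forms 2 → ℂ} (h : lineFun 0 0 ^ 2 * p ∈ lineClosure) :
    p ∈ lineClosure :=
  Subalgebra.mem_denomClosure_of_mul_mem _ rfl (prod_mem fun i _ => lineCofactor_mem i) h

lemma mem_lineClosure_of_cofactor_mul (i : Fin 3) {p : Forms 2 → ℂ}
    (h : lineCofactor i * p ∈ lineClosure) : p ∈ lineClosure := by
  refine Subalgebra.mem_denomClosure_of_mul_mem _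
    (E := lineFun 0 0 ^ 2 * ∏ j ∈ Finset.univ.erase i, lineCofactor j) ?_
    (mul_mem lineFun_sq_mem (prod_mem fun i _ => lineCofactor_mem i)) h
  rw [lineDenom, ← Finset.mul_prod_erase _ _ (Finset.mem_univ i)]
  ring

lemma mem_lineClosure_of_two_mul {p : Forms 2 → ℂ} (h : 2 * p ∈ lineClosure) :
    p ∈ lineClosure := by
  convert lineClosure.smul_mem h (1 / 2) using 1
  funext a
  simp

lemma sqFun_le_lineClosure {p : Forms 2 → ℂ} (h : p ∈ sqFun) : p ∈ lineClosure :=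
  Subalgebra.mem_denomClosure _ h

lemma lineFun_mul_normalFun_zero_mem (x y w : ℂ) :
    lineFun 0 0 * normalFun 0 x y w ∈ lineClosure :=
  mem_lineClosure_of_two_mul (sqFun_le_lineClosure (lineFun_mul_normalFun_mem x y w))

/-- With `n₀, n₁` the transversal linear coefficients at `s` and `t`: `α² (β n₀ + α n₁) - (αβ)(α n₀)
= α² (α n₁)`, and `α²` can be cancelled. -/
lemma lineFun_mul_normalFun_one_mem (x y w : ℂ) :
    lineFun 0 0 * normalFun 1 x y w ∈ lineClosure := by
  refine mem_lineClosure_of_sq_mul ?_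
  convert sub_mem (mul_mem (sqFun_le_lineClosure lineFun_sq_mem) (mem_lineClosure_of_two_mul
    (sqFun_le_lineClosure (lineFun_mul_normalFun_add_mem x y w))))
    (mul_mem (sqFun_le_lineClosure lineFun_mul_mem) (lineFun_mul_normalFun_zero_mem x y w)) using 1
  ring

/-- Products of two linear functions are reached although the linear functions themselves are not:
each is known after multiplication by `α`, and only `α²` has to be cancelled. -/
lemma mul_mem_lineClosure {p q : Forms 2 → ℂ} (hp : lineFun 0 0 * p ∈ lineClosure)
    (hq : lineFun 0 0 * q ∈ lineClosure) : p * q ∈ lineClosure := by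
  refine mem_lineClosure_of_sq_mul ?_
  convert mul_mem hp hq using 1
  ring

lemma lineFun_mul_normalQuad_sub_mem (x y w x' y' w' : ℂ)
    (h : 8 * x ^ 2 - 4 * y ^ 2 + 8 * w ^ 2 = 8 * x' ^ 2 - 4 * y' ^ 2 + 8 * w' ^ 2) :
    lineFun 0 0 * (normalQuad x y w - normalQuad x' y' w') ∈ lineClosure := by
  refine mem_lineClosure_of_two_mul ?_
  have h0 := fun x y w => mul_mem_lineClosure (lineFun_mul_normalFun_zero_mem x y w)
    (lineFun_mul_normalFun_zero_mem x y w)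
  convert sub_mem (sqFun_le_lineClosure (normalQuad_sub_mem x y w x' y' w' h))
    (sub_mem (h0 x y w) (h0 x' y' w')) using 1
  ring

/-- Coordinates along the line and of first order are already known. The diagonal second-order ones
come from the three coincidences of `b`, after cancelling `β - γ`, `β - α` or `α - γ`. The mixed
ones come from two directions differing by a sign, between which `b` does not distinguish. -/
lemma lineFun_mul_lineFun_mem {i j : Fin 5} (hij : i ≤ j) :
    lineFun 0 0 * lineFun i j ∈ lineClosure := by
  have n0 := lineFun_mul_normalFun_zero_mem
  have n1 := lineFun_mul_normalFun_one_mem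
  have hsq : lineFun 0 0 ^ 2 ∈ lineClosure := sqFun_le_lineClosure lineFun_sq_mem
  have e2 : ∀ k, normalFun k 1 0 0 = lineFun k 2 := fun k => by simp [normalFun]
  have e3 : ∀ k, normalFun k 0 1 0 = lineFun k 3 := fun k => by simp [normalFun]
  have e4 : ∀ k, normalFun k 0 0 1 = lineFun k 4 := fun k => by simp [normalFun]
  have h2 : (2 : Forms 2 → ℂ) ∈ lineClosure := ofNat_mem lineClosure 2
  have p00 := fun x y w => mul_mem_lineClosure (n0 x y w) (n0 x y w)
  have p01 := fun x y w => mul_mem h2 (mul_mem_lineClosure (n0 x y w) (n1 x y w))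
  have p11 := fun x y w => mul_mem_lineClosure (n1 x y w) (n1 x y w)
  have h22 : lineFun 0 0 * lineFun 2 2 ∈ lineClosure := by
    have g : 2 * ((lineFun 0 1 - lineFun 1 1) * lineFun 2 2) ∈ lineClosure := by
      convert sub_mem (sqFun_le_lineClosure sMulT_sub_tSq_mem)
        (sub_mem (p01 1 0 0) (p11 1 0 0)) using 1
      ring
    refine mem_lineClosure_of_cofactor_mul 0 ?_
    convert mul_mem (mul_mem hsq hsq) (mem_lineClosure_of_two_mul g) using 1
    simp only [lineCofactor, Matrix.cons_val]
    ring
  have h33 : lineFun 0 0 * lineFun 3 3 ∈ lineClosure := by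
    have g : 2 * ((lineFun 0 1 - lineFun 0 0) * lineFun 3 3) ∈ lineClosure := by
      convert sub_mem (sqFun_le_lineClosure sMulT_sub_sSq_mem)
        (sub_mem (p01 0 1 0) (p00 0 1 0)) using 1
      ring
    refine mem_lineClosure_of_cofactor_mul 1 ?_
    convert mul_mem hsq (mem_lineClosure_of_two_mul g) using 1
    simp only [lineCofactor, Matrix.cons_val]
    ring
  have h44 : lineFun 0 0 * lineFun 4 4 ∈ lineClosure := by
    have g : 2 * ((lineFun 0 0 - lineFun 1 1) * lineFun 4 4) ∈ lineClosure := by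
      convert sub_mem (sqFun_le_lineClosure sSq_sub_tSq_mem)
        (sub_mem (p00 0 0 1) (p11 0 0 1)) using 1
      ring
    refine mem_lineClosure_of_cofactor_mul 2 ?_
    convert mul_mem (mul_mem hsq hsq) (mem_lineClosure_of_two_mul g) using 1
    simp only [lineCofactor, Matrix.cons_val]
    ring
  have h23 : lineFun 0 0 * lineFun 2 3 ∈ lineClosure := by
    refine mem_lineClosure_of_two_mul ?_
    convert lineFun_mul_normalQuad_sub_mem 1 1 0 1 (-1) 0 (by ring) using 1
    funext a
    simp only [normalQuad, lineFun, Pi.mul_apply, Pi.sub_apply, Pi.ofNat_apply]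
    ring
  have h24 : lineFun 0 0 * lineFun 2 4 ∈ lineClosure := by
    refine mem_lineClosure_of_two_mul ?_
    convert lineFun_mul_normalQuad_sub_mem 1 0 1 1 0 (-1) (by ring) using 1
    funext a
    simp only [normalQuad, lineFun, Pi.mul_apply, Pi.sub_apply, Pi.ofNat_apply]
    ring
  have h34 : lineFun 0 0 * lineFun 3 4 ∈ lineClosure := by
    refine mem_lineClosure_of_two_mul ?_
    convert lineFun_mul_normalQuad_sub_mem 0 1 1 0 1 (-1) (by ring) using 1
    funext a
    simp only [normalQuad, lineFun, Pi.mul_apply, Pi.sub_apply, Pi.ofNat_apply]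
    ring
  have h00 : lineFun 0 0 * lineFun 0 0 ∈ lineClosure := by rwa [← pow_two]
  have h01 : lineFun 0 0 * lineFun 0 1 ∈ lineClosure := sqFun_le_lineClosure lineFun_mul_mem
  have h11 : lineFun 0 0 * lineFun 1 1 ∈ lineClosure := by
    refine mem_lineClosure_of_sq_mul ?_
    convert sqFun_le_lineClosure lineFun_cube_mul_mem using 1
    ring
  have n02 := e2 0 ▸ n0 1 0 0
  have n03 := e3 0 ▸ n0 0 1 0
  have n04 := e4 0 ▸ n0 0 0 1
  have n12 := e2 1 ▸ n1 1 0 0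
  have n13 := e3 1 ▸ n1 0 1 0
  have n14 := e4 1 ▸ n1 0 0 1
  fin_cases i <;> fin_cases j <;> first | exact absurd hij (by decide) | assumption

lemma lineFun_mul_dual_mem (φ : Module.Dual ℂ (Forms 2)) :
    lineFun 0 0 * (fun a => φ a) ∈ lineClosure := by
  have hev : ∀ z, lineFun 0 0 * (fun a => evalForm 2 z a) ∈ lineClosure := by
    intro z
    obtain ⟨s, t, x, y, w, rfl⟩ := exists_linePt z
    have h : ∀ (c : ℂ) (i j : Fin 5), i ≤ j → c • (lineFun 0 0 * lineFun i j) ∈ lineClosure :=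
      fun c i j hij => lineClosure.smul_mem (lineFun_mul_lineFun_mem hij) c
    convert add_mem (add_mem (add_mem (add_mem (add_mem (add_mem (add_mem (add_mem (add_mem
      (add_mem (add_mem (add_mem (add_mem (add_mem
      (h (s ^ 2) 0 0 (by decide)) (h (s * t) 0 1 (by decide))) (h (t ^ 2) 1 1 (by decide)))
      (h (x * s) 0 2 (by decide))) (h (x * t) 1 2 (by decide))) (h (y * s) 0 3 (by decide)))
      (h (y * t) 1 3 (by decide))) (h (w * s) 0 4 (by decide))) (h (w * t) 1 4 (by decide)))
      (h (x ^ 2) 2 2 (by decide))) (h (y ^ 2) 3 3 (by decide))) (h (w ^ 2) 4 4 (by decide)))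
      (h (x * y) 2 3 (by decide))) (h (x * w) 2 4 (by decide))) (h (y * w) 3 4 (by decide)) using 1
    funext a
    simp only [Pi.mul_apply, evalForm_apply, form_linePt, Pi.add_apply, Pi.smul_apply,
      smul_eq_mul, lineFun]
    ring
  have h := sum_mem (S := lineClosure) fun k (_ : k ∈ Finset.univ) =>
    sum_mem fun l (_ : l ∈ Finset.univ) =>
      lineClosure.smul_mem (hev (diffVec k l)) (-(1 / 2 * φ (coordProd k l)))
  convert h using 1
  funext a
  simp only [Pi.mul_apply, Finset.sum_apply, Pi.smul_apply, smul_eq_mul]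
  rw [dual_eq_sum φ a, Finset.mul_sum]
  refine Finset.sum_congr rfl fun k _ => ?_
  rw [Finset.mul_sum]
  refine Finset.sum_congr rfl fun l _ => ?_
  rw [coef_apply, evalForm_apply]
  ring

/-- This says that `a` can be recovered up to sign from `a²` modulo `b`, with only `lineDenom` in
the denominators. -/
lemma evenFun_le_lineClosure {P : Forms 2 → ℂ} (hP : P ∈ evenFun (Forms 2)) :
    P ∈ lineClosure := by
  refine Algebra.adjoin_le ?_ hP
  rintro _ ⟨φ, rfl⟩
  exact mul_mem_lineClosure (lineFun_mul_dual_mem φ.1) (lineFun_mul_dual_mem φ.2)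

lemma lineFun_mem_polyFun (i j : Fin 5) : lineFun i j ∈ polyFun (Forms 2) :=
  dual_mem_polyFun (lineCoord i j)

lemma isHomogFun_lineFun (i j : Fin 5) : IsHomogFun 1 (lineFun i j) :=
  isHomogFun_dual (lineCoord i j)

lemma lineDenom_eq : lineDenom = lineFun 0 0 ^ 2 * (lineFun 0 0 ^ 3 *
    (lineFun 0 1 - lineFun 1 1) * (lineFun 0 0 * (lineFun 0 1 - lineFun 0 0)) *
    (lineFun 0 0 ^ 3 * (lineFun 0 0 - lineFun 1 1))) := by
  rw [lineDenom, Fin.prod_univ_three]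
  rfl

lemma lineDenom_mem_polyFun : lineDenom ∈ polyFun (Forms 2) := by
  have h := lineFun_mem_polyFun
  rw [lineDenom_eq]
  exact mul_mem (pow_mem (h _ _) _) (mul_mem (mul_mem (mul_mem (pow_mem (h _ _) _)
    (sub_mem (h _ _) (h _ _))) (mul_mem (h _ _) (sub_mem (h _ _) (h _ _))))
    (mul_mem (pow_mem (h _ _) _) (sub_mem (h _ _) (h _ _))))

lemma isHomogFun_lineDenom : IsHomogFun 12 lineDenom := fun t a => by
  simp only [lineDenom_eq, Pi.mul_apply, Pi.pow_apply, Pi.sub_apply,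
    isHomogFun_lineFun _ _ t a]
  ring

lemma lineDenom_ne_zero : lineDenom ≠ 0 := by
  intro h
  -- A form with `(α, β, γ) = (1, 3, 2)`: nonzero `α` and distinct values, so no factor vanishes.
  have h1 := congrFun h (coordProd 0 0 + (3 : ℂ) • coordProd 0 2 + (2 : ℂ) • coordProd 2 2)
  have h2 : ∀ i j (a : Forms 2), lineFun i j a = lineCoord i j a := fun _ _ _ => rfl
  have h3 : ∀ k i j, lineCoord k k (coordProd i j) = (lineBasis k).1 i * (lineBasis k).1 j := by
    intro k i j
    rw [lineCoord, if_pos rfl, evalForm_apply, coordProd_apply]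
  have h4 : ∀ i j, lineCoord 0 1 (coordProd i j) =
      (lineBasis 0).1 i * (lineBasis 1).1 j + (lineBasis 1).1 i * (lineBasis 0).1 j := by
    intro i j
    rw [lineCoord, if_neg (by decide), polar]
    simp only [LinearMap.sub_apply, evalForm_apply, coordProd_apply, Submodule.coe_add,
      Pi.add_apply]
    ring
  simp only [lineDenom_eq, Pi.mul_apply, Pi.pow_apply, Pi.sub_apply, h2, map_add, map_smul,
    h3, h4, lineBasis, linePt, Matrix.cons_val] at h1
  norm_num at h1

end Igusa

namespace Igusa

/-! ### An invariant denominator -/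

/-- Invariance under the symmetric group of a function on the space of quadratic forms. -/
def IsInvFun (P : Forms 2 → ℂ) : Prop :=
  ∀ (σ : Equiv.Perm (Fin 6)) a, P (permForms 2 σ a) = P a

lemma IsInvFun.mul {P Q : Forms 2 → ℂ} (hP : IsInvFun P) (hQ : IsInvFun Q) : IsInvFun (P * Q) :=
  fun σ a => by rw [Pi.mul_apply, Pi.mul_apply, hP, hQ]

lemma IsInvFun.pow {P : Forms 2 → ℂ} (hP : IsInvFun P) (k : ℕ) : IsInvFun (P ^ k) :=
  fun σ a => by rw [Pi.pow_apply, Pi.pow_apply, hP]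

/-- The product of all conjugates of a function. -/
def normFun (P : Forms 2 → ℂ) : Forms 2 → ℂ :=
  ∏ σ : Equiv.Perm (Fin 6), fun a => P (permForms 2 σ a)

lemma isInvFun_normFun (P : Forms 2 → ℂ) : IsInvFun (normFun P) := by
  intro τ a
  rw [normFun, Finset.prod_apply, Finset.prod_apply]
  refine Fintype.prod_equiv (Equiv.mulRight τ) _ _ fun σ => ?_
  rw [Equiv.coe_mulRight, map_mul]
  rfl

lemma normFun_eq_mul (P : Forms 2 → ℂ) : normFun P =
    P * ∏ σ ∈ Finset.univ.erase (1 : Equiv.Perm (Fin 6)), fun a => P (permForms 2 σ a) := by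
  rw [normFun, ← Finset.mul_prod_erase _ _ (Finset.mem_univ 1)]
  congr 1

lemma _root_.IsHomogFun.comp_perm {d : ℕ} {P : Forms 2 → ℂ} (hP : IsHomogFun d P)
    (σ : Equiv.Perm (Fin 6)) : IsHomogFun d fun a => P (permForms 2 σ a) := fun t a => by
  simp only [map_smul]
  exact hP t _

lemma comp_perm_ne_zero {P : Forms 2 → ℂ} (hP : P ≠ 0) (σ : Equiv.Perm (Fin 6)) :
    (fun a => P (permForms 2 σ a)) ≠ 0 := by
  intro h
  apply hP
  funext a
  have h1 := congrFun h (permForms 2 σ⁻¹ a)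
  simp only [Representation.self_inv_apply] at h1
  exact h1

lemma normFun_mem_polyFun {P : Forms 2 → ℂ} (hP : P ∈ polyFun (Forms 2)) :
    normFun P ∈ polyFun (Forms 2) :=
  prod_mem fun σ _ => comp_linear_mem_polyFun (permForms 2 σ) hP

lemma normFun_ne_zero {P : Forms 2 → ℂ} (hP : P ∈ polyFun (Forms 2)) (h0 : P ≠ 0) :
    normFun P ≠ 0 :=
  polyFun_prod_ne_zero _ (fun σ _ => comp_linear_mem_polyFun (permForms 2 σ) hP)
    fun σ _ => comp_perm_ne_zero h0 σ

lemma normFun_lineDenom_mem : normFun lineDenom ∈ sqFun :=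
  prod_mem fun σ _ => comp_perm_mem_sqFun lineDenom_mem σ

/-- The norm is `lineDenom` times its other conjugates, and these lie in `sqFun` because `b` is
invariant. -/
lemma exists_normFun_pow_mul_mem {P : Forms 2 → ℂ} (hP : P ∈ evenFun (Forms 2)) :
    ∃ N, normFun lineDenom ^ N * P ∈ sqFun := by
  obtain ⟨N, hN⟩ := evenFun_le_lineClosure hP
  refine ⟨N, ?_⟩
  rw [normFun_eq_mul, mul_pow, mul_right_comm]
  exact mul_mem hN (pow_mem (prod_mem fun σ _ => comp_perm_mem_sqFun lineDenom_mem σ) N)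

/-- The total weight as a function. -/
def totFun : Forms 2 → ℂ := fun a => tot a

/-- The discriminant of the vertex weights as a function. -/
def discFun : Forms 2 → ℂ := fun a => diffProd fun k => deg k a

lemma isInvFun_totFun : IsInvFun totFun := tot_perm

lemma isInvFun_discFun : IsInvFun discFun := diffProd_deg_perm

lemma isHomogFun_discFun : IsHomogFun 30 discFun := fun t a => by
  have h : ∀ k l, deg k (t • a) - deg l (t • a) = t * (deg k a - deg l a) := fun k l => by
    simp [mul_sub]
  simp only [discFun, diffProd, h, Finset.prod_mul_distrib, Finset.prod_const]
  congr 1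
  simp [← pow_mul]

lemma lineFun_ne_zero : lineFun 0 0 ≠ 0 := fun h => lineDenom_ne_zero (by rw [lineDenom, h]; simp)

lemma exists_form_weights (x : Fin 6 → ℂ) (hx : Function.Injective x) :
    ∃ a : Forms 2, ∀ k, deg k a = x k := by
  obtain ⟨a, ha, -⟩ := exists_invCoord_eq (x := x) (y := Sum.elim (fun i =>
    MvPolynomial.aeval x (MvPolynomial.esymm (Fin 6) ℂ (i + 2))) 0) hx fun i => rfl
  exact ⟨a, ha⟩

lemma exists_totFun_ne_zero : ∃ a, totFun a ≠ 0 ∧ discFun a ≠ 0 := by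
  obtain ⟨a, ha⟩ := exists_form_weights (fun k => (k : ℂ)) (by
    intro k l h
    simpa [Fin.ext_iff] using h)
  refine ⟨a, ?_, ?_⟩
  · simp only [totFun, tot_apply, ha, Fin.sum_univ_six]
    norm_num
  · rw [discFun, diffProd_ne_zero_iff]
    intro k l h
    simp only [ha] at h
    simpa [Fin.ext_iff] using h

/-- An invariant denominator `F`: up to its powers, all even functions lie in `sqFun`. It is
divisible by the discriminant of the vertex weights, by the value at a point of a singular line of
the Igusa quartic, and by the square of the total weight. -/
structure Denominator where
  /-- Half of the degree. -/
  n : ℕ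
  /-- The denominator. -/
  F : Forms 2 → ℂ
  /-- The quotient by the discriminant. -/
  F₁ : Forms 2 → ℂ
  /-- The quotient by the value at a point of a singular line. -/
  F₂ : Forms 2 → ℂ
  /-- The quotient by the square of the total weight. -/
  F₃ : Forms 2 → ℂ
  n_pos : 0 < n
  mem_sqFun : F ∈ sqFun
  mem_polyFun : F ∈ polyFun (Forms 2)
  ne_zero : F ≠ 0
  homog : IsHomogFun (2 * n) F
  inv : IsInvFun F
  exists_pow_mul_mem : ∀ P ∈ evenFun (Forms 2), ∃ N, F ^ N * P ∈ sqFun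
  F₁_mem : F₁ ∈ polyFun (Forms 2)
  F₁_inv : IsInvFun F₁
  eq_disc_mul : F = discFun * F₁
  F₂_mem : F₂ ∈ polyFun (Forms 2)
  F₂_homog : IsHomogFun (2 * n - 1) F₂
  eq_line_mul : F = lineFun 0 0 * F₂
  F₃_mem : F₃ ∈ polyFun (Forms 2)
  F₃_homog : IsHomogFun (2 * n - 2) F₃
  F₃_inv : IsInvFun F₃
  eq_tot_mul : F = totFun ^ 2 * F₃

/-- With `G` the norm of `lineDenom`, take `F = G^(N+1) Q`, where `Q` contains the prescribed
factors and `N` is chosen so that `G^N Q` lies in `sqFun`. The additional factor `G` does not affect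
this, and a high power of `F` clears every denominator that a power of `G^N Q` and `G` clear. -/
theorem nonempty_denominator : Nonempty Denominator := by
  let G := normFun lineDenom
  let α' := normFun (lineFun 0 0)
  let α'' := ∏ σ ∈ Finset.univ.erase (1 : Equiv.Perm (Fin 6)),
    fun a => lineFun 0 0 (permForms 2 σ a)
  have hα : α' = lineFun 0 0 * α'' := normFun_eq_mul _
  have hGp : G ∈ polyFun (Forms 2) := normFun_mem_polyFun lineDenom_mem_polyFun
  have hαp : α' ∈ polyFun (Forms 2) := normFun_mem_polyFun (lineFun_mem_polyFun 0 0)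
  have hα2 : α'' ∈ polyFun (Forms 2) :=
    prod_mem fun σ _ => comp_linear_mem_polyFun (permForms 2 σ) (lineFun_mem_polyFun 0 0)
  have htp : totFun ∈ polyFun (Forms 2) := dual_mem_polyFun tot
  have hdp : discFun ∈ polyFun (Forms 2) := diffProd_deg_mem_polyFun
  have hGi : IsInvFun G := isInvFun_normFun _
  have hαi : IsInvFun α' := isInvFun_normFun _
  have hcard : (Finset.univ : Finset (Equiv.Perm (Fin 6))).card = 720 := by
    rw [Finset.card_univ, Fintype.card_perm]
    rfl
  have hGh : IsHomogFun 8640 G := by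
    have := IsHomogFun.prod Finset.univ fun σ (_ : σ ∈ Finset.univ) =>
      isHomogFun_lineDenom.comp_perm σ
    rwa [Finset.sum_const, hcard] at this
  have hα2h : IsHomogFun 719 α'' := by
    have := IsHomogFun.prod (Finset.univ.erase 1) fun σ (_ : σ ∈ Finset.univ.erase 1) =>
      (isHomogFun_lineFun 0 0).comp_perm σ
    rwa [Finset.sum_const, Finset.card_erase_of_mem (Finset.mem_univ _), hcard] at this
  have hαh : IsHomogFun 720 α' := by
    rw [hα]
    exact (isHomogFun_lineFun 0 0).mul hα2h
  have hth : IsHomogFun 1 totFun := isHomogFun_dual tot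
  -- The square makes the degree `2 (1 + 30 + 720)` even, as is needed for membership in `evenFun`.
  let Q := (totFun * discFun * α') ^ 2
  have hQp : Q ∈ polyFun (Forms 2) := pow_mem (mul_mem (mul_mem htp hdp) hαp) 2
  have hQh : IsHomogFun (2 * 751) Q := ((hth.mul isHomogFun_discFun).mul hαh).pow 2
  obtain ⟨N, hN⟩ := exists_normFun_pow_mul_mem (hQh.mem_evenFun hQp)
  have hGN := hGh.pow (N + 1)
  refine ⟨⟨4320 * (N + 1) + 751, G ^ (N + 1) * Q,
    G ^ (N + 1) * (totFun ^ 2 * discFun * α' ^ 2),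
    G ^ (N + 1) * ((totFun * discFun) ^ 2 * (α' * α'')),
    G ^ (N + 1) * (discFun * α') ^ 2, by omega, ?_, mul_mem (pow_mem hGp _) hQp, ?_, ?_, ?_, ?_,
    ?_, ?_, ?_, ?_, ?_, ?_, ?_, ?_, ?_, ?_⟩⟩
  · rw [pow_succ', mul_assoc]
    exact mul_mem normFun_lineDenom_mem hN
  · have h : totFun * discFun ≠ 0 := by
      obtain ⟨a, h1, h2⟩ := exists_totFun_ne_zero
      intro h
      exact mul_ne_zero h1 h2 (congrFun h a)
    have h1 : ∀ {P : Forms 2 → ℂ} (k : ℕ), P ∈ polyFun (Forms 2) → P ≠ 0 → P ^ k ≠ 0 := by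
      intro P k hP h0
      rw [← Finset.card_range k, ← Finset.prod_const]
      exact polyFun_prod_ne_zero _ (fun _ _ => hP) fun _ _ => h0
    exact polyFun_mul_ne_zero (pow_mem hGp _) hQp
      (h1 _ hGp (normFun_ne_zero lineDenom_mem_polyFun lineDenom_ne_zero))
      (h1 _ (mul_mem (mul_mem htp hdp) hαp) (polyFun_mul_ne_zero (mul_mem htp hdp) hαp h
        (normFun_ne_zero (lineFun_mem_polyFun 0 0) lineFun_ne_zero)))
  · convert hGN.mul hQh using 1
    omega
  · exact (hGi.pow _).mul (((isInvFun_totFun.mul isInvFun_discFun).mul hαi).pow 2)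
  · intro P hP
    obtain ⟨K, hK⟩ := exists_normFun_pow_mul_mem hP
    refine ⟨K, ?_⟩
    convert mul_mem (pow_mem hN K) hK using 1
    ring
  · exact mul_mem (pow_mem hGp _) (mul_mem (mul_mem (pow_mem htp 2) hdp) (pow_mem hαp 2))
  · exact (hGi.pow _).mul (((isInvFun_totFun.pow 2).mul isInvFun_discFun).mul (hαi.pow 2))
  · ring
  · exact mul_mem (pow_mem hGp _) (mul_mem (pow_mem (mul_mem htp hdp) 2) (mul_mem hαp hα2))
  · convert hGN.mul (((hth.mul isHomogFun_discFun).pow 2).mul (hαh.mul hα2h)) using 1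
    omega
  · simp only [Q, hα]
    ring
  · exact mul_mem (pow_mem hGp _) (pow_mem (mul_mem hdp hαp) 2)
  · convert hGN.mul ((isHomogFun_discFun.mul hαh).pow 2) using 1
    omega
  · exact (hGi.pow _).mul ((isInvFun_discFun.mul hαi).pow 2)
  · ring

end Igusa

namespace Igusa

namespace Denominator

variable (𝒟 : Denominator)

/-! ### The ring of invariants with denominators -/

/-- The quadratic forms with normalised total weight at which the denominator does not vanish. -/
structure NormSet where
  /-- The quadratic form. -/
  form : Forms 2
  tot_eq : tot form = 1
  F_ne : 𝒟.F form ≠ 0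

/-- The functions `P / F ^ k` with `P` an invariant. -/
def invRing : Subalgebra ℂ (𝒟.NormSet → ℂ) where
  carrier := {f | ∃ (k : ℕ) (P : Forms 2 → ℂ), P ∈ polyFun (Forms 2) ∧ IsInvFun P ∧
    ∀ u, f u * 𝒟.F u.1 ^ k = P u.1}
  algebraMap_mem' r := ⟨0, fun _ => r, const_mem_polyFun r, fun _ _ => rfl, fun u => by simp⟩
  add_mem' := by
    rintro f g ⟨k, P, hP, hPi, hf⟩ ⟨l, Q, hQ, hQi, hg⟩
    refine ⟨k + l, P * 𝒟.F ^ l + Q * 𝒟.F ^ k, add_mem (mul_mem hP (pow_mem 𝒟.mem_polyFun l))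
      (mul_mem hQ (pow_mem 𝒟.mem_polyFun k)), fun σ a => ?_, fun u => ?_⟩
    · rw [Pi.add_apply, Pi.add_apply, hPi.mul (𝒟.inv.pow l) σ a, hQi.mul (𝒟.inv.pow k) σ a]
    · simp only [Pi.add_apply, Pi.mul_apply, Pi.pow_apply, ← hf, ← hg]
      ring
  mul_mem' := by
    rintro f g ⟨k, P, hP, hPi, hf⟩ ⟨l, Q, hQ, hQi, hg⟩
    refine ⟨k + l, P * Q, mul_mem hP hQ, hPi.mul hQi, fun u => ?_⟩
    simp only [Pi.mul_apply, ← hf, ← hg]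
    ring

variable {𝒟}

lemma F_eq_F₃ (u : 𝒟.NormSet) : 𝒟.F u.1 = 𝒟.F₃ u.1 := by
  have h := congrFun 𝒟.eq_tot_mul u.1
  rwa [Pi.mul_apply, Pi.pow_apply, totFun, u.2, one_pow, one_mul] at h

lemma tot_ne_zero {a : Forms 2} (ha : 𝒟.F a ≠ 0) : tot a ≠ 0 := by
  intro h
  apply ha
  rw [𝒟.eq_tot_mul, Pi.mul_apply, Pi.pow_apply, totFun, h]
  simp

lemma discFun_ne_zero {a : Forms 2} (ha : 𝒟.F a ≠ 0) : discFun a ≠ 0 := by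
  intro h
  apply ha
  rw [𝒟.eq_disc_mul, Pi.mul_apply, h, zero_mul]

lemma exists_eq_smul {a : Forms 2} (ha : 𝒟.F a ≠ 0) : ∃ u : 𝒟.NormSet, a = tot a • u.1 := by
  have ht := tot_ne_zero ha
  refine ⟨⟨(tot a)⁻¹ • a, ?_, ?_⟩, (smul_inv_smul₀ ht a).symm⟩
  · rw [map_smul, smul_eq_mul, inv_mul_cancel₀ ht]
  · rw [𝒟.homog]
    exact mul_ne_zero (pow_ne_zero _ (inv_ne_zero ht)) ha

instance : Nonempty 𝒟.NormSet := by
  obtain ⟨a, ha⟩ := Function.ne_iff.mp 𝒟.ne_zero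
  exact ⟨(exists_eq_smul ha).choose⟩

variable (𝒟) in
/-- The fourteen invariants generate the ring of invariants with denominators up to localisation. -/
def invHom : MvPolynomial (Fin 5 ⊕ Fin 9) ℂ →ₐ[ℂ] 𝒟.invRing :=
  MvPolynomial.aeval fun j => ⟨fun u => invCoord u.1 j, 0, fun a => invCoord a j,
    invCoord_mem_polyFun j, fun σ a => congrFun (invCoord_perm σ a) j, fun u => by simp⟩

lemma invHom_apply (q : MvPolynomial (Fin 5 ⊕ Fin 9) ℂ) (u : 𝒟.NormSet) :
    (𝒟.invHom q).1 u = MvPolynomial.eval (invCoord u.1) q := by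
  induction q using MvPolynomial.induction_on with
  | C c =>
    rw [MvPolynomial.eval_C, ← MvPolynomial.algebraMap_eq, AlgHom.commutes]
    rfl
  | add p q hp hq =>
    rw [map_add, map_add, ← hp, ← hq]
    rfl
  | mul_X p j h =>
    rw [map_mul, map_mul, ← h, MvPolynomial.eval_X]
    change (𝒟.invHom p).1 u * (𝒟.invHom (MvPolynomial.X j)).1 u = _
    rw [invHom, MvPolynomial.aeval_X]

/-- The ring of invariants with denominators is a localisation of a polynomial ring. -/
theorem exists_isLocalization : ∃ g : MvPolynomial (Fin 5 ⊕ Fin 9) ℂ, g ≠ 0 ∧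
    @IsLocalization.Away _ _ g 𝒟.invRing _ 𝒟.invHom.toRingHom.toAlgebra := by
  obtain ⟨D, hD⟩ := exists_eval_eq_diffProd
  obtain ⟨N, q, hq⟩ := exists_eval_invCoord_eq 𝒟.mem_polyFun 𝒟.inv
  have hD' : ∀ u : 𝒟.NormSet, discFun u.1 = MvPolynomial.eval (invCoord u.1) D := fun u =>
    hD _ _ (by rw [← tot_apply, u.2]) fun i => rfl
  have hq' : ∀ u : 𝒟.NormSet, discFun u.1 ^ N * 𝒟.F u.1 = MvPolynomial.eval (invCoord u.1) q :=
    fun u => hq _ u.2 (discFun_ne_zero u.3)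
  have hg0 : D * q ≠ 0 := by
    intro h
    have u : 𝒟.NormSet := Classical.arbitrary _
    have h1 := congrArg (MvPolynomial.eval (invCoord u.1)) h
    rw [map_mul, ← hD', ← hq', map_zero] at h1
    have hd := discFun_ne_zero u.3
    exact mul_ne_zero hd (mul_ne_zero (pow_ne_zero N hd) u.3) h1
  have hinj : Function.Injective 𝒟.invHom := by
    rw [injective_iff_map_eq_zero]
    intro p hp
    -- At every `y` where `D` and `q` do not vanish there is a normalised form with coordinates `y`
    -- in the domain, so `p` vanishes at `y`.
    have h : p * (D * q) = 0 := by
      refine MvPolynomial.funext fun y => ?_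
      rw [map_zero, map_mul, map_mul]
      by_contra hne
      have hDy : MvPolynomial.eval y D ≠ 0 := fun h => hne (by rw [h]; ring)
      have hqy : MvPolynomial.eval y q ≠ 0 := fun h => hne (by rw [h]; ring)
      obtain ⟨x, hx⟩ := exists_aeval_esymm_eq (Fin.cons 1 fun i => y (.inl i))
      have hx1 : ∑ k, x k = 1 := by
        have := hx 0
        simpa [MvPolynomial.esymm_one] using this
      have hx2 : ∀ i : Fin 5, MvPolynomial.aeval x (MvPolynomial.esymm (Fin 6) ℂ (i + 2)) =
          y (.inl i) := fun i => by simpa using hx i.succ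
      rw [← hD x y hx1 hx2] at hDy
      obtain ⟨a, ha, hay⟩ := exists_invCoord_eq ((diffProd_ne_zero_iff x).mp hDy) hx2
      have hta : tot a = 1 := by
        rw [tot_apply]
        simpa only [ha] using hx1
      have hFa : 𝒟.F a ≠ 0 := by
        intro h
        have h1 := hq a hta (by simpa only [ha] using hDy)
        rw [h, mul_zero, hay] at h1
        exact hqy h1.symm
      have h1 := invHom_apply p (⟨a, hta, hFa⟩ : 𝒟.NormSet)
      rw [hp, hay] at h1
      exact hne (by rw [← h1]; exact zero_mul _)
    exact (mul_eq_zero.mp h).resolve_right hg0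
  refine ⟨D * q, hg0, ?_⟩
  let := 𝒟.invHom.toRingHom.toAlgebra
  have halg : ∀ p, algebraMap (MvPolynomial (Fin 5 ⊕ Fin 9) ℂ) 𝒟.invRing p = 𝒟.invHom p :=
    fun _ => rfl
  have hFinv : ∀ u : 𝒟.NormSet, 𝒟.F u.1 * (𝒟.F u.1)⁻¹ = 1 := fun u => mul_inv_cancel₀ u.3
  -- As `F` is the discriminant times `F₁`, this is the inverse of the discriminant, and `f₂` is the
  -- inverse of `F`.
  let f₁ : 𝒟.invRing := ⟨fun u => 𝒟.F₁ u.1 * (𝒟.F u.1)⁻¹, 1, 𝒟.F₁, 𝒟.F₁_mem, 𝒟.F₁_inv,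
    fun u => by rw [pow_one, mul_assoc, mul_comm _ (𝒟.F u.1), hFinv, mul_one]⟩
  let f₂ : 𝒟.invRing := ⟨fun u => (𝒟.F u.1)⁻¹, 1, fun _ => 1, const_mem_polyFun 1, fun _ _ => rfl,
    fun u => by rw [pow_one, mul_comm, hFinv]⟩
  have hval : ∀ u : 𝒟.NormSet, (𝒟.invHom (D * q)).1 u = discFun u.1 * (discFun u.1 ^ N * 𝒟.F u.1) :=
    fun u => by rw [invHom_apply, map_mul, ← hD', ← hq']
  have hunit : IsUnit (algebraMap (MvPolynomial (Fin 5 ⊕ Fin 9) ℂ) 𝒟.invRing (D * q)) := by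
    refine IsUnit.of_mul_eq_one (f₁ * (f₁ ^ N * f₂)) (Subtype.ext (funext fun u => ?_))
    change (𝒟.invHom (D * q)).1 u * (𝒟.F₁ u.1 * (𝒟.F u.1)⁻¹ *
      ((𝒟.F₁ u.1 * (𝒟.F u.1)⁻¹) ^ N * (𝒟.F u.1)⁻¹)) = 1
    have h1 : discFun u.1 * (𝒟.F₁ u.1 * (𝒟.F u.1)⁻¹) = 1 := by
      rw [← mul_assoc, ← hFinv u]
      congr 1
      exact (congrFun 𝒟.eq_disc_mul u.1).symm
    rw [hval]
    calc _ = (discFun u.1 * (𝒟.F₁ u.1 * (𝒟.F u.1)⁻¹)) ^ (N + 1) * (𝒟.F u.1 * (𝒟.F u.1)⁻¹) := by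
          ring
      _ = 1 := by rw [h1, hFinv]; ring
  refine (isLocalization_iff _ _).mpr ⟨?_, ?_, ?_⟩
  · rintro ⟨_, k, rfl⟩
    rw [map_pow]
    exact hunit.pow k
  · rintro ⟨f, k, P, hP, hPi, hf⟩
    obtain ⟨M, p, hp⟩ := exists_eval_invCoord_eq hP hPi
    -- On normalised forms `q` is `disc^N F`. Hence `q^k` clears `F^k` and contributes `disc^(N k)`,
    -- while `D^M` clears the denominator of `P`.
    refine ⟨(p * (D ^ (k + N * k) * q ^ M), ⟨_, M + k, rfl⟩), Subtype.ext (funext fun u => ?_)⟩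
    change f u * (𝒟.invHom ((D * q) ^ (M + k))).1 u =
      (𝒟.invHom (p * (D ^ (k + N * k) * q ^ M))).1 u
    rw [invHom_apply, invHom_apply]
    simp only [map_mul, map_pow]
    rw [← hp u.1 u.2 (discFun_ne_zero u.3), ← hf, ← hq', ← hD']
    change _ = discFun u.1 ^ M * (f u * 𝒟.F u.1 ^ k) * _
    ring
  · intro p p' h
    exact ⟨1, by rw [hinj h]⟩

end Denominator

end Igusa

/-! ### Homogeneous invariants, and fractions of them on normalised forms. -/

lemma InvariantCone.exists_mem_invariantPart {G E : Type} [Group G] [AddCommGroup E] [Module ℂ E]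
    {ρ : Representation ℂ G E} (C : InvariantCone ρ) {d : ℕ} {H : E → ℂ} (hH : H ∈ polyFun E)
    (hinv : ∀ g, ∀ x ∈ C.carrier, H (ρ g x) = H x)
    (hhom : ∀ (c : ℂ), ∀ x ∈ C.carrier, H (c • x) = c ^ d * H x) :
    ∃ K ∈ C.invariantPart d, ∀ x : C.carrier, K.1 x = H x := by
  have hmem : (fun x : C.carrier => H x) ∈ C.coordRing := by
    clear hinv hhom
    unfold polyFun at hH
    induction hH using Algebra.adjoin_induction with
    | mem P hP =>
      obtain ⟨φ, rfl⟩ := hP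
      exact Algebra.subset_adjoin ⟨φ, rfl⟩
    | algebraMap r => exact C.coordRing.algebraMap_mem r
    | add P Q _ _ h1 h2 => exact add_mem h1 h2
    | mul P Q _ _ h1 h2 => exact mul_mem h1 h2
  exact ⟨⟨_, hmem, fun g x => hinv g x x.2⟩, fun c x => hhom c x x.2, fun _ => rfl⟩

namespace Igusa

namespace Denominator

variable {𝒟 : Denominator}

instance : IsDomain 𝒟.invRing := by
  obtain ⟨g, hg, h⟩ := exists_isLocalization (𝒟 := 𝒟)
  let := 𝒟.invHom.toRingHom.toAlgebra
  exact IsLocalization.Away.isDomain 𝒟.invRing hg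

variable (𝒟) in
/-- The spectrum of the ring of invariants with denominators is an open subscheme of an affine
space. -/
lemma exists_isOpenImmersion : ∃ φ : MvPolynomial (Fin 14) ℂ →ₐ[ℂ] 𝒟.invRing,
    IsOpenImmersion (Spec.map (CommRingCat.ofHom φ.toRingHom)) ∧ Function.Injective φ := by
  obtain ⟨g, hg, h⟩ := exists_isLocalization (𝒟 := 𝒟)
  have hinj : Function.Injective 𝒟.invHom := by
    let := 𝒟.invHom.toRingHom.toAlgebra
    exact IsLocalization.injective 𝒟.invRing (powers_le_nonZeroDivisors_of_noZeroDivisors hg)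
  have hopen : IsOpenImmersion (Spec.map (CommRingCat.ofHom 𝒟.invHom.toRingHom)) := by
    let := 𝒟.invHom.toRingHom.toAlgebra
    exact IsOpenImmersion.of_isLocalization g
  let e := MvPolynomial.renameEquiv ℂ (finSumFinEquiv (m := 5) (n := 9)).symm
  refine ⟨𝒟.invHom.comp e.toAlgHom, ?_, hinj.comp e.injective⟩
  have : Spec.map (CommRingCat.ofHom (𝒟.invHom.comp e.toAlgHom).toRingHom) =
      Spec.map (CommRingCat.ofHom 𝒟.invHom.toRingHom) ≫
        Spec.map e.toRingEquiv.toCommRingCatIso.hom := by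
    rw [← Spec.map_comp]
    rfl
  rw [this]
  infer_instance

/-- The elements of the ring of invariants with denominators are fractions of elements
of `sqFun`. -/
lemma exists_sqFun_fraction (f : 𝒟.invRing) : ∃ (K : ℕ) (p : Forms 2 → ℂ), p ∈ sqFun ∧
    IsHomogFun (2 * (K * 𝒟.n)) p ∧ IsInvFun p ∧ ∀ u, f.1 u * 𝒟.F u.1 ^ K = p u.1 := by
  obtain ⟨f, k, P, hP, hPi, hf⟩ := f
  obtain ⟨j, hj⟩ := exists_homogenization tot hP
  obtain ⟨Q, hQ, hQh, hQe⟩ := hj (2 * (𝒟.n * k + j)) (by omega)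
  -- The homogenisation is a priori invariant only on the slice, hence by scaling where `tot ≠ 0`,
  -- hence everywhere, polynomial functions having no zero divisors.
  have hQi : IsInvFun Q := by
    intro σ a
    have hz := polyFun_eq_zero_or (dual_mem_polyFun tot)
      (sub_mem (comp_linear_mem_polyFun (permForms 2 σ) hQ) hQ) fun a => by
        by_cases ha : tot a = 0
        · rw [ha, zero_mul]
        · have h1 : tot ((tot a)⁻¹ • a) = 1 := by
            rw [map_smul, smul_eq_mul, inv_mul_cancel₀ ha]
          have h2 := hQe _ h1
          have h3 := hQe (permForms 2 σ ((tot a)⁻¹ • a)) (by rw [tot_perm, h1])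
          rw [hPi, ← h2, map_smul, hQh, hQh] at h3
          have h4 := mul_left_cancel₀ (pow_ne_zero _ (inv_ne_zero ha)) h3
          change tot a * (Q (permForms 2 σ a) - Q a) = 0
          rw [h4, sub_self, mul_zero]
    rcases hz with h | h
    · obtain ⟨a, ha⟩ := Function.ne_iff.mp 𝒟.ne_zero
      exact absurd (congrFun h a) (tot_ne_zero ha)
    · exact sub_eq_zero.mp (congrFun h a)
  have hn := 𝒟.n_pos
  -- The degree must be a multiple of that of `F`. Each `F₃` adds `2n - 2`, supplementing the
  -- surplus `2j` of `Q`, and on the slice `F₃` equals `F`.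
  have hdeg : IsHomogFun (2 * (𝒟.n * (k + j))) (Q * 𝒟.F₃ ^ j) := by
    have h := IsHomogFun.mul (P := Q) hQh (𝒟.F₃_homog.pow j)
    convert h using 1
    obtain ⟨m, hm⟩ := Nat.exists_eq_add_of_le hn
    rw [hm, show 2 * (0 + 1 + m) - 2 = 2 * m by omega]
    ring
  obtain ⟨N, hN⟩ := 𝒟.exists_pow_mul_mem _
    (hdeg.mem_evenFun (mul_mem hQ (pow_mem 𝒟.F₃_mem j)))
  refine ⟨N + k + j, 𝒟.F ^ N * (Q * 𝒟.F₃ ^ j), hN, ?_,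
    (𝒟.inv.pow N).mul (hQi.mul (𝒟.F₃_inv.pow j)), fun u => ?_⟩
  · convert (𝒟.homog.pow N).mul hdeg using 1
    ring
  · simp only [Pi.mul_apply, Pi.pow_apply]
    rw [hQe _ u.2, ← hf, ← F_eq_F₃]
    ring

/-- A quotient of an invariant by a power of the denominator. -/
def frac (k : ℕ) (P : Forms 2 → ℂ) (hP : P ∈ polyFun (Forms 2)) (hi : IsInvFun P) : 𝒟.invRing :=
  ⟨fun u => P u.1 / 𝒟.F u.1 ^ k, k, P, hP, hi, fun u => div_mul_cancel₀ _ (pow_ne_zero k u.3)⟩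

lemma frac_apply (k : ℕ) (P : Forms 2 → ℂ) (hP : P ∈ polyFun (Forms 2)) (hi : IsInvFun P)
    (u : 𝒟.NormSet) : (𝒟.frac k P hP hi).1 u * 𝒟.F u.1 ^ k = P u.1 :=
  div_mul_cancel₀ _ (pow_ne_zero k u.3)

/-- Evaluation at a normalised quadratic form. -/
def evalAt (u : 𝒟.NormSet) : 𝒟.invRing →+* ℂ :=
  (Pi.evalRingHom (fun _ : 𝒟.NormSet => ℂ) u).comp (𝒟.invRing.val : 𝒟.invRing →+* _)

/-- Functions on the product of the normalised quadratic forms with the line. -/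
def polyEval : Polynomial 𝒟.invRing →ₐ[ℂ] (𝒟.NormSet × ℂ → ℂ) where
  toRingHom := RingHom.pi fun i => Polynomial.eval₂RingHom (evalAt i.1) i.2
  commutes' r := by
    funext i
    change Polynomial.eval₂ (evalAt i.1) i.2 (Polynomial.C (algebraMap ℂ 𝒟.invRing r)) = r
    rw [Polynomial.eval₂_C]
    rfl

lemma polyEval_apply (p : Polynomial 𝒟.invRing) (u : 𝒟.NormSet) (c : ℂ) :
    polyEval p (u, c) = p.eval₂ (evalAt u) c := rfl

lemma polyEval_injective : Function.Injective (polyEval (𝒟 := 𝒟)) := by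
  rw [injective_iff_map_eq_zero]
  intro p hp
  ext n u
  have h : p.map (evalAt u) = 0 := by
    apply Polynomial.funext
    intro c
    rw [Polynomial.eval_map, ← polyEval_apply, hp]
    simp
  have h1 := congrArg (fun q => Polynomial.coeff q n) h
  rw [Polynomial.coeff_map] at h1
  exact h1

/-- Invariant polynomial functions of a quadratic form and a number are polynomials over the ring of
invariants with denominators. -/
lemma exists_polyEval_eq {P : Forms 2 × ℂ → ℂ} (hP : P ∈ polyFun (Forms 2 × ℂ))
    (hi : ∀ σ a c, P (permForms 2 σ a, c) = P (a, c)) (k : ℕ) :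
    ∃ s : Polynomial 𝒟.invRing, ∀ i, polyEval s i * 𝒟.F i.1.1 ^ k = P (i.1.1, i.2) := by
  obtain ⟨p, hp⟩ := exists_polynomial_prod hP
  have hpi : ∀ n, IsInvFun (p.coeff n).1 := by
    intro n σ a
    have h : p.map ((Pi.evalRingHom (fun _ : Forms 2 => ℂ) (permForms 2 σ a)).comp
        (polyFun (Forms 2)).val.toRingHom) = p.map ((Pi.evalRingHom (fun _ : Forms 2 => ℂ) a).comp
        (polyFun (Forms 2)).val.toRingHom) := by
      apply Polynomial.funext
      intro c
      rw [Polynomial.eval_map, Polynomial.eval_map, ← hp, ← hp, hi]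
    have h1 := congrArg (fun q => Polynomial.coeff q n) h
    simp only [Polynomial.coeff_map] at h1
    exact h1
  refine ⟨∑ n ∈ Finset.range (p.natDegree + 1),
    Polynomial.C (𝒟.frac k _ (p.coeff n).2 (hpi n)) * Polynomial.X ^ n, fun ⟨u, c⟩ => ?_⟩
  rw [polyEval_apply, hp, Polynomial.eval₂_finsetSum, Polynomial.eval₂_eq_sum_range,
    Finset.sum_mul]
  refine Finset.sum_congr rfl fun n _ => ?_
  rw [Polynomial.eval₂_mul, Polynomial.eval₂_C, Polynomial.eval₂_X_pow, mul_right_comm]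
  congr 1
  exact frac_apply k _ (p.coeff n).2 (hpi n) u

end Denominator

/-! ### Squares -/

lemma sq_smul (t : ℂ) (a : Forms 2) : sq (t • a) = t ^ 2 • sq a := by
  apply Subtype.ext
  funext z
  change t * a.1 z * (t * a.1 z) = t ^ 2 * (a.1 z * a.1 z)
  ring

lemma exists_smul_sq_eq (l : ℂ) (a : Forms 2) : ∃ r : ℂ, r ^ 2 = l ∧ l • sq a = sq (r • a) := by
  obtain ⟨r, hr⟩ := IsAlgClosed.exists_pow_nat_eq l (n := 2) (by norm_num)
  exact ⟨r, hr, by rw [sq_smul, hr]⟩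

/-- The product of two quadratic forms. -/
def prodForm : Forms 2 →ₗ[ℂ] Forms 2 →ₗ[ℂ] Forms 4 :=
  LinearMap.mk₂ ℂ (fun a c => ⟨a.1 * c.1, by
    obtain ⟨p, hp, hpa⟩ := a.2
    obtain ⟨q, hq, hqc⟩ := c.2
    refine ⟨p * q, MvPolynomial.IsHomogeneous.mul hp hq, ?_⟩
    rw [← hpa, ← hqc]
    funext z
    simp [restrict]⟩)
    (fun _ _ _ => Subtype.ext (add_mul _ _ _)) (fun _ _ _ => Subtype.ext (smul_mul_assoc _ _ _))
    (fun _ _ _ => Subtype.ext (mul_add _ _ _)) (fun _ _ _ => Subtype.ext (mul_smul_comm _ _ _))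

lemma prodForm_self (a : Forms 2) : prodForm a a = sq a := rfl

lemma sq_eq_sum (a : Forms 2) : sq a = ∑ i : (Fin 6 × Fin 6) × (Fin 6 × Fin 6),
    (1 / 2 * coef i.1.1 i.1.2 a * (1 / 2 * coef i.2.1 i.2.2 a)) •
      prodForm (coordProd i.1.1 i.1.2) (coordProd i.2.1 i.2.2) := by
  have h : a = ∑ i : Fin 6 × Fin 6, (1 / 2 * coef i.1 i.2 a) • coordProd i.1 i.2 := by
    rw [Fintype.sum_prod_type]
    exact form_eq_sum a
  conv_lhs => rw [← prodForm_self, h]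
  simp only [map_sum, LinearMap.sum_apply, map_smul, LinearMap.smul_apply, smul_smul,
    Finset.smul_sum]
  rw [Fintype.sum_prod_type (f := fun i : (Fin 6 × Fin 6) × (Fin 6 × Fin 6) =>
    (1 / 2 * coef i.1.1 i.1.2 a * (1 / 2 * coef i.2.1 i.2.2 a)) •
      prodForm (coordProd i.1.1 i.1.2) (coordProd i.2.1 i.2.2)), Finset.sum_comm]
  refine Finset.sum_congr rfl fun i _ => Finset.sum_congr rfl fun j _ => ?_
  rw [mul_comm]

/-- Linear functions of `a²` are even polynomial functions of `a`. -/
lemma dual_sq_mem_evenFun (φ : Module.Dual ℂ (Forms 4)) :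
    (fun a => φ (sq a)) ∈ evenFun (Forms 2) := by
  have h := sum_mem (S := evenFun (Forms 2))
    fun (i : (Fin 6 × Fin 6) × (Fin 6 × Fin 6)) (_ : i ∈ Finset.univ) =>
    (evenFun (Forms 2)).smul_mem (Algebra.subset_adjoin
      ⟨(coef i.1.1 i.1.2, coef i.2.1 i.2.2), rfl⟩)
      (1 / 4 * φ (prodForm (coordProd i.1.1 i.1.2) (coordProd i.2.1 i.2.2)))
  convert h using 1
  funext a
  rw [sq_eq_sum a, map_sum, Finset.sum_apply]
  refine Finset.sum_congr rfl fun i _ => ?_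
  simp only [map_smul, Pi.smul_apply, smul_eq_mul]
  ring

lemma evenFun_le_polyFun {V : Type} [AddCommGroup V] [Module ℂ V] : evenFun V ≤ polyFun V := by
  refine Algebra.adjoin_le ?_
  rintro _ ⟨φ, rfl⟩
  exact mul_mem (dual_mem_polyFun φ.1) (dual_mem_polyFun φ.2)

lemma dual_sq_mem_polyFun (φ : Module.Dual ℂ (Forms 4)) :
    (fun a => φ (sq a)) ∈ polyFun (Forms 2) := evenFun_le_polyFun (dual_sq_mem_evenFun φ)

lemma dual_sq_tmul_mem_polyFun (φ : Module.Dual ℂ (Forms 4 ⊗[ℂ] Forms 4)) :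
    (fun a => φ (sq a ⊗ₜ[ℂ] sq a)) ∈ polyFun (Forms 2) := by
  have h := sum_mem_polyFun (V := Forms 2) Finset.univ
    fun (i : (Fin 6 × Fin 6) × (Fin 6 × Fin 6)) _ => mul_mem (mul_mem (mul_mem
      (const_mem_polyFun (1 / 4)) (dual_mem_polyFun (coef i.1.1 i.1.2)))
      (dual_mem_polyFun (coef i.2.1 i.2.2)))
      (dual_sq_mem_polyFun (φ.comp ((TensorProduct.mk ℂ (Forms 4) (Forms 4))
        (prodForm (coordProd i.1.1 i.1.2) (coordProd i.2.1 i.2.2)))))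
  convert h using 1
  funext a
  have e : ∀ x, φ (sq a ⊗ₜ[ℂ] x) = φ.comp ((TensorProduct.mk ℂ (Forms 4) (Forms 4)).flip x)
    (sq a) := fun _ => rfl
  rw [e, sq_eq_sum a, map_sum]
  refine Finset.sum_congr rfl fun i _ => ?_
  rw [map_smul, ← sq_eq_sum a, smul_eq_mul]
  simp only [Pi.mul_apply, LinearMap.comp_apply, LinearMap.flip_apply, TensorProduct.mk_apply]
  ring

end Igusa

namespace InvariantCone

variable {G E : Type} [Group G] [AddCommGroup E] [Module ℂ E] {ρ : Representation ℂ G E}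
  (C : InvariantCone ρ) (F : C.invariantRing) (n : ℕ) {ι : Type} (x : ι → C.carrier)

/-- The functions on a family of vectors of a cone that are fractions of invariants, with a power
of `F` as the denominator. -/
def IsFraction (f : ι → ℂ) : Prop :=
  ∃ k, ∃ H ∈ C.invariantPart (k * n), ∀ i, f i * F.1 (x i) ^ k = H.1 (x i)

variable {C F n x}

lemma pow_mem_invariantPart (hF : F ∈ C.invariantPart n) (k : ℕ) :
    F ^ k ∈ C.invariantPart (k * n) := by
  have := SetLike.pow_mem_graded k hF
  rwa [smul_eq_mul] at this

lemma IsFraction.add (hF : F ∈ C.invariantPart n) {f g : ι → ℂ} (hf : C.IsFraction F n x f)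
    (hg : C.IsFraction F n x g) :
    C.IsFraction F n x (f + g) := by
  obtain ⟨k, H, hH, hf⟩ := hf
  obtain ⟨l, K, hK, hg⟩ := hg
  refine ⟨k + l, H * F ^ l + F ^ k * K, ?_, fun i => ?_⟩
  · rw [add_mul]
    exact add_mem (SetLike.mul_mem_graded hH (pow_mem_invariantPart hF l))
      (SetLike.mul_mem_graded (pow_mem_invariantPart hF k) hK)
  · change (f i + g i) * _ = H.1 (x i) * F.1 (x i) ^ l + F.1 (x i) ^ k * K.1 (x i)
    rw [← hf, ← hg]
    ring

lemma IsFraction.mul {f g : ι → ℂ} (hf : C.IsFraction F n x f) (hg : C.IsFraction F n x g) :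
    C.IsFraction F n x (f * g) := by
  obtain ⟨k, H, hH, hf⟩ := hf
  obtain ⟨l, K, hK, hg⟩ := hg
  refine ⟨k + l, H * K, ?_, fun i => ?_⟩
  · rw [add_mul]
    exact SetLike.mul_mem_graded hH hK
  · change f i * g i * _ = H.1 (x i) * K.1 (x i)
    rw [← hf, ← hg]
    ring

end InvariantCone

namespace Igusa

variable {𝒟 : Denominator}

namespace Denominator

/-- Fractions are closed under sums and products, so only the constants from `invRing` and the
variable need to be tested. -/
lemma isFraction_polyEval {G E : Type} [Group G] [AddCommGroup E] [Module ℂ E]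
    {ρ : Representation ℂ G E} {C : InvariantCone ρ} {F : C.invariantRing} {n : ℕ}
    {x : 𝒟.NormSet × ℂ → C.carrier} (hF : F ∈ C.invariantPart n)
    (h1 : ∀ f : 𝒟.invRing, C.IsFraction F n x fun i => f.1 i.1)
    (h2 : C.IsFraction F n x fun i => i.2) (s : Polynomial 𝒟.invRing) :
    C.IsFraction F n x (polyEval s) := by
  have hC : ∀ f, polyEval (Polynomial.C f) = fun i : 𝒟.NormSet × ℂ => f.1 i.1 := fun f =>
    funext fun i => Polynomial.eval₂_C _ _
  have hX : polyEval (Polynomial.X : Polynomial 𝒟.invRing) = fun i => i.2 :=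
    funext fun i => Polynomial.eval₂_X _ _
  induction s using Polynomial.induction_on with
  | C f =>
    rw [hC]
    exact h1 f
  | add p q hp hq =>
    rw [map_add]
    exact .add hF hp hq
  | monomial n f h =>
    rw [pow_succ, ← mul_assoc, map_mul, hX]
    exact h.mul h2

end Denominator

/-! ### Invariants of the cones -/

lemma quartic_smul (t : ℂ) (a : Forms 2) (l m : ℂ) :
    quartic (t • a) l m = quartic a (l * t ^ 2) m := by
  rw [quartic, quartic, sq_smul, smul_smul]

/-- The lift ignores multiples of `b`, and `l • a²` is the square of `√l • a`. -/
lemma exists_lift {d : ℕ} {P : Forms 2 → ℂ} (hP : P ∈ sqFun) (hd : IsHomogFun (2 * d) P) :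
    ∃ Q ∈ polyFun (Forms 4), ∀ a l m, Q (quartic a l m) = l ^ d * P a := by
  obtain ⟨Q, hQ, hb, hs⟩ := exists_lift_of_mem_sqFun hP
  refine ⟨Q, hQ, fun a l m => ?_⟩
  obtain ⟨r, hr, hl⟩ := exists_smul_sq_eq l a
  rw [quartic, hb, hl, hs, hd, pow_mul, hr]

lemma exists_mem_coneV {d : ℕ} {Q : Forms 4 → ℂ} (hQ : Q ∈ polyFun (Forms 4))
    (hi : ∀ σ a l m, Q (quartic (permForms 2 σ a) l m) = Q (quartic a l m))
    (hh : ∀ c a l m, Q (quartic a (c * l) (c * m)) = c ^ d * Q (quartic a l m)) :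
    ∃ K ∈ coneV.invariantPart d, ∀ a l m h, K.1 ⟨quartic a l m, h⟩ = Q (quartic a l m) := by
  obtain ⟨K, hK, hv⟩ := coneV.exists_mem_invariantPart (d := d) hQ
    (by
      rintro σ _ ⟨a, l, m, rfl⟩
      rw [perm_quartic, hi])
    (by
      rintro c _ ⟨a, l, m, rfl⟩
      rw [smul_quartic, hh])
  exact ⟨K, hK, fun a l m h => hv _⟩

lemma exists_mem_coneV2 {d : ℕ} {Q : Forms 4 → ℂ} (hQ : Q ∈ polyFun (Forms 4))
    (hi : ∀ σ a l m, Q (quartic (permForms 2 σ a) l m) = Q (quartic a l m))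
    (hh : ∀ c a l m, Q (quartic a (c * l) (c * m)) = c ^ d * Q (quartic a l m)) :
    ∃ K ∈ coneV2.invariantPart d, ∀ v, K.1 v = Q v.1 := by
  refine coneV2.exists_mem_invariantPart (d := d) hQ ?_ ?_
  · rintro σ _ ⟨a, l, rfl⟩
    rw [perm_quartic, hi]
  · rintro c _ ⟨a, l, rfl⟩
    rw [smul_quartic, hh]

lemma exists_mem_coneBlowup {d : ℕ} {Q : Forms 4 ⊗[ℂ] Forms 4 → ℂ}
    (hQ : Q ∈ polyFun (Forms 4 ⊗[ℂ] Forms 4)) {q : Forms 2 → ℂ → ℂ → ℂ}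
    (hq : ∀ a l m, Q (quartic a l m ⊗ₜ[ℂ] sq a) = q a l m)
    (hi : ∀ σ a l m, q (permForms 2 σ a) l m = q a l m)
    (hh : ∀ c a l m, q a (c * l) (c * m) = c ^ d * q a l m) :
    ∃ K ∈ coneBlowup.invariantPart d, ∀ a l m h,
      K.1 ⟨quartic a l m ⊗ₜ[ℂ] sq a, h⟩ = q a l m := by
  obtain ⟨K, hK, hv⟩ := coneBlowup.exists_mem_invariantPart (d := d) hQ
    (by
      rintro σ _ ⟨a, l, m, rfl⟩
      rw [Representation.tprod_apply, TensorProduct.map_tmul, perm_quartic, perm_sq, hq, hq, hi])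
    (by
      rintro c _ ⟨a, l, m, rfl⟩
      rw [TensorProduct.smul_tmul', smul_quartic, hq, hq, hh])
  exact ⟨K, hK, fun a l m h => (hv _).trans (hq a l m)⟩

instance : IsDomain coneV2.invariantRing :=
  coneV2.isDomain_invariantRing (W := Forms 2)
    (θ := fun a => ⟨sq a, a, 1, by simp [quartic]⟩) dual_sq_mem_polyFun (by
      rintro ⟨_, a, l, rfl⟩
      obtain ⟨r, -, hr⟩ := exists_smul_sq_eq l a
      exact ⟨r • a, Subtype.ext (by simp [quartic, hr])⟩)

lemma dual_quartic_mem_polyFun (φ : Module.Dual ℂ (Forms 4)) :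
    (fun w : Forms 2 × ℂ => φ (quartic w.1 1 w.2)) ∈ polyFun (Forms 2 × ℂ) := by
  have h := add_mem (comp_linear_mem_polyFun (LinearMap.fst ℂ (Forms 2) ℂ)
    (dual_sq_mem_polyFun φ)) (mul_mem (dual_mem_polyFun (LinearMap.snd ℂ (Forms 2) ℂ))
      (const_mem_polyFun (φ b)))
  convert h using 1
  funext w
  simp [quartic]

lemma dual_quartic_tmul_mem_polyFun (φ : Module.Dual ℂ (Forms 4 ⊗[ℂ] Forms 4)) :
    (fun w : (Forms 2 × ℂ) × ℂ => φ (quartic w.1.1 w.1.2 w.2 ⊗ₜ[ℂ] sq w.1.1)) ∈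
      polyFun ((Forms 2 × ℂ) × ℂ) := by
  have h := add_mem
    (mul_mem (dual_mem_polyFun ((LinearMap.snd ℂ (Forms 2) ℂ).comp (LinearMap.fst ℂ _ ℂ)))
      (comp_linear_mem_polyFun ((LinearMap.fst ℂ (Forms 2) ℂ).comp (LinearMap.fst ℂ _ ℂ))
        (dual_sq_tmul_mem_polyFun φ)))
    (mul_mem (dual_mem_polyFun (LinearMap.snd ℂ (Forms 2 × ℂ) ℂ))
      (comp_linear_mem_polyFun ((LinearMap.fst ℂ (Forms 2) ℂ).comp (LinearMap.fst ℂ _ ℂ))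
        (dual_sq_mem_polyFun (φ.comp (TensorProduct.mk ℂ (Forms 4) (Forms 4) b)))))
  convert h using 1
  funext w
  change φ ((w.1.2 • sq w.1.1 + w.2 • b) ⊗ₜ[ℂ] sq w.1.1) = _
  rw [TensorProduct.add_tmul, ← TensorProduct.smul_tmul', ← TensorProduct.smul_tmul',
    map_add, map_smul, map_smul]
  rfl

instance : IsDomain coneV.invariantRing :=
  coneV.isDomain_invariantRing (W := Forms 2 × ℂ)
    (θ := fun w => ⟨quartic w.1 1 w.2, w.1, 1, w.2, rfl⟩) dual_quartic_mem_polyFun (by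
      rintro ⟨_, a, l, m, rfl⟩
      obtain ⟨r, -, hr⟩ := exists_smul_sq_eq l a
      exact ⟨(r • a, m), Subtype.ext (by simp [quartic, hr])⟩)

instance : IsDomain coneBlowup.invariantRing :=
  coneBlowup.isDomain_invariantRing (W := (Forms 2 × ℂ) × ℂ)
    (θ := fun w => ⟨quartic w.1.1 w.1.2 w.2 ⊗ₜ[ℂ] sq w.1.1, w.1.1, w.1.2, w.2, rfl⟩)
    dual_quartic_tmul_mem_polyFun (by
      rintro ⟨_, a, l, m, rfl⟩
      exact ⟨((a, l), m), rfl⟩)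

/-- A linear function that does not vanish at the Igusa quartic. -/
def dualB : Module.Dual ℂ (Forms 4) := evalForm 4 (linePt 0 0 1 0 0)

lemma dualB_b : dualB b = 1 := by
  rw [dualB, evalForm_b, b_linePt]
  norm_num

lemma dualB_quartic (a : Forms 2) (l m : ℂ) : dualB (quartic a l m) = l * dualB (sq a) + m := by
  simp [quartic, dualB_b]

/-- The linear map that recovers the double quadric from a point of the blown-up cone. -/
def blowupMap : Forms 4 ⊗[ℂ] Forms 4 →ₗ[ℂ] Forms 4 :=
  TensorProduct.lift (LinearMap.mk₂ ℂ (fun x y => dualB x • y - dualB y • x)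
    (fun x x' y => by simp only [map_add, add_smul, smul_add]; abel)
    (fun c x y => by simp only [map_smul, smul_sub, smul_smul, smul_eq_mul, mul_comm])
    (fun x y y' => by simp only [map_add, add_smul, smul_add]; abel)
    (fun c x y => by simp only [map_smul, smul_sub, smul_smul, smul_eq_mul, mul_comm]))

/-- Antisymmetrising against `dualB` removes the `l a²` part: modulo `b` the result is `m a²`. Thus
elements of `sqFun` yield functions that scale with `m`, the coordinate nonzero on the exceptional
divisor. -/
lemma blowupMap_tmul (a : Forms 2) (l m : ℂ) :
    blowupMap (quartic a l m ⊗ₜ[ℂ] sq a) = quartic a m (-(m * dualB (sq a))) := by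
  have h : blowupMap (quartic a l m ⊗ₜ[ℂ] sq a) =
      dualB (quartic a l m) • sq a - dualB (sq a) • quartic a l m := by
    rw [blowupMap, TensorProduct.lift.tmul, LinearMap.mk₂_apply]
  rw [h, dualB_quartic, quartic, quartic]
  module

/-- Since `b` vanishes at a point of its singular line, this functional reads off `l`. -/
lemma dual_quartic_linePt (a : Forms 2) (l m : ℂ) :
    evalForm 4 (linePt 1 0 0 0 0) (quartic a l m) = l * lineFun 0 0 a ^ 2 := by
  have h1 : evalForm 4 (linePt 1 0 0 0 0) b = 0 := by
    rw [evalForm_b, b_linePt]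
    ring
  have h2 : lineFun 0 0 a = a.1 (linePt 1 0 0 0 0) := by
    rw [lineFun, lineCoord, if_pos rfl]
    rfl
  rw [quartic, map_add, map_smul, map_smul, h1, evalForm_sq, h2, smul_eq_mul, smul_zero, add_zero,
    pow_two]

end Igusa

namespace InvariantCone

/-- A chart of the quotient of a cone that is the product of an affine scheme with the affine
line. -/
theorem exists_polynomial_chart {G E : Type} [Group G] [Finite G] [AddCommGroup E] [Module ℂ E]
    {ρ : Representation ℂ G E} (C : InvariantCone ρ) [IsDomain C.invariantRing]
    {F : C.invariantRing} {n : ℕ} (hF : F ∈ C.invariantPart n) (hn : 0 < n) {R κ : Type}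
    [CommRing R] [Algebra ℂ R] [Nonempty κ] (ev : κ → R →+* ℂ)
    (hev : ∀ u r, ev u (algebraMap ℂ R r) = r)
    (hinj : ∀ p : Polynomial R, (∀ u c, p.eval₂ (ev u) c = 0) → p = 0) (x : κ × ℂ → C.carrier)
    (hx : ∀ i, F.1 (x i) ≠ 0) (hcov : ∀ v, F.1 v ≠ 0 → ∃ c i, v = C.scale c (x i))
    (h1 : ∀ s : Polynomial R, C.IsFraction F n x fun i => s.eval₂ (ev i.1) i.2)
    (h2 : ∀ k, ∀ H ∈ C.invariantPart (k * n), ∃ s : Polynomial R,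
      ∀ i, s.eval₂ (ev i.1) i.2 * F.1 (x i) ^ k = H.1 (x i)) :
    ∃ (j : Spec (.of (Polynomial R)) ⟶ C.quotient) (_ : IsOpenImmersion j), IsDominant j ∧
      j ≫ C.quotientToSpec = Spec.map (CommRingCat.ofHom (algebraMap ℂ (Polynomial R))) ∧
      (∀ u c (h0 : (x (u, c) : E) ≠ 0), j (kerPoint (Polynomial.eval₂RingHom (ev u) c)) =
        C.point (x (u, c)) (x (u, c)).2 h0) ∧
      ∀ v (hv : v ∈ C.carrier) (h0 : v ≠ 0), C.point v hv h0 ∈ j.opensRange →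
        F.1 ⟨v, hv⟩ ≠ 0 := by
  let θ : Polynomial R →ₐ[ℂ] (κ × ℂ → ℂ) :=
    { toRingHom := RingHom.pi fun i => Polynomial.eval₂RingHom (ev i.1) i.2
      commutes' := fun r => by
        funext i
        change Polynomial.eval₂ (ev i.1) i.2 (Polynomial.C (algebraMap ℂ R r)) = r
        rw [Polynomial.eval₂_C, hev] }
  obtain ⟨j, hj, hd, hs, hp, hr⟩ := C.exists_chart x hF hn θ
    ((injective_iff_map_eq_zero _).mpr fun p h => hinj p fun u c => congrFun h (u, c)) hx hcov h1 h2
  exact ⟨j, hj, hd, hs, fun u c h0 => hp (u, c) h0, hr⟩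

end InvariantCone

namespace Igusa

namespace Denominator

variable (𝒟 : Denominator)

/-! ### Charts of the moduli spaces -/

lemma quartic_eq_smul {u : 𝒟.NormSet} {t l m : ℂ} (hl : l ≠ 0) (ht : t ≠ 0) :
    quartic (t • u.1) l m = (l * t ^ 2) • quartic u.1 1 (m / (l * t ^ 2)) := by
  rw [quartic_smul, smul_quartic, mul_one, mul_div_cancel₀ _ (mul_ne_zero hl (pow_ne_zero 2 ht))]

lemma quartic_tmul_eq_smul {u : 𝒟.NormSet} {t l m : ℂ} (hm : m ≠ 0) :
    quartic (t • u.1) l m ⊗ₜ[ℂ] sq (t • u.1) =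
      (m * t ^ 2) • (quartic u.1 (l * t ^ 2 / m) 1 ⊗ₜ[ℂ] sq u.1) := by
  rw [quartic_smul, sq_smul, TensorProduct.tmul_smul, mul_comm m, mul_smul,
    TensorProduct.smul_tmul' m, smul_quartic, mul_one, mul_div_cancel₀ _ hm]

/-- The double quadrics, as vectors of the cone over `𝕍₂`. -/
def vecP (a : Forms 2) : coneV2.carrier := ⟨sq a, a, 1, by simp [quartic]⟩

/-- The members of Igusa pencils, as vectors of the cone over `𝕍`. -/
def vecX (a : Forms 2) (l m : ℂ) : coneV.carrier := ⟨quartic a l m, a, l, m, rfl⟩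

/-- The vectors of the blown-up cone. -/
def vecBlowup (a : Forms 2) (l m : ℂ) : coneBlowup.carrier :=
  ⟨quartic a l m ⊗ₜ[ℂ] sq a, a, l, m, rfl⟩

lemma sq_eq_quartic (a : Forms 2) : sq a = quartic a 1 0 := by simp [quartic]

lemma exists_vecP_eq {d : ℕ} {P : Forms 2 → ℂ} (hP : P ∈ sqFun) (hd : IsHomogFun (2 * d) P)
    (hi : IsInvFun P) : ∃ K ∈ coneV2.invariantPart d, ∀ a, K.1 (vecP a) = P a := by
  obtain ⟨Q, hQ, hv⟩ := exists_lift hP hd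
  obtain ⟨K, hK, hKv⟩ := exists_mem_coneV2 (d := d) hQ
    (fun σ a l m => by rw [hv, hv, hi])
    (fun c a l m => by rw [hv, hv]; ring)
  refine ⟨K, hK, fun a => (hKv _).trans ?_⟩
  change Q (sq a) = _
  rw [sq_eq_quartic, hv, one_pow, one_mul]

lemma exists_vecX_eq {d : ℕ} {P : Forms 2 → ℂ} (hP : P ∈ sqFun) (hd : IsHomogFun (2 * d) P)
    (hi : IsInvFun P) :
    ∃ K ∈ coneV.invariantPart d, ∀ a l m, K.1 (vecX a l m) = l ^ d * P a := by
  obtain ⟨Q, hQ, hv⟩ := exists_lift hP hd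
  obtain ⟨K, hK, hKv⟩ := exists_mem_coneV (d := d) hQ
    (fun σ a l m => by rw [hv, hv, hi])
    (fun c a l m => by rw [hv, hv]; ring)
  exact ⟨K, hK, fun a l m => (hKv a l m _).trans (hv a l m)⟩

lemma exists_vecBlowup_eq {d : ℕ} {P : Forms 2 → ℂ} (hP : P ∈ sqFun)
    (hd : IsHomogFun (2 * d) P) (hi : IsInvFun P) :
    ∃ K ∈ coneBlowup.invariantPart d, ∀ a l m, K.1 (vecBlowup a l m) = m ^ d * P a := by
  obtain ⟨Q, hQ, hv⟩ := exists_lift hP hd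
  obtain ⟨K, hK, hKv⟩ := exists_mem_coneBlowup (q := fun a l m => m ^ d * P a)
    (comp_linear_mem_polyFun blowupMap hQ)
    (fun a l m => by rw [blowupMap_tmul, hv])
    (fun σ a l m => by rw [hi])
    (fun c a l m => by ring)
  exact ⟨K, hK, fun a l m => hKv a l m _⟩

lemma ne_zero_of_pow_mul {l : ℂ} {a : Forms 2} (h : l ^ 𝒟.n * 𝒟.F a ≠ 0) : l ≠ 0 ∧ 𝒟.F a ≠ 0 := by
  refine ⟨?_, right_ne_zero_of_mul h⟩
  rintro rfl
  exact h (by rw [zero_pow 𝒟.n_pos.ne', zero_mul])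

/-! ### The moduli space of pencils -/

lemma exists_vecP_mul_eq {F : coneV2.invariantRing} (hF : ∀ a, F.1 (vecP a) = 𝒟.F a)
    (f : 𝒟.invRing) : coneV2.IsFraction F 𝒟.n (fun u : 𝒟.NormSet => vecP u.1) f.1 := by
  obtain ⟨k, p, hp, hpd, hpi, hpv⟩ := exists_sqFun_fraction f
  obtain ⟨H, hH, hHv⟩ := exists_vecP_eq hp hpd hpi
  exact ⟨k, H, hH, fun u => by rw [hF, hHv, hpv]⟩

/-- The easy inclusion: an invariant on the cone pulls back to an invariant polynomial function of
`a`. The opposite one, `exists_vecP_mul_eq`, needs `sqFun`. -/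
lemma exists_eq_mul_vecP (H : coneV2.invariantRing) (k : ℕ) :
    ∃ s : 𝒟.invRing, ∀ u : 𝒟.NormSet, s.1 u * 𝒟.F u.1 ^ k = H.1 (vecP u.1) := by
  have hP : (fun a => H.1 (vecP a)) ∈ polyFun (Forms 2) :=
    coneV2.comp_coordRing_mem_polyFun (W := Forms 2) (θ := vecP) dual_sq_mem_polyFun H.2.1
  exact ⟨𝒟.frac k _ hP fun σ a => H.2.2 σ (vecP a), fun u => 𝒟.frac_apply k _ hP _ u⟩

lemma exists_eq_scale_vecP {F : coneV2.invariantRing} (hF : F ∈ coneV2.invariantPart 𝒟.n)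
    (hFv : ∀ a, F.1 (vecP a) = 𝒟.F a) (v : coneV2.carrier) (h : F.1 v ≠ 0) :
    ∃ (c : ℂ) (u : 𝒟.NormSet), v = coneV2.scale c (vecP u.1) := by
  obtain ⟨_, a, l, rfl⟩ := v
  have hv : (⟨quartic a l 0, a, l, rfl⟩ : coneV2.carrier) = coneV2.scale l (vecP a) :=
    Subtype.ext (by
      change quartic a l 0 = l • sq a
      simp [quartic])
  rw [hv] at h ⊢
  rw [coneV2.mem_invariantPart.mp hF l (vecP a), hFv] at h
  obtain ⟨u, hu⟩ := exists_eq_smul (ne_zero_of_pow_mul 𝒟 h).2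
  refine ⟨l * tot a ^ 2, u, Subtype.ext ?_⟩
  change l • sq a = (l * tot a ^ 2) • sq u.1
  conv_lhs => rw [hu, sq_smul, smul_smul]

theorem exists_chart_moduliP : ∃ (j : Spec (.of 𝒟.invRing) ⟶ moduliP) (_ : IsOpenImmersion j),
    IsDominant j ∧ j ≫ coneV2.quotientToSpec =
      Spec.map (CommRingCat.ofHom (algebraMap ℂ 𝒟.invRing)) ∧
    (∀ (u : 𝒟.NormSet) h, j (kerPoint (evalAt u)) = pointP u.1 h) ∧
    ∀ a ha, pointP a ha ∈ j.opensRange → 𝒟.F a ≠ 0 := by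
  obtain ⟨F, hF, hFv⟩ := exists_vecP_eq 𝒟.mem_sqFun 𝒟.homog 𝒟.inv
  obtain ⟨j, hj, hd, hs, hp, hr⟩ := coneV2.exists_chart hF 𝒟.n_pos (ι := 𝒟.NormSet)
    𝒟.invRing.val Subtype.val_injective (x := fun u => vecP u.1)
    (fun u => by
      rw [hFv]
      exact u.3)
    (exists_eq_scale_vecP 𝒟 hF hFv) (exists_vecP_mul_eq 𝒟 hFv)
    (fun k H _ => by
      obtain ⟨s, hs⟩ := exists_eq_mul_vecP 𝒟 H k
      refine ⟨s, fun u => ?_⟩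
      rw [hFv]
      exact hs u)
  refine ⟨j, hj, hd, hs, fun u h => hp u (sq_ne_zero h), fun a ha h => ?_⟩
  rw [← hFv]
  exact hr _ _ _ h

/-! ### The moduli space of quartics -/

lemma isFraction_vecX {F : coneV.invariantRing}
    (hF : ∀ a l m, F.1 (vecX a l m) = l ^ 𝒟.n * 𝒟.F a) (f : 𝒟.invRing) :
    coneV.IsFraction F 𝒟.n (fun i : 𝒟.NormSet × ℂ => vecX i.1.1 1 i.2) fun i => f.1 i.1 := by
  obtain ⟨k, p, hp, hpd, hpi, hpv⟩ := exists_sqFun_fraction f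
  obtain ⟨H, hH, hHv⟩ := exists_vecX_eq hp hpd hpi
  exact ⟨k, H, hH, fun i => by rw [hF, hHv, one_pow, one_pow, one_mul, one_mul, hpv]⟩

/-- `dualB` of `l a² + m b` is `l · dualB(a²) + m`. The first summand becomes a lift from `sqFun`
after multiplication by `F^N`, so it can be subtracted. The difference has degree `nN + 1`, and a
lift of `F^M F₃`, of degree `nM + n - 1`, completes it to a multiple of `n`. -/
lemma isFraction_vecX_snd {F : coneV.invariantRing}
    (hF : ∀ a l m, F.1 (vecX a l m) = l ^ 𝒟.n * 𝒟.F a) :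
    coneV.IsFraction F 𝒟.n (fun i : 𝒟.NormSet × ℂ => vecX i.1.1 1 i.2) fun i => i.2 := by
  obtain ⟨m, hm⟩ := Nat.exists_eq_add_of_le' 𝒟.n_pos
  obtain ⟨N, hN⟩ := 𝒟.exists_pow_mul_mem _ (dual_sq_mem_evenFun dualB)
  have hF₃ : IsHomogFun (2 * m) 𝒟.F₃ := by
    convert 𝒟.F₃_homog using 1
    omega
  obtain ⟨M, hM⟩ := 𝒟.exists_pow_mul_mem _ (hF₃.mem_evenFun 𝒟.F₃_mem)
  obtain ⟨Q₁, hQ₁, hv₁⟩ := exists_lift (d := 𝒟.n * N) (pow_mem 𝒟.mem_sqFun N) (by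
    rw [← mul_assoc]
    exact 𝒟.homog.pow N)
  obtain ⟨Q₂, hQ₂, hv₂⟩ := exists_lift (d := 𝒟.n * N + 1) hN (by
    rw [mul_add, ← mul_assoc]
    exact (𝒟.homog.pow N).mul fun t a => by rw [sq_smul, map_smul, smul_eq_mul])
  obtain ⟨Q₃, hQ₃, hv₃⟩ := exists_lift (d := 𝒟.n * M + m) hM (by
    rw [mul_add, ← mul_assoc]
    exact (𝒟.homog.pow M).mul hF₃)
  have hval : ∀ a l c, ((Q₁ * (fun v => dualB v) - Q₂) * Q₃) (quartic a l c) =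
      c * l ^ (𝒟.n * N + 𝒟.n * M + m) * (𝒟.F a ^ (N + M) * 𝒟.F₃ a) := by
    intro a l c
    simp only [Pi.mul_apply, Pi.sub_apply, Pi.pow_apply, hv₁, hv₂, hv₃, dualB_quartic]
    ring
  obtain ⟨H, hH, hHv⟩ := exists_mem_coneV (d := (N + M + 1) * 𝒟.n)
    (mul_mem (sub_mem (mul_mem hQ₁ (dual_mem_polyFun dualB)) hQ₂) hQ₃)
    (fun σ a l c => by rw [hval, hval, 𝒟.inv, 𝒟.F₃_inv])
    (fun t a l c => by
      rw [hval, hval, hm]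
      ring)
  refine ⟨N + M + 1, H, hH, fun i => ?_⟩
  have h := (hHv i.1.1 1 i.2 ⟨_, _, _, rfl⟩).trans (hval _ _ _)
  rw [← F_eq_F₃] at h
  rw [hF]
  refine Eq.trans ?_ h.symm
  ring

lemma exists_eq_mul_vecX (H : coneV.invariantRing) (k : ℕ) : ∃ s : Polynomial 𝒟.invRing,
    ∀ i : 𝒟.NormSet × ℂ, polyEval s i * 𝒟.F i.1.1 ^ k = H.1 (vecX i.1.1 1 i.2) := by
  have hP : (fun w : Forms 2 × ℂ => H.1 (vecX w.1 1 w.2)) ∈ polyFun (Forms 2 × ℂ) :=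
    coneV.comp_coordRing_mem_polyFun (W := Forms 2 × ℂ) (θ := fun w => vecX w.1 1 w.2)
      dual_quartic_mem_polyFun H.2.1
  refine exists_polyEval_eq hP (fun σ a c => ?_) k
  have h : vecX (permForms 2 σ a) 1 c = coneV.act σ (vecX a 1 c) :=
    Subtype.ext (perm_quartic σ a 1 c).symm
  change H.1 (vecX (permForms 2 σ a) 1 c) = H.1 (vecX a 1 c)
  rw [h]
  exact H.2.2 σ _

lemma exists_eq_scale_vecX {F : coneV.invariantRing}
    (hF : ∀ a l m, F.1 (vecX a l m) = l ^ 𝒟.n * 𝒟.F a) (v : coneV.carrier) (h : F.1 v ≠ 0) :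
    ∃ (c : ℂ) (i : 𝒟.NormSet × ℂ), v = coneV.scale c (vecX i.1.1 1 i.2) := by
  obtain ⟨_, a, l, m, rfl⟩ := v
  change F.1 (vecX a l m) ≠ 0 at h
  rw [hF] at h
  obtain ⟨hl, ha⟩ := ne_zero_of_pow_mul 𝒟 h
  obtain ⟨u, hu⟩ := exists_eq_smul ha
  refine ⟨l * tot a ^ 2, (u, m / (l * tot a ^ 2)), Subtype.ext ?_⟩
  change quartic a l m = (l * tot a ^ 2) • quartic u.1 1 (m / (l * tot a ^ 2))
  rw [← quartic_eq_smul 𝒟 hl (tot_ne_zero ha), ← hu]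

lemma eq_zero_of_eval₂ (p : Polynomial 𝒟.invRing)
    (h : ∀ (u : 𝒟.NormSet) c, p.eval₂ (evalAt u) c = 0) : p = 0 :=
  polyEval_injective (funext fun i => (h i.1 i.2).trans (by rw [map_zero]; rfl))

theorem exists_chart_moduliX : ∃ (j : Spec (.of (Polynomial 𝒟.invRing)) ⟶ moduliX)
    (_ : IsOpenImmersion j), IsDominant j ∧ j ≫ coneV.quotientToSpec =
      Spec.map (CommRingCat.ofHom (algebraMap ℂ (Polynomial 𝒟.invRing))) ∧
    (∀ (u : 𝒟.NormSet) c h, j (kerPoint (Polynomial.eval₂RingHom (evalAt u) c)) =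
      pointX u.1 1 c h) ∧
    ∀ a l m h, pointX a l m h ∈ j.opensRange → l ≠ 0 ∧ 𝒟.F a ≠ 0 := by
  obtain ⟨F, hF, hFv⟩ := exists_vecX_eq 𝒟.mem_sqFun 𝒟.homog 𝒟.inv
  have hF1 : ∀ i : 𝒟.NormSet × ℂ, F.1 (vecX i.1.1 1 i.2) = 𝒟.F i.1.1 := fun i => by
    rw [hFv, one_pow, one_mul]
  obtain ⟨j, hj, hd, hs, hp, hr⟩ := coneV.exists_polynomial_chart hF 𝒟.n_pos evalAt
    (fun _ _ => rfl) (eq_zero_of_eval₂ 𝒟) (fun i => vecX i.1.1 1 i.2)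
    (fun i => by
      rw [hF1]
      exact i.1.3)
    (exists_eq_scale_vecX 𝒟 hFv)
    (isFraction_polyEval hF (isFraction_vecX 𝒟 hFv) (isFraction_vecX_snd 𝒟 hFv))
    (fun k H _ => by
      obtain ⟨s, hs⟩ := exists_eq_mul_vecX 𝒟 H k
      refine ⟨s, fun i => ?_⟩
      rw [hF1]
      exact hs i)
  refine ⟨j, hj, hd, hs, hp, fun a l m h hm => ?_⟩
  · have h1 := hr _ _ _ hm
    change F.1 (vecX a l m) ≠ 0 at h1
    rw [hFv] at h1
    exact ne_zero_of_pow_mul 𝒟 h1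

/-! ### The blown-up cone -/

lemma isFraction_vecBlowup {F : coneBlowup.invariantRing}
    (hF : ∀ a l m, F.1 (vecBlowup a l m) = m ^ 𝒟.n * 𝒟.F a) (f : 𝒟.invRing) :
    coneBlowup.IsFraction F 𝒟.n (fun i : 𝒟.NormSet × ℂ => vecBlowup i.1.1 i.2 1)
      fun i => f.1 i.1 := by
  obtain ⟨k, p, hp, hpd, hpi, hpv⟩ := exists_sqFun_fraction f
  obtain ⟨H, hH, hHv⟩ := exists_vecBlowup_eq hp hpd hpi
  exact ⟨k, H, hH, fun i => by rw [hF, hHv, one_pow, one_pow, one_mul, one_mul, hpv]⟩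

/-- Evaluating both tensor factors at a point of the singular line gives `l α⁴`. The factor `F₂⁴`
turns `α⁴` into `F⁴`. -/
lemma isFraction_vecBlowup_snd {F : coneBlowup.invariantRing}
    (hF : ∀ a l m, F.1 (vecBlowup a l m) = m ^ 𝒟.n * 𝒟.F a) :
    coneBlowup.IsFraction F 𝒟.n (fun i : 𝒟.NormSet × ℂ => vecBlowup i.1.1 i.2 1)
      fun i => i.2 := by
  obtain ⟨m, hm⟩ := Nat.exists_eq_add_of_le' 𝒟.n_pos
  have hth : IsHomogFun 1 totFun := isHomogFun_dual tot
  -- Half of the degree of `F₂⁴` is `4n - 2`. The factor `totFun ^ 2`, which is `1` on normalised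
  -- forms, raises it to `4n - 1`; with the degree one of `l α⁴` the sum is a multiple of `n`.
  have hF₂ : IsHomogFun (2 * (4 * m + 3)) (totFun ^ 2 * 𝒟.F₂ ^ 4) := by
    convert (hth.pow 2).mul (𝒟.F₂_homog.pow 4) using 1
    omega
  obtain ⟨M, hM⟩ := 𝒟.exists_pow_mul_mem _ (hF₂.mem_evenFun
    (mul_mem (pow_mem (dual_mem_polyFun tot) 2) (pow_mem 𝒟.F₂_mem 4)))
  obtain ⟨Q, hQ, hv⟩ := exists_lift (d := 𝒟.n * M + (4 * m + 3)) hM (by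
    rw [mul_add, ← mul_assoc]
    exact (𝒟.homog.pow M).mul hF₂)
  have hval : ∀ a l c, ((fun w => ((LinearMap.mul' ℂ ℂ).comp (TensorProduct.map
      (evalForm 4 (linePt 1 0 0 0 0)) (evalForm 4 (linePt 1 0 0 0 0)))) w) *
      fun w => Q (blowupMap w)) (quartic a l c ⊗ₜ[ℂ] sq a) =
      l * c ^ (𝒟.n * M + (4 * m + 3)) * (𝒟.F a ^ (M + 4) * totFun a ^ 2) := by
    intro a l c
    have h1 : evalForm 4 (linePt 1 0 0 0 0) (sq a) = lineFun 0 0 a ^ 2 := by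
      rw [sq_eq_quartic, dual_quartic_linePt, one_mul]
    have h4 : 𝒟.F a ^ 4 = lineFun 0 0 a ^ 4 * 𝒟.F₂ a ^ 4 := by
      rw [← mul_pow]
      exact congrArg (· ^ 4) (congrFun 𝒟.eq_line_mul a)
    simp only [Pi.mul_apply, LinearMap.comp_apply, TensorProduct.map_tmul,
      LinearMap.mul'_apply, blowupMap_tmul, hv, dual_quartic_linePt, h1, pow_add (𝒟.F a) M 4, h4,
      Pi.pow_apply]
    ring
  obtain ⟨H, hH, hHv⟩ := exists_mem_coneBlowup (d := (M + 4) * 𝒟.n)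
    (mul_mem (dual_mem_polyFun _) (comp_linear_mem_polyFun blowupMap hQ)) hval
    (fun σ a l c => by rw [𝒟.inv, isInvFun_totFun])
    (fun t a l c => by
      rw [hm]
      ring)
  refine ⟨M + 4, H, hH, fun i => ?_⟩
  have h := hHv i.1.1 i.2 1 ⟨_, _, _, rfl⟩
  have ht : totFun i.1.1 = 1 := i.1.2
  rw [ht] at h
  rw [hF]
  refine Eq.trans ?_ h.symm
  ring

lemma exists_eq_mul_vecBlowup (H : coneBlowup.invariantRing) (k : ℕ) :
    ∃ s : Polynomial 𝒟.invRing, ∀ i : 𝒟.NormSet × ℂ,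
      polyEval s i * 𝒟.F i.1.1 ^ k = H.1 (vecBlowup i.1.1 i.2 1) := by
  have hc : ∀ ψ : Module.Dual ℂ ((Forms 2 × ℂ) × ℂ),
      (fun w : Forms 2 × ℂ => ψ (w, 1)) ∈ polyFun (Forms 2 × ℂ) := fun ψ => by
    have h := add_mem (dual_mem_polyFun (ψ.comp (LinearMap.inl ℂ (Forms 2 × ℂ) ℂ)))
      (const_mem_polyFun (V := Forms 2 × ℂ) (ψ (0, 1)))
    convert h using 1
    funext w
    change ψ (w, 1) = ψ (w, 0) + ψ (0, 1)
    rw [← map_add]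
    simp
  have hP : (fun w : Forms 2 × ℂ => H.1 (vecBlowup w.1 w.2 1)) ∈ polyFun (Forms 2 × ℂ) :=
    coneBlowup.comp_coordRing_mem_polyFun (W := Forms 2 × ℂ)
      (θ := fun w => vecBlowup w.1 w.2 1)
      (fun φ => comp_mem_polyFun hc (dual_quartic_tmul_mem_polyFun φ)) H.2.1
  refine exists_polyEval_eq hP (fun σ a c => ?_) k
  have h : vecBlowup (permForms 2 σ a) c 1 = coneBlowup.act σ (vecBlowup a c 1) := by
    apply Subtype.ext
    change quartic _ _ _ ⊗ₜ[ℂ] sq _ = TensorProduct.map _ _ (_ ⊗ₜ[ℂ] _)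
    rw [TensorProduct.map_tmul, perm_quartic, perm_sq]
  change H.1 (vecBlowup (permForms 2 σ a) c 1) = H.1 (vecBlowup a c 1)
  rw [h]
  exact H.2.2 σ _

lemma exists_eq_scale_vecBlowup {F : coneBlowup.invariantRing}
    (hF : ∀ a l m, F.1 (vecBlowup a l m) = m ^ 𝒟.n * 𝒟.F a) (v : coneBlowup.carrier)
    (h : F.1 v ≠ 0) :
    ∃ (c : ℂ) (i : 𝒟.NormSet × ℂ), v = coneBlowup.scale c (vecBlowup i.1.1 i.2 1) := by
  obtain ⟨_, a, l, m, rfl⟩ := v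
  change F.1 (vecBlowup a l m) ≠ 0 at h
  rw [hF] at h
  obtain ⟨hm, ha⟩ := ne_zero_of_pow_mul 𝒟 h
  obtain ⟨u, hu⟩ := exists_eq_smul ha
  refine ⟨m * tot a ^ 2, (u, l * tot a ^ 2 / m), Subtype.ext ?_⟩
  change quartic a l m ⊗ₜ[ℂ] sq a =
    (m * tot a ^ 2) • (quartic u.1 (l * tot a ^ 2 / m) 1 ⊗ₜ[ℂ] sq u.1)
  rw [← quartic_tmul_eq_smul 𝒟 hm, ← hu]

theorem exists_chart_moduliBlowup : ∃ (j : Spec (.of (Polynomial 𝒟.invRing)) ⟶ moduliBlowup)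
    (_ : IsOpenImmersion j), IsDominant j ∧ j ≫ coneBlowup.quotientToSpec =
      Spec.map (CommRingCat.ofHom (algebraMap ℂ (Polynomial 𝒟.invRing))) ∧
    (∀ (u : 𝒟.NormSet) c hu h, j (kerPoint (Polynomial.eval₂RingHom (evalAt u) c)) =
      pointBlowup u.1 hu c 1 h) ∧
    ∀ a ha l m h, pointBlowup a ha l m h ∈ j.opensRange → m ≠ 0 ∧ 𝒟.F a ≠ 0 := by
  obtain ⟨F, hF, hFv⟩ := exists_vecBlowup_eq 𝒟.mem_sqFun 𝒟.homog 𝒟.inv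
  have hF1 : ∀ i : 𝒟.NormSet × ℂ, F.1 (vecBlowup i.1.1 i.2 1) = 𝒟.F i.1.1 := fun i => by
    rw [hFv, one_pow, one_mul]
  obtain ⟨j, hj, hd, hs, hp, hr⟩ := coneBlowup.exists_polynomial_chart hF 𝒟.n_pos evalAt
    (fun _ _ => rfl) (eq_zero_of_eval₂ 𝒟) (fun i => vecBlowup i.1.1 i.2 1)
    (fun i => by
      rw [hF1]
      exact i.1.3)
    (exists_eq_scale_vecBlowup 𝒟 hFv)
    (isFraction_polyEval hF (isFraction_vecBlowup 𝒟 hFv) (isFraction_vecBlowup_snd 𝒟 hFv))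
    (fun k H _ => by
      obtain ⟨s, hs⟩ := exists_eq_mul_vecBlowup 𝒟 H k
      refine ⟨s, fun i => ?_⟩
      rw [hF1]
      exact hs i)
  refine ⟨j, hj, hd, hs, fun u c hu h => hp u c (tmul_ne_zero h (sq_ne_zero hu)),
    fun a ha l m h hm => ?_⟩
  · have h1 := hr _ _ _ hm
    change F.1 (vecBlowup a l m) ≠ 0 at h1
    rw [hFv] at h1
    exact ne_zero_of_pow_mul 𝒟 h1

end Denominator

end Igusa

namespace Igusa

/-! ### Moduli points in the charts -/

namespace Denominator

variable {𝒟 : Denominator}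

lemma NormSet.form_ne_zero (u : 𝒟.NormSet) : u.1 ≠ 0 := by
  intro h
  have h1 := u.tot_eq
  rw [h, map_zero] at h1
  exact zero_ne_one h1

lemma pointP_eq {a : Forms 2} (ha : a ≠ 0) {t : ℂ} {u : 𝒟.NormSet} (hu : a = t • u.1) :
    pointP a ha = pointP u.1 u.form_ne_zero :=
  coneV2.point_congr _ _ _ _ (by rw [hu, sq_smul])

lemma pointX_eq {a : Forms 2} {l m : ℂ} (hl : l ≠ 0) {t : ℂ} (ht : t ≠ 0) {u : 𝒟.NormSet}
    (hu : a = t • u.1) (h : quartic a l m ≠ 0) :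
    ∃ h', pointX a l m h = pointX u.1 1 (m / (l * t ^ 2)) h' := by
  have h1 : quartic a l m = (l * t ^ 2) • quartic u.1 1 (m / (l * t ^ 2)) := by
    rw [hu, quartic_eq_smul 𝒟 hl ht]
  exact ⟨fun h0 => h (by rw [h1, h0, smul_zero]), coneV.point_congr _ _ _ _ h1⟩

lemma pointBlowup_eq {a : Forms 2} (ha : a ≠ 0) {l m : ℂ} (hm : m ≠ 0) {t : ℂ}
    {u : 𝒟.NormSet} (hu : a = t • u.1) (h : quartic a l m ≠ 0) :
    ∃ h', pointBlowup a ha l m h =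
      pointBlowup u.1 u.form_ne_zero (l * t ^ 2 / m) 1 h' := by
  have h1 : quartic a l m = m • quartic u.1 (l * t ^ 2 / m) 1 := by
    rw [hu, quartic_smul, smul_quartic, mul_one, mul_div_cancel₀ _ hm]
  exact ⟨fun h0 => h (by rw [h1, h0, smul_zero]), coneBlowup.point_congr _ _ _ _
    (by rw [hu, quartic_tmul_eq_smul 𝒟 hm])⟩

end Denominator

end Igusa

lemma AlgebraicGeometry.Scheme.PartialMap.hom_congr {X Y : Scheme.{0}} (f : X.PartialMap Y)
    {x y : X} (h : x = y) (hx : x ∈ f.domain) :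
    f.hom ⟨x, hx⟩ = f.hom ⟨y, h ▸ hx⟩ := by
  subst h
  rfl

end

/-! ### Assembly of the theorem from the three charts. -/

open Igusa in
theorem theoremC :
    -- the moduli space of Igusa pencils and the moduli space of `E₆`-quartics are rational
    IsRationalVariety coneV2.quotientToSpec ∧ IsRationalVariety coneV.quotientToSpec ∧
    -- there is a rational map `f : 𝒳 ⇢ 𝒫ᴵ` over `ℂ`
    ∃ f : moduliX.PartialMap moduliP,
      f.hom ≫ coneV2.quotientToSpec = f.domain.ι ≫ coneV.quotientToSpec ∧
      -- that sends every `[X]` in its domain, `X = div(λ a² + μ b)`, to the Igusa pencil of `X`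
      (∀ (a : Forms 2) (ha : a ≠ 0) (l m : ℂ) (_ : l ≠ 0) (h : quartic a l m ≠ 0)
        (hd : pointX a l m h ∈ f.domain), f.hom ⟨pointX a l m h, hd⟩ = pointP a ha) ∧
      -- it is a fibration in rational curves
      IsRationalCurveFibration f ∧
      -- on the blown-up cone modulo `𝔖₆`, which the blow-down `σ` makes birational to `𝒳`,
      -- the map `f' = f ∘ σ` has a rational section `t`, given by the exceptional divisor
      (∃ (σ : moduliBlowup.PartialIso moduliX) (f' : moduliBlowup.PartialMap moduliP)
          (t : moduliP.PartialMap moduliBlowup),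
        σ.IsOver coneBlowup.quotientToSpec coneV.quotientToSpec ∧
        (∀ (a : Forms 2) (ha : a ≠ 0) (l m : ℂ) (h : quartic a l m ≠ 0)
          (hd : pointBlowup a ha l m h ∈ σ.toPartialMap.domain),
          σ.toPartialMap.hom ⟨pointBlowup a ha l m h, hd⟩ = pointX a l m h) ∧
        IsRationalComp σ.toPartialMap f f' ∧
        t.hom ≫ coneBlowup.quotientToSpec = t.domain.ι ≫ coneV2.quotientToSpec ∧
        (∀ (a : Forms 2) (ha : a ≠ 0) (h : quartic a 0 1 ≠ 0) (hd : pointP a ha ∈ t.domain),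
          t.hom ⟨pointP a ha, hd⟩ = pointBlowup a ha 0 1 h) ∧
        IsRationalComp t f' (Scheme.PartialMap.id moduliP)) ∧
      -- hence `𝒳` is birational to `𝒫ᴵ × ℙ¹`, compatibly with `f` and the first projection
      ∃ e : moduliX.PartialIso
          (Limits.pullback coneV2.quotientToSpec (projLineToSpec (.of ℂ))),
        e.IsOver coneV.quotientToSpec (Limits.pullback.fst _ _ ≫ coneV2.quotientToSpec) ∧
        IsRationalComp e.toPartialMap
          (Limits.pullback.fst coneV2.quotientToSpec (projLineToSpec (.of ℂ))).toPartialMap f := by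
  obtain ⟨𝒟⟩ := nonempty_denominator
  obtain ⟨φ, hφ, hφi⟩ := 𝒟.exists_isOpenImmersion
  obtain ⟨jP, hjP, hjPd, hP, hPp, hPr⟩ := 𝒟.exists_chart_moduliP
  obtain ⟨jX, hjX, hjXd, hX, hXp, hXr⟩ := 𝒟.exists_chart_moduliX
  obtain ⟨jB, hjB, hjBd, hB, hBp, hBr⟩ := 𝒟.exists_chart_moduliBlowup
  obtain ⟨f, hf, hfd, hfp, hfib, ⟨σ, f', t, hσ, hσd, hσp, hσf, ht, htd, htp, htf⟩, he⟩ :=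
    exists_maps_of_charts jP jX jB hP hX hB
  refine ⟨isRationalVariety_of_chart jP hP φ hφi,
    isRationalVariety_of_polynomial_chart jX hX φ hφi, f, hf, fun a ha l m hl h hd => ?_, hfib,
    ⟨σ, f', t, hσ, fun a ha l m h hd => ?_, hσf, ht, fun a ha h hd => ?_, htf⟩, he⟩
  -- Each of the three formulas is checked on all moduli points in the domain by rescaling `a` to
  -- total weight one, where the charts describe the points.
  · have hF := (hXr a l m h (hfd ▸ hd)).2
    obtain ⟨u, hu⟩ := Denominator.exists_eq_smul hF
    obtain ⟨h', hx⟩ := Denominator.pointX_eq hl (Denominator.tot_ne_zero hF) hu h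
    rw [f.hom_congr (hx.trans (hXp u _ h').symm) hd, hfp,
      hPp u u.form_ne_zero, Denominator.pointP_eq ha hu]
  · obtain ⟨hm, hF⟩ := hBr a ha l m h (hσd hd)
    obtain ⟨u, hu⟩ := Denominator.exists_eq_smul hF
    obtain ⟨h', hx⟩ := Denominator.pointBlowup_eq ha hm hu h
    have hx' := hx.trans (hBp u _ u.form_ne_zero h').symm
    obtain ⟨hc, hv⟩ := hσp (Denominator.evalAt u) _ (hx' ▸ hd)
    -- The chart coordinate is `l (tot a)² / m`, which is nonzero on the domain of `σ`: the
    -- exceptional divisor is excluded there.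
    have hl : l ≠ 0 := by
      rintro rfl
      simp at hc
    obtain ⟨h'', hy⟩ := Denominator.pointX_eq hl (Denominator.tot_ne_zero hF) hu h
    rw [σ.toPartialMap.hom_congr hx' hd, hv, hy, ← hXp, inv_div]
  · have hF := hPr a ha (htd ▸ hd)
    obtain ⟨u, hu⟩ := Denominator.exists_eq_smul hF
    obtain ⟨h', hx⟩ := Denominator.pointBlowup_eq ha one_ne_zero hu h
    rw [t.hom_congr ((Denominator.pointP_eq ha hu).trans (hPp u u.form_ne_zero).symm) hd, htp, hx,
      ← hBp]
    simp
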